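/- For integers $0\le k\le n$ and $p\in(0,1)$, let $C$ be a uniformly random $n$-qubit Clifford operator (modulo global phase, given classically by its tableau, i.e. by the signed Pauli strings $CX_iC^\dagger$, $CZ_iC^\dagger$ for $i=1,\dots,n$), and let $E=E_1\otimes\cdots\otimes E_n$ be a random Pauli string with independent factors, where $E_j=I$ with probability $1-p$ and $E_j=X,Y,Z$ with probability $p/3$ each. * **Search $\mathsf{LSN}(k,n,p)$:** given $(C,\;EC|0^{n-k},x\rangle)$ with $x\in\{0,1\}^k$ uniformly random, find $x$. The success probability is taken over $C$, $E$, $x$ and the solver's internal randomness. * **Search $\mathsf{sLSN}(k,n,p)$:** given $(C,\;EC|0^{n-k},\psi\rangle)$ with $|\psi\rangle=U|0^k\rangle$ for a Haar-random unitary $U$ on $k$ qubits, output a $k$-qubit state $\rho$. The average fidelity is the expectation of $\langle\psi|\rho|\psi\rangle$ over $C$, $E$, $\psi$ and the solver's internal randomness. An oracle for Search $\mathsf{LSN}(k,n,p)$ takes a classical tableau and an $n$-qubit state, and answers with $k$ classical bits obtained by an arbitrary quantum measurement (depending on the tableau) of the state, which is consumed. A quantum algorithm is a single program for all $n$, run on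 a classical random-access machine (with addition and subtraction) that controls a memory of qubits through the gates $H$, $T$, $CX$ and computational-basis measurements, one step per instruction; it gets $n$ and $k$ as part of its input. "$f(n)\ge g(n)+1/\mathrm{poly}(n)$" means that there is a $d\in\mathbb N$ with $f(n)\ge g(n)+n^{-d}$ for all sufficiently large $n$. Throughout, $k=k(n)\le n$ and $p=p(n)\in(0,1)$ may be arbitrary functions of $n$. 1. **Few logical qubits.** There is a quantum oracle algorithm $\mathcal B$, running in time $\mathrm{poly}(n)$ and making a single call to its oracle, such that the following holds for all $k=O(\log n)$, all $p$ and all oracles $\mathcal O$: if $\mathcal O$ solves Search $\mathsf{LSN}(k,n,p)$ with probability at least $\frac1{2^k}+\frac1{\mathrm{poly}(n)}$, then $\mathcal B^{\mathcal O}$ solves Search $\mathsf{sLSN}(k,n,p)$ with average fidelity at least $\frac1{2^k}+\frac1{\mathrm{poly}(n)}$. 2. **Arbitrary $k$, high success probability.** There is a quantum oracle algorithm $\mathcal B$, running in time $\mathrm{poly}(n)$ and making two calls to its oracle, such that the following holds for all $k$, all $p$ and all oracles $\mathcal O$: if $\mathcal O$ solves Search $\mathsf{LSN}(k,n,p)$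 with probability at least $\frac12\bigl(1+\frac1{2^k}+\frac1{\mathrm{poly}(n)}\bigr)$, then $\mathcal B^{\mathcal O}$ solves Search $\mathsf{sLSN}(k,n,p)$ with average fidelity at least $\frac1{2^k}+\frac1{\mathrm{poly}(n)}$. Moreover, for all $k$ and $p$, if there is a quantum algorithm (without oracle) running in time $\mathrm{poly}(n)$ that solves Search $\mathsf{LSN}(k,n,p)$ with probability at least $\frac12\bigl(1+\frac1{2^k}+\frac1{\mathrm{poly}(n)}\bigr)$, then there is a quantum algorithm (without oracle) running in time $\mathrm{poly}(n)$ that solves Search $\mathsf{sLSN}(k,n,p)$ with average fidelity at least $\frac1{2^k}+\frac1{\mathrm{poly}(n)}$. -/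

import Mathlib

open MeasureTheory Filter
open scoped Matrix

noncomputable section

namespace LSN

/-! ## States, Pauli operators, Clifford operators -/

/-- Classical strings of `n` bits, labelling the computational basis of `n` qubits. -/
abbrev Bits (n : ℕ) := Fin n → Bool

/-- Vectors of amplitudes of `n` qubits. -/
abbrev Ket (n : ℕ) := Bits n → ℂ

/-- Linear operators on `n` qubits. -/
abbrev Op (n : ℕ) := Matrix (Bits n) (Bits n) ℂ

/-- The basis vector `|x⟩`. -/
def basisKet {n : ℕ} (x : Bits n) : Ket n := Pi.single x 1

/-- The squared Euclidean norm of a vector. -/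
def ketNormSq {n : ℕ} (v : Ket n) : ℝ := ∑ b, ‖v b‖ ^ 2

/-- The Pauli matrices `I, X, Z, Y`, labelled by `(0,0), (1,0), (0,1), (1,1)`;
`false` and `true` stand for the basis states `|0⟩` and `|1⟩`. -/
def pauliMatrix : Bool × Bool → Matrix Bool Bool ℂ
  | (false, false) => 1
  | (true, false) => Matrix.of fun r c => if r = c then 0 else 1
  | (false, true) => Matrix.of fun r c => if r = c then (if r then -1 else 1) else 0
  | (true, true) => Matrix.of fun r c =>
      if r = c then 0 else if r then Complex.I else -Complex.I

/-- Phase-free Pauli strings on `n` qubits, in symplectic form: `(P j).1` is the `X`-bit and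
`(P j).2` the `Z`-bit at qubit `j`. -/
abbrev PauliString (n : ℕ) := Fin n → Bool × Bool

/-- The operator `P₁ ⊗ ⋯ ⊗ Pₙ`. -/
def pauliOp {n : ℕ} (P : PauliString n) : Op n :=
  Matrix.of fun r c => ∏ j, pauliMatrix (P j) (r j) (c j)

/-- A unitary that maps Pauli strings to Pauli strings, up to phases, under conjugation. -/
def IsClifford {n : ℕ} (V : Op n) : Prop :=
  V ∈ Matrix.unitaryGroup (Bits n) ℂ ∧
    ∀ P : PauliString n, ∃ Q : PauliString n, ∃ c : ℂ,
      (c = 1 ∨ c = -1 ∨ c = Complex.I ∨ c = -Complex.I) ∧ V * pauliOp P * Vᴴ = c • pauliOp Q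

/-- A Pauli string with a sign; `true` is the sign `-1`. -/
abbrev SignedPauli (n : ℕ) := PauliString n × Bool

def signedPauliOp {n : ℕ} (P : SignedPauli n) : Op n :=
  if P.2 then -pauliOp P.1 else pauliOp P.1

/-- The generators `X_i` (`Sum.inl i`) and `Z_i` (`Sum.inr i`) of the Pauli group. -/
def generator {n : ℕ} : Fin n ⊕ Fin n → PauliString n
  | Sum.inl i => fun j => (decide (j = i), false)
  | Sum.inr i => fun j => (false, decide (j = i))

/-- Classical descriptions of `n`-qubit Clifford operators: the signed Pauli strings
`C X_i C†` (`Sum.inl i`) and `C Z_i C†` (`Sum.inr i`). -/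
abbrev Tableau (n : ℕ) := Fin n ⊕ Fin n → SignedPauli n

/-- `V` is a Clifford operator with tableau `T`. -/
def HasTableau {n : ℕ} (V : Op n) (T : Tableau n) : Prop :=
  IsClifford V ∧ ∀ g, V * pauliOp (generator g) * Vᴴ = signedPauliOp (T g)

open Classical in
/-- The `n`-qubit Clifford group modulo global phases: a Clifford operator is determined up to
a global phase by its tableau, so the group is listed through the tableaux that occur. -/
def cliffords (n : ℕ) : Finset (Tableau n) :=
  Finset.univ.filter fun T => ∃ V : Op n, HasTableau V T

open Classical in
/-- The Clifford operator with tableau `T` (fixed up to an irrelevant global phase). -/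
def cliffordOp {n : ℕ} (T : Tableau n) : Op n :=
  if h : ∃ V : Op n, HasTableau V T then h.choose else 1

/-! ## Samples: noise, encoding, Haar-random states -/

/-- The probability of the Pauli string `E` under `n`-fold depolarizing noise of rate `p`. -/
def depolarizing {n : ℕ} (p : ℝ) (E : PauliString n) : ℝ :=
  ∏ j, if E j = (false, false) then 1 - p else p / 3

/-- The state `|0^{n-k}, ψ⟩`. -/
def padKet {n k : ℕ} (hk : k ≤ n) (ψ : Ket k) : Ket n := fun b =>
  if ∀ j : Fin n, (j : ℕ) < n - k → b j = false then
    ψ fun i => b ⟨n - k + i, by omega⟩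
  else 0

/-- The noisy encoded state `E C |0^{n-k}, ψ⟩`. -/
def noisyCodeword {n k : ℕ} (hk : k ≤ n) (T : Tableau n) (E : PauliString n) (ψ : Ket k) :
    Ket n :=
  (pauliOp E * cliffordOp T) *ᵥ padKet hk ψ

instance compactSpace_unitaryGroup (ι : Type) [Fintype ι] [DecidableEq ι] :
    CompactSpace (Matrix.unitaryGroup ι ℂ) := by
  suffices h : IsCompact (Matrix.unitaryGroup ι ℂ : Set (Matrix ι ι ℂ)) from
    isCompact_iff_compactSpace.mp h
  have hc : IsCompact (Set.pi Set.univ fun _ : ι =>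
      Set.pi Set.univ fun _ : ι => Metric.closedBall (0 : ℂ) 1) :=
    isCompact_univ_pi fun _ => isCompact_univ_pi fun _ => isCompact_closedBall _ _
  refine hc.of_isClosed_subset (isClosed_unitary (R := Matrix ι ι ℂ)) ?_
  intro U hU i _ j _
  simpa using entry_norm_bound_of_unitary hU i j

instance measurableSpace_unitaryGroup (ι : Type) [Fintype ι] [DecidableEq ι] :
    MeasurableSpace (Matrix.unitaryGroup ι ℂ) := borel _

instance borelSpace_unitaryGroup (ι : Type) [Fintype ι] [DecidableEq ι] :
    BorelSpace (Matrix.unitaryGroup ι ℂ) := ⟨rfl⟩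

/-- The Haar probability measure on the group of unitary operators on `k` qubits. -/
def haarUnitary (k : ℕ) : Measure (Matrix.unitaryGroup (Bits k) ℂ) := Measure.haarMeasure ⊤

/-- The law of a Haar-random `k`-qubit state, i.e. of `U |0^k⟩` for Haar-random `U`. -/
def haarState (k : ℕ) : Measure (Ket k) :=
  (haarUnitary k).map fun U : Matrix.unitaryGroup (Bits k) ℂ => (U : Op k) *ᵥ basisKet fun _ => false

/-- The average of `f C (E C |0^{n-k}, x⟩) x` over a uniformly random Clifford operator `C`,
depolarizing noise `E` and a uniformly random string `x`. If `f T φ x` is the probability that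
a solver answers `x` on the sample `(T, φ)`, this is the probability that the solver finds
the secret of a random sample of Search LSN. -/
def lsnAverage {n k : ℕ} (hk : k ≤ n) (p : ℝ) (f : Tableau n → Ket n → Bits k → ℝ) : ℝ :=
  (∑ T ∈ cliffords n, ∑ E : PauliString n, ∑ x : Bits k,
    depolarizing p E * f T (noisyCodeword hk T E (basisKet x)) x) / ((cliffords n).card * 2 ^ k)

/-- The average of `f C (E C |0^{n-k}, ψ⟩) ψ` over a uniformly random Clifford operator `C`,
depolarizing noise `E` and a Haar-random `k`-qubit state `ψ`. If `f T φ ψ` is the fidelity with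
`ψ` of the output of a solver on the sample `(T, φ)`, this is the average fidelity of the
solver on a random sample of Search sLSN. -/
def slsnAverage {n k : ℕ} (hk : k ≤ n) (p : ℝ) (f : Tableau n → Ket n → Ket k → ℝ) : ℝ :=
  (∑ T ∈ cliffords n, ∑ E : PauliString n,
    depolarizing p E * ∫ ψ, f T (noisyCodeword hk T E ψ) ψ ∂haarState k) / (cliffords n).card

/-! ## Oracles -/

/-- An oracle that takes a Clifford tableau and an `n`-qubit state and answers with `k` bits:
for every tableau, a general quantum measurement given by its measurement operators. -/
structure Oracle (n k : ℕ) where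
  op : Tableau n → Bits k → Op n
  complete : ∀ T, ∑ x, (op T x)ᴴ * op T x = 1

/-- The probability of the answer `x` on the tableau `T` and the state `φ`. -/
def Oracle.prob {n k : ℕ} (O : Oracle n k) (T : Tableau n) (φ : Ket n) (x : Bits k) : ℝ :=
  ketNormSq (O.op T x *ᵥ φ)

/-- The success probability of an oracle for Search LSN with parameters `k, n, p`. -/
def Oracle.lsnSuccess {n k : ℕ} (hk : k ≤ n) (p : ℝ) (O : Oracle n k) : ℝ :=
  lsnAverage hk p O.prob

/-! ## Quantum algorithms

A classical random access machine that controls a quantum memory. The classical memory consists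
of variables and arrays of natural numbers, the quantum memory of arrays of qubits; variables and
arrays are named by natural numbers. Arithmetic is restricted to addition and subtraction, so that
counting one step per instruction is polynomially equivalent to counting bit operations. A loop
fixes its number of rounds on entry; for computations with a polynomial time bound this is no
restriction, as the time bound can serve as the number of rounds. The quantum instructions are the
universal gate set `H`, `T`, `CX` and the measurement of a qubit in the computational basis. -/

/-- The address of a qubit: the name of an array of qubits, and an index. -/
abbrev Qubit := ℕ × ℕ

/-- Vectors of the quantum memory; the basis vector `S` is the one in which exactly the qubits
in `S` are in the state `|1⟩`. -/
abbrev QMem := Finset Qubit →₀ ℂ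

/-- The linear map on the quantum memory with the given values on basis vectors. -/
def onBasis (f : Finset Qubit → QMem) (v : QMem) : QMem := v.sum fun S z => z • f S

def qmemNormSq (v : QMem) : ℝ := v.sum fun _ z => ‖z‖ ^ 2

def gateH (q : Qubit) : QMem → QMem := onBasis fun S =>
  Finsupp.single (S.erase q) ((1 / Real.sqrt 2 : ℝ) : ℂ) +
    Finsupp.single (insert q S) ((if q ∈ S then -1 / Real.sqrt 2 else 1 / Real.sqrt 2 : ℝ) : ℂ)

def gateT (q : Qubit) : QMem → QMem := onBasis fun S =>
  Finsupp.single S (if q ∈ S then Complex.exp (Real.pi / 4 * Complex.I) else 1)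

/-- The gate `CX` with control `c` and target `t`; the identity if `c = t`. -/
def gateCX (c t : Qubit) : QMem → QMem := onBasis fun S =>
  Finsupp.single (if c ∈ S ∧ c ≠ t then symmDiff S {t} else S) 1

/-- The projection onto the subspace in which the qubit `q` is in the state `|b⟩`. -/
def projectQubit (q : Qubit) (b : Bool) : QMem → QMem := onBasis fun S =>
  if decide (q ∈ S) = b then Finsupp.single S 1 else 0

/-- The values of the qubits `(a, 0), …, (a, m - 1)` in a basis vector. -/
def readBits (a m : ℕ) (S : Finset Qubit) : Bits m := fun i => decide ((a, (i : ℕ)) ∈ S)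

/-- The other qubits of a basis vector, with `(a, 0), …, (a, m - 1)` set to `|0⟩`. -/
def clearBits (a m : ℕ) (S : Finset Qubit) : Finset Qubit :=
  S.filter fun q => ¬(q.1 = a ∧ q.2 < m)

/-- The basis vector in which the qubits `(a, 0), …, (a, m - 1)` have the values `b`, and all
others are in the state `|0⟩`. -/
def writeBits (a m : ℕ) (b : Bits m) : Finset Qubit :=
  ((Finset.univ : Finset (Fin m)).filter fun i => b i = true).image fun i : Fin m => (a, (i : ℕ))

/-- Apply the operator `|0^m⟩⟨w|` to the qubits `(a, 0), …, (a, m - 1)`, where `w` is given by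
the entries of the row vector `⟨w|`. -/
def contract (a m : ℕ) (w : Bits m → ℂ) : QMem → QMem := onBasis fun S =>
  Finsupp.single (clearBits a m S) (w (readBits a m S))

/-- The configurations of the machine. The vector is not normalized: its squared norm is the
probability of the measurement outcomes that have led to the configuration. -/
structure Config where
  var : ℕ → ℕ
  arr : ℕ → ℕ → ℕ
  vec : QMem
  time : ℕ
  calls : ℕ

namespace Config

def tick (s : Config) : Config := { s with time := s.time + 1 }

def setVar (s : Config) (x m : ℕ) : Config := { s with var := Function.update s.var x m }

def setArr (s : Config) (a i m : ℕ) : Config :=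
  { s with arr := Function.update s.arr a (Function.update (s.arr a) i m) }

/-- Write a bit string to the first entries of an array. -/
def setBits {m : ℕ} (s : Config) (a : ℕ) (x : Bits m) : Config :=
  { s with arr := Function.update s.arr a fun i =>
      if h : i < m then (x ⟨i, h⟩).toNat else s.arr a i }

/-- Read a bit string from the first entries of an array. -/
def getBits (s : Config) (a m : ℕ) : Bits m := fun i => decide (s.arr a i ≠ 0)

def mapVec (s : Config) (f : QMem → QMem) : Config := { s with vec := f s.vec }

end Config

/-- The `2n` rows of a tableau: `n` rows for the `C X_i C†`, then `n` rows for the `C Z_i C†`. -/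
def rowIndex {n : ℕ} : Fin n ⊕ Fin n → ℕ
  | Sum.inl i => i
  | Sum.inr i => n + i

/-- The row with a given index. -/
def rowOfIndex (n r : ℕ) : Option (Fin n ⊕ Fin n) :=
  if h : r < n then some (Sum.inl ⟨r, h⟩)
  else if h' : r - n < n then some (Sum.inr ⟨r - n, h'⟩)
  else none

/-- The tableau stored in three arrays: the `X`-bit and the `Z`-bit of row `r` at qubit `j` are
entry `r * n + j` of the arrays `ax` and `az`, and the sign of row `r` is entry `r` of the
array `asgn`. -/
def Config.getTableau (s : Config) (n ax az asgn : ℕ) : Tableau n := fun g =>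
  (fun j => (decide (s.arr ax (rowIndex g * n + j) ≠ 0),
    decide (s.arr az (rowIndex g * n + j) ≠ 0)),
   decide (s.arr asgn (rowIndex g) ≠ 0))

/-- The value of a bit of a tableau at the entry `r * n + j`, and `0` outside the table. -/
def tableEntry {n : ℕ} (f : Fin n ⊕ Fin n → Fin n → Bool) (m : ℕ) : ℕ :=
  match rowOfIndex n (m / n) with
  | some g => if h : m % n < n then (f g ⟨m % n, h⟩).toNat else 0
  | none => 0

/-- The initial configuration on input `(T, φ)`: `n` and `k` are in the variables `0` and `1`,
the tableau `T` is in the arrays `0, 1, 2`, the state `φ` in the qubits `(0, 0), …, (0, n - 1)`;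
everything else is zero. -/
def Config.start {n : ℕ} (k : ℕ) (T : Tableau n) (φ : Ket n) : Config where
  var := fun x => if x = 0 then n else if x = 1 then k else 0
  arr := fun a m =>
    if a = 0 then tableEntry (fun g j => ((T g).1 j).1) m
    else if a = 1 then tableEntry (fun g j => ((T g).1 j).2) m
    else if a = 2 then
      match rowOfIndex n m with
      | some g => (T g).2.toNat
      | none => 0
    else 0
  vec := ∑ b : Bits n, Finsupp.single (writeBits 0 n b) (φ b)
  time := 0
  calls := 0

/-- Programs. In `load`, `store` and the quantum instructions, `a` and `b` are names of arrays
(of numbers or of qubits), and `i` and `j` are variables that hold the index. -/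
inductive Program
  /-- `x := m` -/
  | const (x m : ℕ)
  /-- `x := y + z` -/
  | add (x y z : ℕ)
  /-- `x := y - z`, or `0` if this is negative -/
  | sub (x y z : ℕ)
  /-- `x := a[i]` -/
  | load (x a i : ℕ)
  /-- `a[i] := x` -/
  | store (a i x : ℕ)
  /-- apply `H` to the qubit `a[i]` -/
  | had (a i : ℕ)
  /-- apply `T` to the qubit `a[i]` -/
  | tgate (a i : ℕ)
  /-- apply `CX` with control `a[i]` and target `b[j]` -/
  | cx (a i b j : ℕ)
  /-- measure the qubit `a[i]`, and store the outcome in `x` -/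
  | meas (x a i : ℕ)
  /-- query the oracle on the tableau in the arrays `ax, az, asgn` and the first `n` qubits of the
  array of qubits `a`, and store the answer in the array `out` -/
  | query (ax az asgn a out : ℕ)
  /-- first `P`, then `Q` -/
  | seq (P Q : Program)
  /-- if `x ≠ 0` then `P` else `Q` -/
  | ite (x : ℕ) (P Q : Program)
  /-- repeat `P`, as many times as the value of `x` says when the loop is entered -/
  | loop (x : ℕ) (P : Program)

/-- Run a branching computation `m` times in succession. -/
def repeatRun (f : Config → Multiset Config) : ℕ → Config → Multiset Config
  | 0, s => {s}
  | m + 1, s => (f s).bind (repeatRun f m)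

/-- The final configurations of a program, one for every sequence of measurement outcomes.
The oracle consumes its `n` qubits: they are measured and reset to `|0⟩` after the query. Without
an oracle (`none`) a query has no effect. -/
def Program.run {n k : ℕ} (O : Option (Oracle n k)) : Program → Config → Multiset Config
  | const x m, s => {s.tick.setVar x m}
  | add x y z, s => {s.tick.setVar x (s.var y + s.var z)}
  | sub x y z, s => {s.tick.setVar x (s.var y - s.var z)}
  | load x a i, s => {s.tick.setVar x (s.arr a (s.var i))}
  | store a i x, s => {s.tick.setArr a (s.var i) (s.var x)}
  | had a i, s => {s.tick.mapVec (gateH (a, s.var i))}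
  | tgate a i, s => {s.tick.mapVec (gateT (a, s.var i))}
  | cx a i b j, s => {s.tick.mapVec (gateCX (a, s.var i) (b, s.var j))}
  | meas x a i, s => (Finset.univ : Finset Bool).val.map fun b =>
      (s.tick.setVar x b.toNat).mapVec (projectQubit (a, s.var i) b)
  | query ax az asgn a out, s =>
      match O with
      | none => {s.tick}
      | some O => (Finset.univ : Finset (Bits k × Bits n)).val.map fun o =>
          { (s.tick.setBits out o.1).mapVec
              (contract a n (O.op (s.getTableau n ax az asgn) o.1 o.2)) with
            calls := s.calls + 1 }
  | seq P Q, s => (P.run O s).bind (Q.run O)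
  | ite x P Q, s => if s.var x = 0 then Q.run O s.tick else P.run O s.tick
  | loop x P, s => repeatRun (fun s' => P.run O s'.tick) (s.var x) s.tick

/-- The probability that a program, started on `(T, φ)`, ends with the bit string `x` in the
array `3`. -/
def Program.outputProb {n k : ℕ} (O : Option (Oracle n k)) (P : Program) (T : Tableau n)
    (φ : Ket n) (x : Bits k) : ℝ :=
  ((P.run O (Config.start k T φ)).map fun s =>
    if s.getBits 3 k = x then qmemNormSq s.vec else 0).sum

/-- The fidelity `⟨ψ|ρ|ψ⟩` of the final state `ρ` of the qubits `(1, 0), …, (1, k - 1)`, for a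
program started on `(T, φ)`. -/
def Program.outputFidelity {n k : ℕ} (O : Option (Oracle n k)) (P : Program) (T : Tableau n)
    (φ : Ket n) (ψ : Ket k) : ℝ :=
  ((P.run O (Config.start k T φ)).map fun s =>
    qmemNormSq (contract 1 k (fun b => star (ψ b)) s.vec)).sum

/-- The probability that a program solves a random sample of Search LSN. -/
def Program.lsnSuccess {n k : ℕ} (hk : k ≤ n) (p : ℝ) (O : Option (Oracle n k))
    (P : Program) : ℝ :=
  lsnAverage hk p (P.outputProb O)

/-- The average fidelity of the output of a program on a random sample of Search sLSN. -/
def Program.slsnFidelity {n k : ℕ} (hk : k ≤ n) (p : ℝ) (O : Option (Oracle n k))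
    (P : Program) : ℝ :=
  slsnAverage hk p (P.outputFidelity O)

/-- On every input with parameters `n, k`, and for all measurement outcomes, the program takes
at most `t` steps. -/
def Program.TimeAtMost {n k : ℕ} (O : Option (Oracle n k)) (P : Program) (t : ℕ) : Prop :=
  ∀ T ∈ cliffords n, ∀ φ : Ket n, ∀ s ∈ P.run O (Config.start k T φ), s.time ≤ t

/-- On every input with parameters `n, k`, and for all measurement outcomes, the program makes
exactly `m` queries. -/
def Program.CallsExactly {n k : ℕ} (O : Option (Oracle n k)) (P : Program) (m : ℕ) : Prop :=
  ∀ T ∈ cliffords n, ∀ φ : Ket n, ∀ s ∈ P.run O (Config.start k T φ), s.calls = m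

/-- `f n ≥ g n + 1 / poly(n)`. -/
def ExceedsByInvPoly (f g : ℕ → ℝ) : Prop :=
  ∃ d : ℕ, ∀ᶠ n : ℕ in atTop, g n + 1 / (n : ℝ) ^ d ≤ f n

end LSN

end

/-! ### The quantum memory as a vector space: tensor factors, norms, registers, derived gates. -/

noncomputable section

namespace LSN

/-! ## Linear algebra of the quantum memory -/

/-! Noise can be pushed through the encoding: `E C = C (C† E C)`, and `C† E C` is a Pauli operator
up to phase, determined by which rows of the tableau fail to commute with `E`. Hence `E C|0,ψ⟩ = μ
C|t, X^a Z^b ψ⟩`, where `|μ| = 1`, the syndrome `t` and the string `a` come from the rows `C Z_i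
C†`, and `b` comes from the logical rows `C X_i C†` (`HasTableau.noise`, `noisyCodeword_eq`). For `ψ
= |x⟩` this is `C|t, x ⊕ a⟩` up to a phase. So a solver for Search LSN, shown `C|t,u⟩` for a uniform
`u`, is asked for `u ⊕ a`; in effect it predicts the logical error `a` from the syndrome.

For few logical qubits, one measures and prepares: the sample goes to the oracle, and the basis
state `|x⟩` of its answer is the output (`guessProg`). With `N = 2^k`, the Haar moments
`E|ψ_x|²|ψ_y|²` are `1/(N(N+1))` for `x ≠ y` and twice that for `x = y`, and all mixed terms that
occur vanish. The average fidelity is therefore determined by the behaviour of the oracle on basis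
states, and equals exactly `(1 + s)/(N + 1)` for success probability `s` (`integral_ketNormSq_mul`,
`guessProg_slsnFidelity`). An advantage `ε` over `1/N` becomes `ε/(N + 1)`, which stays inverse
polynomial when `k = O(log n)`.

For arbitrary `k`, both `a` and `b` are found and the error is undone (`reduction`). The tableau of
`C (I ⊗ H ⊗ ⋯ ⊗ H)` arises from that of `C` by exchanging `X` and `Z` rows on the logical qubits; it
has the same syndrome, and its logical `X`-error is `b`. This twist is an involution of the Clifford
group, so a query on the twisted tableau is again a uniformly random instance
(`sum_cliffords_twist`). The reduction moves `t` and the state `X^a Z^b ψ` out of the codeword,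
tosses coins `u`, prepares fresh copies of `C|t,u⟩` and of its twisted analogue, asks for `u ⊕ a`
and `u ⊕ b`, and corrects. If `P` and `Q` are the two success probabilities for fixed `C, E, u`,
then `ψ` is restored with probability at least `PQ ≥ P + Q - 1`; averaging gives fidelity at least
`2s - 1` (`reduction_slsnFidelity_ge`), which is the bound wanted when `s ≥ (1 + 2^{-k} + ε)/2`.

No circuit for `C` is ever synthesized. A controlled row of the tableau acts on encoded bits as a
controlled `X_i` or `Z_i`. This suffices to move an encoded bit to a fresh qubit (`swapOp_enc`), and
to create `C|w⟩` from `|0…0⟩` up to an unentangled ancilla state (`flipSeq_swapSeq`).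

The oracle and an algorithm without oracle are treated alike through `Answers`: each call runs in
its own private part of the memory and acts on one tensor factor only. For an algorithm this rests
on renaming its memory (`run_rename`) and on conservation of probability over all branches
(`totalNormSq_run`). -/

theorem onBasis_eq (f : Finset Qubit → QMem) (v : QMem) :
    onBasis f v = Finsupp.linearCombination ℂ f v := rfl

theorem onBasis_add (f : Finset Qubit → QMem) (v w : QMem) :
    onBasis f (v + w) = onBasis f v + onBasis f w := by simp [onBasis_eq]

theorem onBasis_smul (f : Finset Qubit → QMem) (c : ℂ) (v : QMem) :
    onBasis f (c • v) = c • onBasis f v := by simp [onBasis_eq]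

theorem onBasis_zero (f : Finset Qubit → QMem) : onBasis f 0 = 0 := by simp [onBasis_eq]

theorem onBasis_sum {ι : Type*} (f : Finset Qubit → QMem) (s : Finset ι) (v : ι → QMem) :
    onBasis f (∑ i ∈ s, v i) = ∑ i ∈ s, onBasis f (v i) := by simp [onBasis_eq]

theorem onBasis_single (f : Finset Qubit → QMem) (S : Finset Qubit) (z : ℂ) :
    onBasis f (Finsupp.single S z) = z • f S := by simp [onBasis_eq]

theorem onBasis_isLinear (f : Finset Qubit → QMem) : IsLinearMap ℂ (onBasis f) :=
  ⟨onBasis_add f, onBasis_smul f⟩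

theorem isLinearMap_comp {F G : QMem → QMem} (hF : IsLinearMap ℂ F) (hG : IsLinearMap ℂ G) :
    IsLinearMap ℂ fun v => F (G v) :=
  ⟨fun u v => by rw [hG.map_add, hF.map_add], fun c v => by rw [hG.map_smul, hF.map_smul]⟩

theorem qmem_lhom_ext {M : Type*} [AddCommMonoid M] [Module ℂ M] {f g : QMem →ₗ[ℂ] M}
    (h : ∀ S, f (Finsupp.single S 1) = g (Finsupp.single S 1)) : f = g :=
  Finsupp.lhom_ext' fun S => LinearMap.ext_ring (h S)

theorem eq_of_basis {F G : QMem → QMem} (hF : IsLinearMap ℂ F) (hG : IsLinearMap ℂ G)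
    (h : ∀ S, F (Finsupp.single S 1) = G (Finsupp.single S 1)) (v : QMem) : F v = G v := by
  have : hF.mk' F = hG.mk' G := qmem_lhom_ext h
  exact congrArg (fun f => f v) this

/-- The tensor product of vectors that live on disjoint sets of qubits. -/
def tens : QMem →ₗ[ℂ] QMem →ₗ[ℂ] QMem :=
  Finsupp.linearCombination ℂ fun S => Finsupp.lmapDomain ℂ ℂ fun R => S ∪ R

@[simp] theorem tens_single (S R : Finset Qubit) (a b : ℂ) :
    tens (Finsupp.single S a) (Finsupp.single R b) = Finsupp.single (S ∪ R) (a * b) := by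
  simp [tens, Finsupp.mapDomain_single]

theorem tens_comm (u v : QMem) : tens u v = tens v u := by
  suffices h : tens = tens.flip by exact congrArg (fun f => f u v) h
  refine qmem_lhom_ext fun S => qmem_lhom_ext fun R => ?_
  simp [Finset.union_comm]

theorem tens_assoc (u v w : QMem) : tens (tens u v) w = tens u (tens v w) := by
  induction u using Finsupp.induction_linear with
  | zero => simp
  | add u u' h h' => simp [h, h']
  | single S a =>
    induction v using Finsupp.induction_linear with
    | zero => simp
    | add u u' h h' => simp [h, h']
    | single R b =>
      induction w using Finsupp.induction_linear with
      | zero => simp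
      | add u u' h h' => rw [map_add, map_add, map_add, h, h']
      | single Q c => simp only [tens_single, Finset.union_assoc, mul_assoc]

theorem tens_left_comm (u v w : QMem) : tens u (tens v w) = tens v (tens u w) := by
  rw [← tens_assoc, tens_comm u v, tens_assoc]

/-- The vector with all qubits in the state `|0⟩`. -/
def vac : QMem := Finsupp.single ∅ 1

@[simp] theorem tens_vac (u : QMem) : tens u vac = u := by
  induction u using Finsupp.induction_linear with
  | zero => simp
  | add u u' h h' => simp [h, h']
  | single S a => simp [vac]

@[simp] theorem vac_tens (u : QMem) : tens vac u = u := by rw [tens_comm, tens_vac]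

/-- The vectors in which only qubits in `A` may differ from `|0⟩`. -/
def Supp (A : Set Qubit) : Submodule ℂ QMem := Finsupp.supported ℂ ℂ {S : Finset Qubit | (S : Set Qubit) ⊆ A}

theorem Supp_mono {A B : Set Qubit} (h : A ⊆ B) : Supp A ≤ Supp B :=
  Finsupp.supported_mono fun _ hS => Set.Subset.trans hS h

theorem single_mem_Supp {A : Set Qubit} {S : Finset Qubit} {z : ℂ} (h : (S : Set Qubit) ⊆ A) :
    Finsupp.single S z ∈ Supp A := Finsupp.single_mem_supported ℂ z h

theorem vac_mem_Supp (A : Set Qubit) : vac ∈ Supp A := single_mem_Supp (by simp)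

theorem Supp_induction {A : Set Qubit} {p : QMem → Prop} (hz : p 0)
    (hadd : ∀ u v, p u → p v → p (u + v))
    (hs : ∀ (S : Finset Qubit) z, (S : Set Qubit) ⊆ A → p (Finsupp.single S z)) {v : QMem} (hv : v ∈ Supp A) :
    p v := by
  have : v = ∑ S ∈ v.support, Finsupp.single S (v S) := (Finsupp.sum_single v).symm
  rw [this]
  refine Finset.sum_induction _ p hadd hz fun S hS => hs S _ ?_
  exact (Finsupp.mem_supported ℂ v).1 hv hS

theorem tens_mem_Supp {A : Set Qubit} {u v : QMem} (hu : u ∈ Supp A) (hv : v ∈ Supp A) :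
    tens u v ∈ Supp A := by
  refine Supp_induction (p := fun u => tens u v ∈ Supp A) (by simp)
    (fun u u' h h' => by simpa using add_mem h h') (fun S z hS => ?_) hu
  refine Supp_induction (p := fun v => tens (Finsupp.single S z) v ∈ Supp A) (by simp)
    (fun u u' h h' => by simpa using add_mem h h') (fun R w hR => ?_) hv
  rw [tens_single]
  exact single_mem_Supp (by simp [hS, hR])

/-- Locality: an operation that ignores the qubits in `B` acts on the first factor alone, and by
linearity this need only be checked on basis vectors. All statements that a gate acts on one tensor
factor are instances. -/
theorem onBasis_tens {B : Set Qubit} {f : Finset Qubit → QMem}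
    (hf : ∀ S R : Finset Qubit, (R : Set Qubit) ⊆ B →
      f (S ∪ R) = tens (f S) (Finsupp.single R 1))
    (u : QMem) {v : QMem} (hv : v ∈ Supp B) : onBasis f (tens u v) = tens (onBasis f u) v := by
  refine Supp_induction (p := fun v => onBasis f (tens u v) = tens (onBasis f u) v)
    (by simp [onBasis_zero]) (fun v v' h h' => by simp [onBasis_add, h, h']) (fun R w hR => ?_) hv
  induction u using Finsupp.induction_linear with
  | zero => simp [onBasis_zero]
  | add u u' h h' => simp [onBasis_add, h, h']
  | single S a =>
    have hw : Finsupp.single R w = w • Finsupp.single R (1 : ℂ) := by simp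
    rw [tens_single, onBasis_single, onBasis_single, hf S R hR, hw]
    simp only [map_smul, LinearMap.smul_apply, smul_smul]
    rw [mul_comm]

theorem gateH_tens {q : Qubit} (u : QMem) {v : QMem} (hv : v ∈ Supp {q}ᶜ) :
    gateH q (tens u v) = tens (gateH q u) v := by
  refine onBasis_tens (fun S R hR => ?_) u hv
  have hq : q ∉ R := fun h => hR h rfl
  simp [Finset.erase_union_distrib, hq]

theorem gateT_tens {q : Qubit} (u : QMem) {v : QMem} (hv : v ∈ Supp {q}ᶜ) :
    gateT q (tens u v) = tens (gateT q u) v := by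
  refine onBasis_tens (fun S R hR => ?_) u hv
  have hq : q ∉ R := fun h => hR h rfl
  simp [hq]

theorem symmDiff_union_of_disjoint {α : Type*} [DecidableEq α] (S R T : Finset α)
    (h : Disjoint T R) : symmDiff (S ∪ R) T = symmDiff S T ∪ R := by
  ext x
  have h' : x ∈ T → x ∉ R := fun hx => Finset.disjoint_left.1 h hx
  simp only [Finset.mem_symmDiff, Finset.mem_union]
  tauto

theorem gateCX_tens {c t : Qubit} (u : QMem) {v : QMem} (hv : v ∈ Supp {c, t}ᶜ) :
    gateCX c t (tens u v) = tens (gateCX c t u) v := by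
  refine onBasis_tens (fun S R hR => ?_) u hv
  have hc : c ∉ R := fun h => hR h (by simp)
  have ht : t ∉ R := fun h => hR h (by simp)
  rw [tens_single, mul_one]
  by_cases h : c ∈ S ∧ c ≠ t
  · rw [if_pos h, if_pos ⟨by simp [h.1], h.2⟩, symmDiff_union_of_disjoint _ _ _ (by simpa using ht)]
  · rw [if_neg h, if_neg (by simpa [hc] using h)]

theorem projectQubit_tens {q : Qubit} {b : Bool} (u : QMem) {v : QMem} (hv : v ∈ Supp {q}ᶜ) :
    projectQubit q b (tens u v) = tens (projectQubit q b u) v := by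
  refine onBasis_tens (fun S R hR => ?_) u hv
  have hq : q ∉ R := fun h => hR h rfl
  simp only [Finset.mem_union, hq, or_false]
  split_ifs <;> simp

theorem contract_tens {a m : ℕ} {w : Bits m → ℂ} (u : QMem) {v : QMem}
    (hv : v ∈ Supp {q | q.1 = a ∧ q.2 < m}ᶜ) :
    contract a m w (tens u v) = tens (contract a m w u) v := by
  refine onBasis_tens (fun S R hR => ?_) u hv
  have h1 : readBits a m (S ∪ R) = readBits a m S := by
    funext i
    have : (a, (i : ℕ)) ∉ R := fun h => hR h (by simp)
    simp [readBits, this]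
  have h2 : clearBits a m R = R := Finset.filter_true_of_mem fun q hq => hR hq
  rw [h1, tens_single, mul_one]
  congr 1
  conv_rhs => rw [← h2]
  exact Finset.filter_union ..

/-! ## Norms -/

theorem qmemNormSq_eq_sum {v : QMem} {s : Finset (Finset Qubit)} (h : v.support ⊆ s) :
    qmemNormSq v = ∑ S ∈ s, ‖v S‖ ^ 2 :=
  Finsupp.sum_of_support_subset _ h _ (by simp)

theorem qmemNormSq_nonneg (v : QMem) : 0 ≤ qmemNormSq v :=
  Finset.sum_nonneg fun _ _ => by positivity

theorem qmemNormSq_sum_single {ι : Type*} (s : Finset ι) (g : ι → Finset Qubit) (c : ι → ℂ)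
    (hg : Set.InjOn g s) :
    qmemNormSq (∑ i ∈ s, Finsupp.single (g i) (c i)) = ∑ i ∈ s, ‖c i‖ ^ 2 := by
  classical
  have hsub : (∑ i ∈ s, Finsupp.single (g i) (c i)).support ⊆ s.image g := by
    refine (Finsupp.support_finsetSum).trans ?_
    refine Finset.biUnion_subset.2 fun i hi => Finsupp.support_single_subset.trans ?_
    simpa using ⟨i, hi, rfl⟩
  rw [qmemNormSq_eq_sum hsub, Finset.sum_image hg]
  refine Finset.sum_congr rfl fun i hi => ?_
  rw [Finsupp.finsetSum_apply, Finset.sum_eq_single i]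
  · simp
  · intro j hj hji
    rw [Finsupp.single_apply, if_neg fun h => hji (hg hj hi h)]
  · exact fun h => absurd hi h

theorem qmemNormSq_smul (c : ℂ) (v : QMem) : qmemNormSq (c • v) = ‖c‖ ^ 2 * qmemNormSq v := by
  rw [qmemNormSq_eq_sum (Finsupp.support_smul (b := c) (g := v)),
    qmemNormSq_eq_sum (Finset.Subset.refl v.support), Finset.mul_sum]
  simp [mul_pow]

theorem qmemNormSq_single (S : Finset Qubit) (c : ℂ) :
    qmemNormSq (Finsupp.single S c) = ‖c‖ ^ 2 := by
  simp [qmemNormSq]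

theorem qmemNormSq_vac : qmemNormSq vac = 1 := by simp [vac, qmemNormSq_single]

/-- As `A` and `B` are disjoint, `S ∪ R` determines both `S ⊆ A` and `R ⊆ B`, so the products of
basis vectors are distinct basis vectors. -/
theorem qmemNormSq_tens {A B : Set Qubit} (hAB : Disjoint A B) {u v : QMem} (hu : u ∈ Supp A)
    (hv : v ∈ Supp B) : qmemNormSq (tens u v) = qmemNormSq u * qmemNormSq v := by
  classical
  have hu' : u = ∑ S ∈ u.support, Finsupp.single S (u S) := (Finsupp.sum_single u).symm
  have hv' : v = ∑ S ∈ v.support, Finsupp.single S (v S) := (Finsupp.sum_single v).symm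
  have h : tens u v = ∑ x ∈ u.support ×ˢ v.support,
      Finsupp.single (x.1 ∪ x.2) (u x.1 * v x.2) := by
    conv_lhs => rw [hu', hv']
    simp only [map_sum, LinearMap.sum_apply, tens_single, Finset.sum_product]
    exact Finset.sum_comm
  rw [h, qmemNormSq_sum_single, Finset.sum_product, qmemNormSq_eq_sum (Finset.Subset.refl _),
    qmemNormSq_eq_sum (Finset.Subset.refl _), Finset.sum_mul_sum]
  · simp [mul_pow]
  · rintro ⟨S, R⟩ h1 ⟨S', R'⟩ h2 heq
    simp only [Finset.coe_product, Set.mem_prod, Finset.mem_coe] at h1 h2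
    have hS := (Finsupp.mem_supported ℂ u).1 hu h1.1
    have hS' := (Finsupp.mem_supported ℂ u).1 hu h2.1
    have hR := (Finsupp.mem_supported ℂ v).1 hv h1.2
    have hR' := (Finsupp.mem_supported ℂ v).1 hv h2.2
    have hd := Set.disjoint_left.1 hAB
    have key : ∀ x, (x ∈ S ∨ x ∈ R) ↔ (x ∈ S' ∨ x ∈ R') := fun x => by
      have := Finset.ext_iff.1 heq x
      simpa using this
    refine Prod.ext (Finset.ext fun x => ?_) (Finset.ext fun x => ?_)
    · have := key x
      constructor
      · intro hx
        exact (this.1 (Or.inl hx)).resolve_right fun h => hd (hS hx) (hR' h)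
      · intro hx
        exact (this.2 (Or.inl hx)).resolve_right fun h => hd (hS' hx) (hR h)
    · have := key x
      constructor
      · intro hx
        exact (this.1 (Or.inr hx)).resolve_left fun h => hd (hS' h) (hR hx)
      · intro hx
        exact (this.2 (Or.inr hx)).resolve_left fun h => hd (hS h) (hR' hx)

/-! ## Registers -/

/-- The state `χ` of the qubits `(a, 0), …, (a, m - 1)`. -/
def ket {m : ℕ} (a : ℕ) (χ : Ket m) : QMem := ∑ b : Bits m, Finsupp.single (writeBits a m b) (χ b)

theorem mem_writeBits {a m : ℕ} {b : Bits m} {q : Qubit} :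
    q ∈ writeBits a m b ↔ ∃ i : Fin m, b i = true ∧ (a, (i : ℕ)) = q := by
  simp [writeBits]

@[simp] theorem mk_mem_writeBits {a m : ℕ} {b : Bits m} {i : Fin m} :
    (a, (i : ℕ)) ∈ writeBits a m b ↔ b i = true := by
  rw [mem_writeBits]
  constructor
  · rintro ⟨j, hj, h⟩
    have : j = i := Fin.ext (by simpa using h)
    rwa [← this]
  · exact fun h => ⟨i, h, rfl⟩

theorem mem_writeBits_iff {a m : ℕ} {b : Bits m} {c i : ℕ} :
    (c, i) ∈ writeBits a m b ↔ c = a ∧ ∃ h : i < m, b ⟨i, h⟩ = true := by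
  rw [mem_writeBits]
  constructor
  · rintro ⟨j, hj, h⟩
    obtain ⟨rfl, rfl⟩ := Prod.mk.inj h
    exact ⟨rfl, j.2, hj⟩
  · rintro ⟨rfl, h, hb⟩
    exact ⟨⟨i, h⟩, hb, rfl⟩

@[simp] theorem readBits_writeBits (a m : ℕ) (b : Bits m) : readBits a m (writeBits a m b) = b := by
  funext i
  simp [readBits]

theorem writeBits_injective (a m : ℕ) : Function.Injective (writeBits a m) :=
  Function.LeftInverse.injective (readBits_writeBits a m)

theorem writeBits_subset (a m : ℕ) (b : Bits m) :
    (writeBits a m b : Set Qubit) ⊆ {q | q.1 = a ∧ q.2 < m} := by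
  rintro ⟨c, i⟩ h
  obtain ⟨rfl, hi, -⟩ := mem_writeBits_iff.1 h
  exact ⟨rfl, hi⟩

theorem writeBits_false (a m : ℕ) : writeBits a m (fun _ => false) = ∅ := by
  simp [writeBits]

theorem clearBits_writeBits (a m : ℕ) (b : Bits m) : clearBits a m (writeBits a m b) = ∅ := by
  refine Finset.filter_eq_empty_iff.2 fun q hq => ?_
  simpa using writeBits_subset a m b hq

/-- The array of qubits with name `a`. -/
abbrev qarr (a : ℕ) : Set Qubit := {q | q.1 = a}

theorem ket_mem_Supp {m : ℕ} (a : ℕ) (χ : Ket m) : ket a χ ∈ Supp {q | q.1 = a ∧ q.2 < m} :=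
  Submodule.sum_mem _ fun b _ => single_mem_Supp (writeBits_subset a m b)

theorem ket_mem_qarr {m : ℕ} (a : ℕ) (χ : Ket m) : ket a χ ∈ Supp (qarr a) :=
  Supp_mono (fun _ h => h.1) (ket_mem_Supp a χ)

theorem ket_smul {m : ℕ} (a : ℕ) (c : ℂ) (χ : Ket m) : ket a (c • χ) = c • ket a χ := by
  simp [ket, Finset.smul_sum]

theorem ket_add {m : ℕ} (a : ℕ) (χ χ' : Ket m) : ket a (χ + χ') = ket a χ + ket a χ' := by
  simp [ket, Finset.sum_add_distrib]

theorem ket_sum {m : ℕ} {ι : Type*} (a : ℕ) (s : Finset ι) (χ : ι → Ket m) :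
    ket a (∑ i ∈ s, χ i) = ∑ i ∈ s, ket a (χ i) := by
  classical
  induction s using Finset.induction with
  | empty => simp [ket]
  | insert i s hi h => simp [Finset.sum_insert hi, ket_add, h]

theorem ket_basisKet {m : ℕ} (a : ℕ) (x : Bits m) :
    ket a (basisKet x) = Finsupp.single (writeBits a m x) 1 := by
  rw [ket, Finset.sum_eq_single x]
  · simp [basisKet]
  · intro b _ hb
    simp [basisKet, hb]
  · simp

theorem sum_smul_basisKet {m : ℕ} (χ : Ket m) : ∑ b, χ b • basisKet b = χ := by
  funext y
  simp [basisKet, Pi.single_apply]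

theorem qmemNormSq_ket {m : ℕ} (a : ℕ) (χ : Ket m) : qmemNormSq (ket a χ) = ketNormSq χ :=
  qmemNormSq_sum_single _ _ _ (writeBits_injective a m).injOn

/-- A contracted register is back in `|0…0⟩`, so only a scalar survives. This serves both for the
outcome of an oracle call and for the overlap with `ψ`. -/
theorem contract_ket {m : ℕ} (a : ℕ) (w : Bits m → ℂ) (χ : Ket m) :
    contract a m w (ket a χ) = (∑ b, w b * χ b) • vac := by
  simp only [contract, ket, onBasis_sum, onBasis_single, clearBits_writeBits, readBits_writeBits,
    vac, Finsupp.smul_single, Finset.sum_smul, smul_eq_mul, mul_one]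
  simp [mul_comm]

/-! ## Gates -/

theorem gateH_single (q : Qubit) (S : Finset Qubit) :
    gateH q (Finsupp.single S 1) = ((√2 : ℝ) : ℂ)⁻¹ •
      (Finsupp.single (S.erase q) 1 + (if q ∈ S then -1 else 1 : ℂ) •
        Finsupp.single (insert q S) 1) := by
  rw [gateH, onBasis_single]
  by_cases hq : q ∈ S <;> simp [hq, neg_div]

theorem gateH_add (q : Qubit) (v w : QMem) : gateH q (v + w) = gateH q v + gateH q w :=
  onBasis_add _ _ _

theorem gateH_smul (q : Qubit) (c : ℂ) (v : QMem) : gateH q (c • v) = c • gateH q v :=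
  onBasis_smul _ _ _

theorem gateH_gateH (q : Qubit) (v : QMem) : gateH q (gateH q v) = v := by
  have h2 : ((√2 : ℝ) : ℂ)⁻¹ * ((√2 : ℝ) : ℂ)⁻¹ = 1 / 2 := by
    rw [← mul_inv, ← Complex.ofReal_mul, Real.mul_self_sqrt (by norm_num)]
    norm_num
  refine eq_of_basis (isLinearMap_comp (onBasis_isLinear _) (onBasis_isLinear _))
    (G := fun v => v) ⟨fun _ _ => rfl, fun _ _ => rfl⟩ (fun S => ?_) v
  change gateH q (gateH q _) = _
  rw [gateH_single, gateH, onBasis_smul, onBasis_add, onBasis_smul]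
  change _ • (gateH q _ + _ • gateH q _) = _
  rw [gateH_single, gateH_single]
  by_cases hq : q ∈ S
  · have e : insert q S = S := Finset.insert_eq_of_mem hq
    simp only [hq, e, Finset.mem_erase, ne_eq, not_true, false_and, if_true, if_false,
      Finset.erase_idem, Finset.insert_erase hq]
    linear_combination (norm := module) (2 * h2) • Finsupp.single S (1 : ℂ)
  · have e : S.erase q = S := Finset.erase_eq_of_notMem hq
    simp only [hq, e, Finset.mem_insert_self, if_true, if_false, Finset.erase_insert hq,
      Finset.insert_idem]
    linear_combination (norm := module) (2 * h2) • Finsupp.single S (1 : ℂ)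

/-- The Pauli gate `Z`. -/
def gateZ (q : Qubit) : QMem → QMem := onBasis fun S =>
  Finsupp.single S (if q ∈ S then -1 else 1)

/-- The phase gate. -/
def gateS (q : Qubit) : QMem → QMem := onBasis fun S =>
  Finsupp.single S (if q ∈ S then Complex.I else 1)

/-- The Pauli gate `X`. -/
def gateX (q : Qubit) : QMem → QMem := onBasis fun S => Finsupp.single (symmDiff S {q}) 1

/-- The controlled gate `CZ`. -/
def gateCZ (c t : Qubit) : QMem → QMem := onBasis fun S =>
  Finsupp.single S (if c ∈ S ∧ t ∈ S then -1 else 1)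

/-- The machine offers only `H`, `T` and `CX`. The other gates are words in these: `S = T²`, `Z =
S²`, `X = H Z H`, and `CZ` is `CX` with its target conjugated by `H`. -/
theorem gateT_gateT (q : Qubit) (v : QMem) : gateT q (gateT q v) = gateS q v := by
  refine eq_of_basis (isLinearMap_comp (onBasis_isLinear _) (onBasis_isLinear _))
    (onBasis_isLinear _) (fun S => ?_) v
  have : Complex.exp (Real.pi / 4 * Complex.I) * Complex.exp (Real.pi / 4 * Complex.I)
      = Complex.I := by
    rw [← Complex.exp_add, ← add_mul, ← add_div, ← two_mul,
      show (2 * Real.pi / 4 : ℂ) = Real.pi / 2 by ring, Complex.exp_pi_div_two_mul_I]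
  by_cases hq : q ∈ S <;> simp [onBasis_single, hq, this]

theorem gateS_gateS (q : Qubit) (v : QMem) : gateS q (gateS q v) = gateZ q v := by
  refine eq_of_basis (isLinearMap_comp (onBasis_isLinear _) (onBasis_isLinear _))
    (onBasis_isLinear _) (fun S => ?_) v
  by_cases hq : q ∈ S <;> simp [onBasis_single, hq]

theorem gateX_tens {q : Qubit} (u : QMem) {v : QMem} (hv : v ∈ Supp {q}ᶜ) :
    gateX q (tens u v) = tens (gateX q u) v := by
  refine onBasis_tens (fun S R hR => ?_) u hv
  have hq : q ∉ R := fun h => hR h rfl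
  rw [tens_single, mul_one, symmDiff_union_of_disjoint _ _ _ (by simpa using hq)]

theorem gateZ_tens {q : Qubit} (u : QMem) {v : QMem} (hv : v ∈ Supp {q}ᶜ) :
    gateZ q (tens u v) = tens (gateZ q u) v := by
  refine onBasis_tens (fun S R hR => ?_) u hv
  have hq : q ∉ R := fun h => hR h rfl
  simp [hq]

theorem gateCZ_tens {c t : Qubit} (u : QMem) {v : QMem} (hv : v ∈ Supp {c, t}ᶜ) :
    gateCZ c t (tens u v) = tens (gateCZ c t u) v := by
  refine onBasis_tens (fun S R hR => ?_) u hv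
  have hc : c ∉ R := fun h => hR h (by simp)
  have ht : t ∉ R := fun h => hR h (by simp)
  simp [hc, ht]

theorem gateH_gateZ_gateH (q : Qubit) (v : QMem) : gateH q (gateZ q (gateH q v)) = gateX q v := by
  have h2 : ((√2 : ℝ) : ℂ)⁻¹ * ((√2 : ℝ) : ℂ)⁻¹ = 1 / 2 := by
    rw [← mul_inv, ← Complex.ofReal_mul, Real.mul_self_sqrt (by norm_num)]
    norm_num
  refine eq_of_basis (isLinearMap_comp (onBasis_isLinear _) (isLinearMap_comp
    (onBasis_isLinear _) (onBasis_isLinear _))) (onBasis_isLinear _) (fun S => ?_) v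
  have hZ : ∀ R, gateZ q (Finsupp.single R 1) =
      (if q ∈ R then -1 else 1 : ℂ) • Finsupp.single R 1 := fun R => by
    by_cases hR : q ∈ R <;> simp [gateZ, onBasis_single, hR]
  change gateH q (gateZ q (gateH q _)) = gateX q _
  rw [gateH_single, gateZ, onBasis_smul, onBasis_add, onBasis_smul]
  change gateH q (_ • (gateZ q _ + _ • gateZ q _)) = _
  rw [hZ, hZ, gateH_smul, gateH_add, gateH_smul, gateH_smul, gateH_smul, gateH_single,
    gateH_single, gateX, onBasis_single, one_smul]
  by_cases hq : q ∈ S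
  · have e : insert q S = S := Finset.insert_eq_of_mem hq
    have e' : symmDiff S {q} = S.erase q := by
      ext x; by_cases hx : x = q <;> simp [Finset.mem_symmDiff, hx, hq]
    simp only [hq, e, e', Finset.mem_erase, ne_eq, not_true, false_and, if_true, if_false,
      Finset.erase_idem, Finset.insert_erase hq]
    linear_combination (norm := module) (2 * h2) • Finsupp.single (S.erase q) (1 : ℂ)
  · have e : S.erase q = S := Finset.erase_eq_of_notMem hq
    have e' : symmDiff S {q} = insert q S := by
      ext x; by_cases hx : x = q <;> simp [Finset.mem_symmDiff, hx, hq]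
    simp only [hq, e, e', Finset.mem_insert_self, if_true, if_false, Finset.erase_insert hq,
      Finset.insert_idem]
    linear_combination (norm := module) (2 * h2) • Finsupp.single (insert q S) (1 : ℂ)

theorem gateCX_single (c t : Qubit) (S : Finset Qubit) (z : ℂ) :
    gateCX c t (Finsupp.single S z) =
      Finsupp.single (if c ∈ S ∧ c ≠ t then symmDiff S {t} else S) z := by
  simp [gateCX, onBasis_single]

theorem gateH_gateCX_gateH {c t : Qubit} (hct : c ≠ t) (v : QMem) :
    gateH t (gateCX c t (gateH t v)) = gateCZ c t v := by
  have key : ∀ S, gateH t (gateCX c t (gateH t (Finsupp.single S 1))) =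
      gateCZ c t (Finsupp.single S 1) := by
    intro S
    rw [gateCZ, onBasis_single, one_smul]
    by_cases hc : c ∈ S
    · have h1 : ∀ z, gateCX c t (Finsupp.single (S.erase t) z) =
          Finsupp.single (insert t S) z := fun z => by
        rw [gateCX_single, if_pos ⟨by simp [hc, hct], hct⟩]
        congr 1
        ext x; by_cases hx : x = t <;> simp [Finset.mem_symmDiff, hx]
      have h2 : ∀ z, gateCX c t (Finsupp.single (insert t S) z) =
          Finsupp.single (S.erase t) z := fun z => by
        rw [gateCX_single, if_pos ⟨by simp [hc], hct⟩]
        congr 1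
        ext x; by_cases hx : x = t <;> simp [Finset.mem_symmDiff, hx]
      -- With the control set, `CX` exchanges the two terms of `H|t⟩`, which is thus an eigenvector
      -- with eigenvalue `1` or `-1`.
      have h3 : gateCX c t (gateH t (Finsupp.single S 1)) =
          (if t ∈ S then -1 else 1 : ℂ) • gateH t (Finsupp.single S 1) := by
        simp only [gateH, onBasis_single, one_smul]
        rw [gateCX, onBasis_add]
        change gateCX c t _ + gateCX c t _ = _
        rw [h1, h2, smul_add, add_comm]
        by_cases ht : t ∈ S <;> simp [ht, neg_div]
      rw [h3, gateH_smul, gateH_gateH]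
      by_cases ht : t ∈ S <;> simp [hc, ht]
    · have h3 : gateCX c t (gateH t (Finsupp.single S 1)) = gateH t (Finsupp.single S 1) := by
        simp only [gateH, onBasis_single, one_smul]
        rw [gateCX, onBasis_add]
        change gateCX c t _ + gateCX c t _ = _
        rw [gateCX_single, gateCX_single, if_neg (by simp [hc]), if_neg (by simp [hc, hct])]
      rw [h3, gateH_gateH]
      simp [hc]
  exact eq_of_basis (isLinearMap_comp (onBasis_isLinear _) (isLinearMap_comp
    (onBasis_isLinear _) (onBasis_isLinear _))) (onBasis_isLinear _) key v

end LSN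

end

/-! ### Controlled Pauli strings, and extraction of one encoded bit. -/

noncomputable section

namespace LSN

/-! ## Pauli strings on basis vectors -/

/-- The nonzero entry of a Pauli matrix in the column `b`. -/
def pauliPhase (P : Bool × Bool) (b : Bool) : ℂ :=
  if P.2 then (if b then -1 else 1) * (if P.1 then Complex.I else 1) else 1

/-- Pauli matrices are monomial: on basis vectors a Pauli string is a bit flip with a phase, and all
computations with controlled strings rest on this. -/
theorem pauliMatrix_apply (P : Bool × Bool) (r c : Bool) :
    pauliMatrix P r c = if r = xor c P.1 then pauliPhase P c else 0 := by
  obtain ⟨x, z⟩ := P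
  cases x <;> cases z <;> cases r <;> cases c <;> simp [pauliPhase, pauliMatrix]

/-- The bitwise sum of two bit strings. -/
def bxor {m : ℕ} (x y : Bits m) : Bits m := fun i => xor (x i) (y i)

theorem bxor_bxor_cancel {m : ℕ} (x y : Bits m) : bxor (bxor x y) y = x := by
  funext i; simp [bxor]

theorem bxor_comm {m : ℕ} (x y : Bits m) : bxor x y = bxor y x := by
  funext i; simp [bxor, Bool.xor_comm]

theorem pauliOp_mulVec_basisKet {m : ℕ} (P : PauliString m) (b : Bits m) :
    pauliOp P *ᵥ basisKet b =
      (∏ j, pauliPhase (P j) (b j)) • basisKet (bxor b fun j => (P j).1) := by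
  funext r
  simp only [basisKet, Matrix.mulVec_single_one, Pi.smul_apply, smul_eq_mul, pauliOp,
    Matrix.col_apply, Matrix.of_apply, Pi.single_apply, pauliMatrix_apply]
  by_cases h : r = bxor b fun j => (P j).1
  · simp [h, bxor]
  · rw [if_neg h, mul_zero]
    obtain ⟨j, hj⟩ := Function.ne_iff.1 h
    exact Finset.prod_eq_zero (Finset.mem_univ j) (if_neg hj)

theorem writeBits_union_subset {a m : ℕ} {b : Bits m} {R : Finset Qubit} (i : Fin m)
    (hR : (R : Set Qubit) ⊆ {q | q.1 = a ∧ q.2 < m}ᶜ) :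
    (a, (i : ℕ)) ∈ writeBits a m b ∪ R ↔ b i = true := by
  have : (a, (i : ℕ)) ∉ R := fun h => hR h ⟨rfl, i.2⟩
  simp [this]

/-! ## Controlled Pauli strings -/

/-- A controlled Pauli matrix with control `c` and target `t`. -/
def ctrlSite (P : Bool × Bool) (c t : Qubit) (v : QMem) : QMem :=
  let v₁ := if P.2 then gateCZ c t v else v
  let v₂ := if P.1 then gateCX c t v₁ else v₁
  -- `Y = i X Z`, and a controlled factor `i` is a phase gate on the control.
  if P.1 && P.2 then gateS c v₂ else v₂

/-- A controlled Pauli string with control `c` on the first `i` qubits of the array `a`. -/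
def ctrlSites (P : ℕ → Bool × Bool) (c : Qubit) (a : ℕ) : ℕ → QMem → QMem
  | 0, v => v
  | i + 1, v => ctrlSite (P i) c (a, i) (ctrlSites P c a i v)

/-- A controlled signed Pauli string. -/
def ctrlPauli (P : ℕ → Bool × Bool) (sgn : Bool) (c : Qubit) (a n : ℕ) (v : QMem) : QMem :=
  -- A controlled sign `-1` is the gate `Z` on the control.
  if sgn then gateZ c (ctrlSites P c a n v) else ctrlSites P c a n v

theorem ctrlSite_isLinear (P : Bool × Bool) (c t : Qubit) : IsLinearMap ℂ (ctrlSite P c t) := by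
  have hid : IsLinearMap ℂ fun v : QMem => v := ⟨fun _ _ => rfl, fun _ _ => rfl⟩
  obtain ⟨x, z⟩ := P
  cases x <;> cases z
  · exact hid
  · exact onBasis_isLinear _
  · exact onBasis_isLinear _
  · exact isLinearMap_comp (F := gateS c) (onBasis_isLinear _) (isLinearMap_comp
      (F := gateCX c t) (G := gateCZ c t) (onBasis_isLinear _) (onBasis_isLinear _))

theorem ctrlSites_isLinear (P : ℕ → Bool × Bool) (c : Qubit) (a i : ℕ) :
    IsLinearMap ℂ (ctrlSites P c a i) := by
  induction i with
  | zero => exact ⟨fun _ _ => rfl, fun _ _ => rfl⟩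
  | succ i ih =>
    exact isLinearMap_comp (F := ctrlSite (P i) c (a, i)) (G := ctrlSites P c a i)
      (ctrlSite_isLinear _ _ _) ih

theorem ctrlPauli_isLinear (P : ℕ → Bool × Bool) (sgn : Bool) (c : Qubit) (a n : ℕ) :
    IsLinearMap ℂ (ctrlPauli P sgn c a n) := by
  cases sgn
  · exact ctrlSites_isLinear _ _ _ _
  · exact isLinearMap_comp (F := gateZ c) (G := ctrlSites P c a n) (onBasis_isLinear _)
      (ctrlSites_isLinear _ _ _ _)

theorem ctrlSite_single_of_notMem {P : Bool × Bool} {c t : Qubit} {S : Finset Qubit} (z : ℂ)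
    (h : c ∉ S) : ctrlSite P c t (Finsupp.single S z) = Finsupp.single S z := by
  obtain ⟨x, y⟩ := P
  cases x <;> cases y <;> simp [ctrlSite, gateCZ, gateCX, gateS, onBasis_single, h]

theorem ctrlSites_single_of_notMem {P : ℕ → Bool × Bool} {c : Qubit} {a : ℕ} {S : Finset Qubit}
    (z : ℂ) (h : c ∉ S) (i : ℕ) :
    ctrlSites P c a i (Finsupp.single S z) = Finsupp.single S z := by
  induction i with
  | zero => rfl
  | succ i ih => rw [ctrlSites, ih, ctrlSite_single_of_notMem z h]

theorem symmDiff_writeBits_union {a m : ℕ} {b : Bits m} {R : Finset Qubit} (i : Fin m)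
    (hR : (R : Set Qubit) ⊆ {q | q.1 = a ∧ q.2 < m}ᶜ) :
    symmDiff (writeBits a m b ∪ R) {(a, (i : ℕ))} =
      writeBits a m (Function.update b i (!b i)) ∪ R := by
  have hi : (a, (i : ℕ)) ∉ R := fun h => hR h ⟨rfl, i.2⟩
  rw [symmDiff_union_of_disjoint _ _ _ (by simpa using hi)]
  congr 1
  ext ⟨c, l⟩
  simp only [Finset.mem_symmDiff, Finset.mem_singleton, mem_writeBits_iff, Prod.mk.injEq]
  by_cases hc : c = a
  · by_cases hl : l < m
    · by_cases hli : (⟨l, hl⟩ : Fin m) = i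
      · have : l = i := congrArg Fin.val hli
        simp [hc, this]
      · have : l ≠ i := fun h => hli (Fin.ext h)
        simp [hc, hl, hli, this]
    · have : l ≠ i := fun h => hl (h ▸ i.2)
      simp [hc, hl, this]
  · simp [hc]

theorem ctrlSite_single_of_mem {a m : ℕ} {b : Bits m} {R : Finset Qubit} {P : Bool × Bool}
    {c : Qubit} (i : Fin m) (hR : (R : Set Qubit) ⊆ {q | q.1 = a ∧ q.2 < m}ᶜ) (hc : c ∈ R)
    (z : ℂ) : ctrlSite P c (a, (i : ℕ)) (Finsupp.single (writeBits a m b ∪ R) z) =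
      Finsupp.single (writeBits a m (Function.update b i (xor (b i) P.1)) ∪ R)
        (pauliPhase P (b i) * z) := by
  have hne : c ≠ (a, (i : ℕ)) := fun h => hR hc (by simp [h])
  have hm := writeBits_union_subset (b := b) i hR
  have hcS : ∀ b, c ∈ writeBits a m b ∪ R := fun b => by simp [hc]
  obtain ⟨x, y⟩ := P
  have hCZ : ∀ z, gateCZ c (a, (i : ℕ)) (Finsupp.single (writeBits a m b ∪ R) z) =
      Finsupp.single (writeBits a m b ∪ R) ((if b i then -1 else 1) * z) := fun z => by
    rw [gateCZ, onBasis_single]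
    simp only [hcS, hm, true_and, Finsupp.smul_single, smul_eq_mul]
    rw [mul_comm]
  have hCX : ∀ z, gateCX c (a, (i : ℕ)) (Finsupp.single (writeBits a m b ∪ R) z) =
      Finsupp.single (writeBits a m (Function.update b i (!b i)) ∪ R) z := fun z => by
    rw [gateCX_single, if_pos ⟨hcS b, hne⟩, symmDiff_writeBits_union i hR]
  have hS : ∀ b z, gateS c (Finsupp.single (writeBits a m b ∪ R) z) =
      Finsupp.single (writeBits a m b ∪ R) (Complex.I * z) := fun b z => by
    rw [gateS, onBasis_single, if_pos (hcS b), Finsupp.smul_single, smul_eq_mul, mul_comm]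
  have hu : Function.update b i (b i) = b := Function.update_eq_self i b
  cases x <;> cases y
  · simp [ctrlSite, pauliPhase]
  · cases hb : b i <;> simp only [ctrlSite, hCZ, pauliPhase, hb] <;> rw [hb] at hu <;> simp [hu]
  · cases hb : b i <;> simp [ctrlSite, hCX, pauliPhase, hb]
  · simp only [ctrlSite, Bool.and_self, if_true, hCZ, hCX, hS, pauliPhase, Bool.xor_true]
    congr 1
    ring

theorem ctrlSites_single_of_mem {a m : ℕ} {b : Bits m} {R : Finset Qubit} {P : ℕ → Bool × Bool}
    {c : Qubit} (hR : (R : Set Qubit) ⊆ {q | q.1 = a ∧ q.2 < m}ᶜ) (hc : c ∈ R) {i : ℕ}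
    (hi : i ≤ m) : ctrlSites P c a i (Finsupp.single (writeBits a m b ∪ R) 1) =
      Finsupp.single
        (writeBits a m (fun j => if (j : ℕ) < i then xor (b j) (P j).1 else b j) ∪ R)
        (∏ j ∈ Finset.univ.filter fun j : Fin m => (j : ℕ) < i, pauliPhase (P j) (b j)) := by
  induction i with
  | zero => simp [ctrlSites]
  | succ i ih =>
    rw [ctrlSites, ih (by omega), ctrlSite_single_of_mem ⟨i, hi⟩ hR hc]
    have hf : (Finset.univ.filter fun j : Fin m => (j : ℕ) < i + 1) =
        insert ⟨i, hi⟩ (Finset.univ.filter fun j : Fin m => (j : ℕ) < i) := by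
      ext j
      simp only [Finset.mem_filter, Finset.mem_univ, true_and, Finset.mem_insert, Fin.ext_iff]
      omega
    rw [hf, Finset.prod_insert (by simp)]
    congr 3
    · funext j
      by_cases hj : j = ⟨i, hi⟩
      · subst hj; simp
      · have : (j : ℕ) ≠ i := fun h => hj (Fin.ext h)
        rw [Function.update_of_ne hj]
        by_cases h : (j : ℕ) < i
        · rw [if_pos h, if_pos (by omega)]
        · rw [if_neg h, if_neg (by omega)]
    · simp

theorem ket_ext {m a : ℕ} {F G : QMem → QMem} (hF : IsLinearMap ℂ F) (hG : IsLinearMap ℂ G)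
    (v : QMem) (M : Op m)
    (h : ∀ b : Bits m, F (tens (ket a (basisKet b)) v) = G (tens (ket a (M *ᵥ basisKet b)) v))
    (χ : Ket m) : F (tens (ket a χ) v) = G (tens (ket a (M *ᵥ χ)) v) := by
  have e : ∀ f : QMem → QMem, IsLinearMap ℂ f → ∀ χ' : Bits m → Ket m,
      f (tens (ket a (∑ b, χ b • χ' b)) v) = ∑ b, χ b • f (tens (ket a (χ' b)) v) := by
    intro f hf χ'
    have : ∀ w, f w = hf.mk' f w := fun _ => rfl
    simp only [this, ket_sum, ket_smul, map_sum, map_smul, LinearMap.sum_apply,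
      LinearMap.smul_apply]
  conv_lhs => rw [← sum_smul_basisKet χ]
  conv_rhs => rw [← sum_smul_basisKet χ]
  rw [Matrix.mulVec_sum]
  simp only [Matrix.mulVec_smul]
  rw [e F hF, e G hG]
  exact Finset.sum_congr rfl fun b _ => by rw [h]

theorem signedPauliOp_mulVec {m : ℕ} (P : SignedPauli m) (χ : Ket m) :
    signedPauliOp P *ᵥ χ = (if P.2 then -1 else 1 : ℂ) • (pauliOp P.1 *ᵥ χ) := by
  rcases P with ⟨P, s⟩
  cases s <;> simp [signedPauliOp, Matrix.neg_mulVec]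

/-- A controlled signed Pauli string applied to a register. -/
theorem ctrlPauli_ket {m a : ℕ} (P : SignedPauli m) {p : ℕ → Bool × Bool}
    (hp : ∀ j : Fin m, p j = P.1 j) {c : Qubit} {R : Finset Qubit}
    (hR : (R : Set Qubit) ⊆ {q | q.1 = a ∧ q.2 < m}ᶜ) (hc : ¬(c.1 = a ∧ c.2 < m)) (χ : Ket m) :
    ctrlPauli p P.2 c a m (tens (ket a χ) (Finsupp.single R 1)) =
      tens (ket a (if c ∈ R then signedPauliOp P *ᵥ χ else χ)) (Finsupp.single R 1) := by
  have hid : IsLinearMap ℂ fun v : QMem => v := ⟨fun _ _ => rfl, fun _ _ => rfl⟩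
  by_cases h : c ∈ R
  · rw [if_pos h]
    refine ket_ext (ctrlPauli_isLinear _ _ _ _ _) hid _ (signedPauliOp P) (fun b => ?_) χ
    rw [signedPauliOp_mulVec, pauliOp_mulVec_basisKet, ket_smul, ket_smul, ket_basisKet,
      ket_basisKet, tens_single, mul_one]
    have := ctrlSites_single_of_mem (P := p) (b := b) hR h le_rfl
    simp only [Fin.is_lt, if_true, Finset.filter_true, hp] at this
    rw [ctrlPauli, this, gateZ, onBasis_single]
    have e : (writeBits a m fun j => xor (b j) (P.1 j).1) =
      writeBits a m (bxor b fun j => (P.1 j).1) := rfl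
    cases P.2 <;> simp [h, e]
  · rw [if_neg h]
    have := ket_ext (m := m) (a := a) (ctrlPauli_isLinear p P.2 c a m) hid (Finsupp.single R 1) 1
      (fun b => ?_) χ
    · simpa using this
    rw [Matrix.one_mulVec, ket_basisKet, tens_single, mul_one]
    have hn : c ∉ writeBits a m b ∪ R := by
      rw [Finset.mem_union, not_or]
      exact ⟨fun hw => hc (writeBits_subset a m b hw), h⟩
    rw [ctrlPauli, ctrlSites_single_of_notMem _ hn, gateZ, onBasis_single]
    cases P.2 <;> simp [hn]

/-! ## Tableaux -/

theorem generator_inl_mulVec {n : ℕ} (i : Fin n) (y : Bits n) :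
    pauliOp (generator (Sum.inl i)) *ᵥ basisKet y =
      basisKet (Function.update y i (!y i)) := by
  rw [pauliOp_mulVec_basisKet, Finset.prod_eq_one, one_smul]
  · congr 1
    funext j
    by_cases h : j = i
    · subst h; simp [bxor, generator]
    · simp [bxor, generator, h]
  · intro j _
    by_cases h : j = i <;> cases y j <;> simp [generator, h, pauliPhase]

theorem generator_inr_mulVec {n : ℕ} (i : Fin n) (y : Bits n) :
    pauliOp (generator (Sum.inr i)) *ᵥ basisKet y =
      (if y i then -1 else 1 : ℂ) • basisKet y := by
  rw [pauliOp_mulVec_basisKet, Finset.prod_eq_single i]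
  · congr 1
    · cases y i <;> simp [generator, pauliPhase]
    · congr 1
      funext j
      simp [bxor, generator]
  · intro j _ h
    cases y j <;> simp [generator, h, pauliPhase]
  · simp

/-- `(V P V†) V = V P`: on encoded vectors a row of the tableau acts as the bare generator does
before the encoding. Encoded bits can thus be manipulated knowing the tableau only. -/
theorem HasTableau.row_mulVec {n : ℕ} {V : Op n} {T : Tableau n} (h : HasTableau V T)
    (g : Fin n ⊕ Fin n) (χ : Ket n) :
    signedPauliOp (T g) *ᵥ (V *ᵥ χ) = V *ᵥ (pauliOp (generator g) *ᵥ χ) := by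
  have hV : Vᴴ * V = 1 := (Matrix.mem_unitaryGroup_iff'.1 h.1.1)
  rw [← h.2 g]
  simp only [Matrix.mulVec_mulVec, Matrix.mul_assoc, hV, Matrix.mul_one]

theorem cliffordOp_hasTableau {n : ℕ} {T : Tableau n} (hT : T ∈ cliffords n) :
    HasTableau (cliffordOp T) T := by
  have h : ∃ V, HasTableau V T := by simpa [cliffords] using hT
  rw [cliffordOp, dif_pos h]
  exact h.choose_spec

/-- The encoded basis vector `V|y⟩` in the register `a`, and the basis vector `R` outside. -/
def enc {n : ℕ} (a : ℕ) (V : Op n) (y : Bits n) (R : Finset Qubit) : QMem :=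
  tens (ket a (V *ᵥ basisKet y)) (Finsupp.single R 1)

theorem ctrlPauli_enc_inl {n a : ℕ} {V : Op n} {T : Tableau n} (h : HasTableau V T) (i : Fin n)
    {p : ℕ → Bool × Bool} (hp : ∀ j : Fin n, p j = (T (Sum.inl i)).1 j) {c : Qubit}
    {R : Finset Qubit} (hR : (R : Set Qubit) ⊆ {q | q.1 = a ∧ q.2 < n}ᶜ)
    (hc : ¬(c.1 = a ∧ c.2 < n)) (y : Bits n) :
    ctrlPauli p (T (Sum.inl i)).2 c a n (enc a V y R) =
      enc a V (if c ∈ R then Function.update y i (!y i) else y) R := by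
  rw [enc, ctrlPauli_ket _ hp hR hc, enc]
  split_ifs
  · rw [h.row_mulVec, generator_inl_mulVec]
  · rfl

theorem ctrlPauli_enc_inr {n a : ℕ} {V : Op n} {T : Tableau n} (h : HasTableau V T) (i : Fin n)
    {p : ℕ → Bool × Bool} (hp : ∀ j : Fin n, p j = (T (Sum.inr i)).1 j) {c : Qubit}
    {R : Finset Qubit} (hR : (R : Set Qubit) ⊆ {q | q.1 = a ∧ q.2 < n}ᶜ)
    (hc : ¬(c.1 = a ∧ c.2 < n)) (y : Bits n) :
    ctrlPauli p (T (Sum.inr i)).2 c a n (enc a V y R) =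
      (if c ∈ R ∧ y i then -1 else 1 : ℂ) • enc a V y R := by
  rw [enc, ctrlPauli_ket _ hp hR hc]
  by_cases hcR : c ∈ R
  · rw [if_pos hcR, h.row_mulVec, generator_inr_mulVec, Matrix.mulVec_smul, ket_smul, map_smul]
    cases y i <;> simp [hcR]
  · simp [hcR]

/-- Move the encoded bit `i` from the register `a` to the qubit `c`. -/
def swapOp (px pz : ℕ → Bool × Bool) (sx sz : Bool) (c : Qubit) (a n : ℕ) (v : QMem) : QMem :=
  ctrlPauli px sx c a n (gateH c (ctrlPauli pz sz c a n (gateH c v)))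

theorem gateH_enc {n a : ℕ} {V : Op n} {c : Qubit} (hc : ¬(c.1 = a ∧ c.2 < n)) (y : Bits n)
    (R : Finset Qubit) : gateH c (enc a V y R) = ((√2 : ℝ) : ℂ)⁻¹ •
      (enc a V y (R.erase c) + (if c ∈ R then -1 else 1 : ℂ) • enc a V y (insert c R)) := by
  rw [enc, tens_comm, gateH_tens, gateH_single, enc, enc]
  · simp only [map_smul, map_add, LinearMap.smul_apply, LinearMap.add_apply]
    simp only [tens_comm]
  · refine Supp_mono ?_ (ket_mem_Supp a _)
    rintro q hq rfl
    exact hc hq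

/-- Between the two Hadamard gates, the controlled `C Z_i C†` kicks the sign `(-1)^{y_i}` back to
`c`, which ends in the state `|y_i⟩`. The controlled `C X_i C†` flips the encoded bit exactly when
it is `1`, leaving `0`. As `c` starts in `|0⟩`, this half of a swap is enough. -/
theorem swapOp_enc {n a : ℕ} {V : Op n} {T : Tableau n} (h : HasTableau V T) (i : Fin n)
    {px pz : ℕ → Bool × Bool} (hpx : ∀ j : Fin n, px j = (T (Sum.inl i)).1 j)
    (hpz : ∀ j : Fin n, pz j = (T (Sum.inr i)).1 j) {c : Qubit} {R : Finset Qubit}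
    (hR : (R : Set Qubit) ⊆ {q | q.1 = a ∧ q.2 < n}ᶜ) (hc : ¬(c.1 = a ∧ c.2 < n)) (hcR : c ∉ R)
    (y : Bits n) :
    swapOp px pz (T (Sum.inl i)).2 (T (Sum.inr i)).2 c a n (enc a V y R) =
      enc a V (Function.update y i false) (if y i then insert c R else R) := by
  have h2 : ((√2 : ℝ) : ℂ)⁻¹ * ((√2 : ℝ) : ℂ)⁻¹ = 1 / 2 := by
    rw [← mul_inv, ← Complex.ofReal_mul, Real.mul_self_sqrt (by norm_num)]
    norm_num
  have hR' : ((insert c R : Finset Qubit) : Set Qubit) ⊆ {q | q.1 = a ∧ q.2 < n}ᶜ := by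
    rw [Finset.coe_insert]
    exact Set.insert_subset hc hR
  have hX := ctrlPauli_isLinear px (T (Sum.inl i)).2 c a n
  have hZ := ctrlPauli_isLinear pz (T (Sum.inr i)).2 c a n
  have e1 : R.erase c = R := Finset.erase_eq_of_notMem hcR
  rw [swapOp, gateH_enc hc, if_neg hcR, one_smul, e1, hZ.map_smul, hZ.map_add,
    ctrlPauli_enc_inr h i hpz hR hc, ctrlPauli_enc_inr h i hpz hR' hc, gateH_smul, gateH_add,
    gateH_smul, gateH_smul, gateH_enc hc, gateH_enc hc]
  simp only [hcR, e1, Finset.mem_insert_self, false_and, true_and, if_false, if_true,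
    Finset.erase_insert hcR, Finset.insert_idem]
  cases hy : y i
  · have hu : Function.update y i false = y := by rw [← hy]; exact Function.update_eq_self i y
    rw [hu]
    simp only [Bool.false_eq_true, if_false]
    -- The target is written as an image under the last controlled Pauli (trivial here, as `c ∉ R`),
    -- so that only the arguments remain to be compared.
    have : enc a V y R = ctrlPauli px (T (Sum.inl i)).2 c a n (enc a V y R) := by
      rw [ctrlPauli_enc_inl h i hpx hR hc, if_neg hcR]
    conv_rhs => rw [this]
    congr 1
    linear_combination (norm := module) (2 * h2) • enc a V y R
  · simp only [if_true]
    have : enc a V (Function.update y i false) (insert c R) =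
        ctrlPauli px (T (Sum.inl i)).2 c a n (enc a V y (insert c R)) := by
      rw [ctrlPauli_enc_inl h i hpx hR' hc, if_pos (by simp), hy, Bool.not_true]
    rw [this]
    congr 1
    linear_combination (norm := module) (2 * h2) • enc a V y (insert c R)

end LSN

end

noncomputable section

namespace LSN

/-! ## Programs without measurements -/

/-- `s'` arises from `s` in at most `t` steps and without queries, by changing only variables in
`X`, arrays in `A`, and the quantum memory. -/
structure Frame (X A : Set ℕ) (t : ℕ) (s s' : Config) : Prop where
  var : ∀ x ∉ X, s'.var x = s.var x
  arr : ∀ a ∉ A, s'.arr a = s.arr a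
  time : s'.time ≤ s.time + t
  calls : s'.calls = s.calls

theorem Frame.refl (X A : Set ℕ) (s : Config) : Frame X A 0 s s :=
  ⟨fun _ _ => rfl, fun _ _ => rfl, le_rfl, rfl⟩

theorem Frame.trans {X A X' A' : Set ℕ} {t t' : ℕ} {s s' s'' : Config} (h : Frame X A t s s')
    (h' : Frame X' A' t' s' s'') : Frame (X ∪ X') (A ∪ A') (t + t') s s'' where
  var x hx := by
    rw [h'.var x fun hh => hx (Or.inr hh), h.var x fun hh => hx (Or.inl hh)]
  arr x hx := by
    rw [h'.arr x fun hh => hx (Or.inr hh), h.arr x fun hh => hx (Or.inl hh)]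
  time := by have := h.time; have := h'.time; omega
  calls := by rw [h'.calls, h.calls]

theorem Frame.mono {X A X' A' : Set ℕ} {t t' : ℕ} {s s' : Config} (h : Frame X A t s s')
    (hX : X ⊆ X') (hA : A ⊆ A') (ht : t ≤ t') : Frame X' A' t' s s' where
  var x hx := h.var x fun hh => hx (hX hh)
  arr x hx := h.arr x fun hh => hx (hA hh)
  time := h.time.trans (by omega)
  calls := h.calls

theorem Frame.trans' {X A : Set ℕ} {t t' : ℕ} {s s' s'' : Config} (h : Frame X A t s s')
    (h' : Frame X A t' s' s'') : Frame X A (t + t') s s'' :=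
  (h.trans h').mono (by simp) (by simp) le_rfl

/-- An instruction without effect. -/
def nop : Program := .const 17 0

/-- A sequence of programs. -/
def block : List Program → Program
  | [] => nop
  | [P] => P
  | P :: Q :: L => .seq P (block (Q :: L))

variable {n k : ℕ} {O : Option (Oracle n k)}

theorem run_seq {P Q : Program} {s s' : Config} (h : P.run O s = {s'}) :
    (Program.seq P Q).run O s = Q.run O s' := by
  rw [Program.run, h, Multiset.singleton_bind]

/-- `repeatRun` is defined by its first round; induction along a loop invariant needs the last round
instead. -/
theorem repeatRun_succ (f : Config → Multiset Config) (m : ℕ) (s : Config) :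
    repeatRun f (m + 1) s = (repeatRun f m s).bind f := by
  induction m generalizing s with
  | zero =>
    change (f s).bind (fun x => {x}) = ({s} : Multiset Config).bind f
    rw [Multiset.singleton_bind, Multiset.bind_singleton, Multiset.map_id']
  | succ m ih =>
    rw [repeatRun, Multiset.bind_congr fun c _ => ih c, ← Multiset.bind_assoc]
    rfl

/-- Loops whose body does not branch. -/
theorem run_loop {P : Program} {x : ℕ} {s : Config} (I : ℕ → Config → Prop) (h0 : I 0 s.tick)
    (hstep : ∀ i < s.var x, ∀ c, I i c → ∃ c', P.run O c.tick = {c'} ∧ I (i + 1) c') :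
    ∃ c', (Program.loop x P).run O s = {c'} ∧ I (s.var x) c' := by
  rw [Program.run]
  suffices h : ∀ m ≤ s.var x, ∃ c', repeatRun (fun s' => P.run O s'.tick) m s.tick = {c'} ∧ I m c'
    from h _ le_rfl
  intro m hm
  induction m with
  | zero => exact ⟨_, rfl, h0⟩
  | succ m ih =>
    obtain ⟨c, hc, hI⟩ := ih (by omega)
    obtain ⟨c', hc', hI'⟩ := hstep m (by omega) c hI
    exact ⟨c', by rw [repeatRun_succ, hc, Multiset.singleton_bind, hc'], hI'⟩

/-- Scratch variables of `ctrlPauliProg`. -/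
abbrev pauliScratch : Set ℕ := {10, 11, 12, 13, 17}

/-- A controlled Pauli matrix, read from a tableau, on one qubit of an array. -/
def ctrlSiteProg (c ci ax az reg : ℕ) : Program := block [
  .add 11 14 10, .load 12 ax 11, .load 13 az 11,
  .ite 13 (block [.had reg 10, .cx c ci reg 10, .had reg 10]) nop,
  .ite 12 (.cx c ci reg 10) nop,
  .ite 12 (.ite 13 (block [.tgate c ci, .tgate c ci]) nop) nop,
  .add 10 10 3]

/-- A controlled signed Pauli string, read from a tableau, on the first `n` qubits of the array
`reg`. The variables `14` and `15` hold the offset and the number of the row. -/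
def ctrlPauliProg (c ci ax az asgn reg : ℕ) : Program := block [
  .const 10 0, .loop 0 (ctrlSiteProg c ci ax az reg), .load 12 asgn 15,
  .ite 12 (block [.tgate c ci, .tgate c ci, .tgate c ci, .tgate c ci]) nop]

/-- Variable `3` holds the constant `1`, used as increment throughout. The condition `17 < ci` keeps
the index of the control clear of the scratch variables, among them `17`, which `nop` overwrites. -/
theorem ctrlSiteProg_spec {c ci ax az reg : ℕ} (hci : 17 < ci) (hc : c ≠ reg) (s : Config)
    (h3 : s.var 3 = 1) :
    ∃ s', (ctrlSiteProg c ci ax az reg).run O s = {s'} ∧ Frame pauliScratch ∅ 20 s s' ∧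
      s'.var 10 = s.var 10 + 1 ∧
      s'.vec = ctrlSite (decide (s.arr ax (s.var 14 + s.var 10) ≠ 0),
        decide (s.arr az (s.var 14 + s.var 10) ≠ 0)) (c, s.var ci) (reg, s.var 10) s.vec := by
  have e2 : ci ≠ 11 := by omega
  have e3 : ci ≠ 12 := by omega
  have e4 : ci ≠ 13 := by omega
  have e5 : ci ≠ 17 := by omega
  have hcz : ∀ v, gateH (reg, s.var 10) (gateCX (c, s.var ci) (reg, s.var 10)
      (gateH (reg, s.var 10) v)) = gateCZ (c, s.var ci) (reg, s.var 10) v := fun v =>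
    gateH_gateCX_gateH (by simp [hc]) v
  by_cases hx : s.arr ax (s.var 14 + s.var 10) = 0 <;>
  by_cases hz : s.arr az (s.var 14 + s.var 10) = 0 <;>
  · simp only [ctrlSiteProg, block, nop, Program.run, Config.tick, Config.setVar, Config.mapVec,
      Multiset.singleton_bind, Function.update_apply, hx, hz, h3, e2, e3, e4, e5, if_true,
      if_false, Nat.reduceEqDiff, hcz, gateT_gateT, ctrlSite, ne_eq,
      not_true, not_false_iff, decide_true, decide_false, Bool.and_true, Bool.and_false,
      Bool.false_eq_true]
    refine ⟨_, rfl, ⟨fun x hx => ?_, fun _ _ => rfl, by simp, rfl⟩, rfl, rfl⟩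
    simp only [pauliScratch, Set.mem_insert_iff, Set.mem_singleton_iff, not_or] at hx
    simp [hx]

theorem ctrlPauliProg_spec {c ci ax az asgn reg : ℕ} (hci : 17 < ci) (hc : c ≠ reg) (s : Config)
    (h3 : s.var 3 = 1) :
    ∃ s', (ctrlPauliProg c ci ax az asgn reg).run O s = {s'} ∧
      Frame pauliScratch ∅ (30 * (s.var 0 + 1)) s s' ∧
      s'.vec = ctrlPauli (fun j => (decide (s.arr ax (s.var 14 + j) ≠ 0),
        decide (s.arr az (s.var 14 + j) ≠ 0))) (decide (s.arr asgn (s.var 15) ≠ 0))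
        (c, s.var ci) reg (s.var 0) s.vec := by
  set p : ℕ → Bool × Bool := fun j => (decide (s.arr ax (s.var 14 + j) ≠ 0),
        decide (s.arr az (s.var 14 + j) ≠ 0)) with hp
  obtain ⟨s1, hs1⟩ : ∃ s1, s1 = s.tick.setVar 10 0 := ⟨_, rfl⟩
  -- In the time bound, `2` counts the initial `const` and the entry of the loop; `21` is one tick
  -- per round and at most `20` steps of the body.
  obtain ⟨s2, hrun, hfr, hj, hv⟩ := run_loop (O := O) (P := ctrlSiteProg c ci ax az reg) (x := 0)
    (s := s1) (fun i c' => Frame pauliScratch ∅ (2 + i * 21) s c' ∧ c'.var 10 = i ∧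
      c'.vec = ctrlSites p (c, s.var ci) reg i s.vec) (by
      subst hs1
      refine ⟨⟨fun x hx => ?_, fun _ _ => rfl, le_rfl, rfl⟩, rfl, rfl⟩
      simp only [pauliScratch, Set.mem_insert_iff, Set.mem_singleton_iff, not_or] at hx
      simp [Config.tick, Config.setVar, hx]) (by
      rintro i hi c' ⟨hf, hj, hv⟩
      obtain ⟨c'', hr, hf', hj', hv'⟩ := ctrlSiteProg_spec (O := O) (ax := ax) (az := az) hci hc
        c'.tick (by rw [← h3]; exact hf.var 3 (by simp))
      refine ⟨c'', hr, ?_, ?_, ?_⟩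
      · refine (hf.trans' (t' := 21) ⟨hf'.var, hf'.arr, ?_, hf'.calls⟩).mono subset_rfl subset_rfl
          (by omega)
        have := hf'.time
        simp only [Config.tick] at this
        omega
      · rw [hj']; simp [Config.tick, hj]
      · rw [hv', ctrlSites, ← hv, hp]
        have e1 : c'.var 14 = s.var 14 := hf.var 14 (by simp)
        have e2 : c'.var ci = s.var ci := hf.var ci (by simp; omega)
        have e3 : c'.arr = s.arr := funext fun a => hf.arr a (by simp)
        simp [Config.tick, hj, e1, e2, e3])
  have h0 : s1.var 0 = s.var 0 := by rw [hs1]; simp [Config.setVar, Config.tick]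
  have e15 : s2.var 15 = s.var 15 := hfr.var 15 (by simp)
  have eci : s2.var ci = s.var ci := hfr.var ci (by simp; omega)
  have earr : s2.arr = s.arr := funext fun a => hfr.arr a (by simp)
  have e3 : ci ≠ 12 := by omega
  have hrun' : (ctrlPauliProg c ci ax az asgn reg).run O s =
      (block [.load 12 asgn 15, .ite 12 (block [.tgate c ci, .tgate c ci, .tgate c ci,
        .tgate c ci]) nop]).run O s2 := by
    rw [ctrlPauliProg, block, run_seq (s' := s1) (by rw [hs1]; rfl), block, run_seq hrun]
  rw [hrun', ctrlPauli, ← h0, ← hv, ← earr, ← e15, ← eci]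
  have ht := hfr.time
  by_cases hs : s2.arr asgn (s2.var 15) = 0 <;>
  · simp only [block, nop, Program.run, Config.tick, Config.setVar, Config.mapVec,
      Multiset.singleton_bind, Function.update_apply, hs, e3, if_true, gateT_gateT, gateS_gateS,
      if_false, ne_eq, not_true, not_false_iff, decide_true, decide_false, Bool.false_eq_true]
    refine ⟨_, rfl, ⟨fun x hx => ?_, fun a ha => hfr.arr a ha, ?_, hfr.calls⟩, rfl⟩
    · rw [← hfr.var x hx]
      simp only [pauliScratch, Set.mem_insert_iff, Set.mem_singleton_iff, not_or] at hx
      simp [hx]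
    · simp only
      omega

end LSN

end

/-! ### Moving and creating whole encoded registers: the operators and the programs for them. -/

noncomputable section

namespace LSN

/-! ## Moving an encoded state out of a register -/

section Operators

variable {n : ℕ}

/-- The row `g` of a tableau as a function of natural numbers. -/
def rowFn (T : Tableau n) (g : Fin n ⊕ Fin n) (j : ℕ) : Bool × Bool :=
  if h : j < n then (T g).1 ⟨j, h⟩ else (false, false)

theorem rowFn_coe (T : Tableau n) (g : Fin n ⊕ Fin n) (j : Fin n) : rowFn T g j = (T g).1 j := by
  simp [rowFn]

theorem ctrlSites_congr {p p' : ℕ → Bool × Bool} {m : ℕ} (h : ∀ j < m, p j = p' j) (c : Qubit)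
    (a : ℕ) (v : QMem) : ctrlSites p c a m v = ctrlSites p' c a m v := by
  induction m with
  | zero => rfl
  | succ m ih => rw [ctrlSites, ctrlSites, h m (by omega), ih fun j hj => h j (by omega)]

/-- The controlled operator `C X_i C†`. -/
def tabX (T : Tableau n) (i : ℕ) (c : Qubit) (a : ℕ) (v : QMem) : QMem :=
  if h : i < n then
    ctrlPauli (rowFn T (Sum.inl ⟨i, h⟩)) (T (Sum.inl ⟨i, h⟩)).2 c a n v
  else v

/-- The controlled operator `C Z_i C†`. -/
def tabZ (T : Tableau n) (i : ℕ) (c : Qubit) (a : ℕ) (v : QMem) : QMem :=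
  if h : i < n then
    ctrlPauli (rowFn T (Sum.inr ⟨i, h⟩)) (T (Sum.inr ⟨i, h⟩)).2 c a n v
  else v

/-- Move the encoded bit `i` to the qubit `c`. -/
def tabSwap (T : Tableau n) (i : ℕ) (c : Qubit) (a : ℕ) (v : QMem) : QMem :=
  tabX T i c a (gateH c (tabZ T i c a (gateH c v)))

/-- Move the encoded bits `r, …, r + m - 1` to the first qubits of the array `c`. -/
def swapSeq (T : Tableau n) (c a r : ℕ) : ℕ → QMem → QMem
  | 0, v => v
  | m + 1, v => tabSwap T (r + m) (c, m) a (swapSeq T c a r m v)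

/-- Flip the encoded bits as prescribed by the first qubits of the array `5`. -/
def flipSeq (T : Tableau n) (a : ℕ) : ℕ → QMem → QMem
  | 0, v => v
  | m + 1, v => tabX T m (5, m) a (flipSeq T a m v)

theorem tabX_isLinear (T : Tableau n) (i : ℕ) (c : Qubit) (a : ℕ) :
    IsLinearMap ℂ (tabX T i c a) := by
  by_cases h : i < n
  · have : tabX T i c a =
        ctrlPauli (rowFn T (Sum.inl ⟨i, h⟩)) (T (Sum.inl ⟨i, h⟩)).2 c a n := by
      funext v; simp [tabX, h]
    rw [this]
    exact ctrlPauli_isLinear _ _ _ _ _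
  · have : tabX T i c a = fun v => v := by funext v; simp [tabX, h]
    rw [this]
    exact ⟨fun _ _ => rfl, fun _ _ => rfl⟩

theorem tabZ_isLinear (T : Tableau n) (i : ℕ) (c : Qubit) (a : ℕ) :
    IsLinearMap ℂ (tabZ T i c a) := by
  by_cases h : i < n
  · have : tabZ T i c a =
        ctrlPauli (rowFn T (Sum.inr ⟨i, h⟩)) (T (Sum.inr ⟨i, h⟩)).2 c a n := by
      funext v; simp [tabZ, h]
    rw [this]
    exact ctrlPauli_isLinear _ _ _ _ _
  · have : tabZ T i c a = fun v => v := by funext v; simp [tabZ, h]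
    rw [this]
    exact ⟨fun _ _ => rfl, fun _ _ => rfl⟩

theorem tabSwap_isLinear (T : Tableau n) (i : ℕ) (c : Qubit) (a : ℕ) :
    IsLinearMap ℂ (tabSwap T i c a) :=
  isLinearMap_comp (F := tabX T i c a) (tabX_isLinear _ _ _ _)
    (isLinearMap_comp (F := gateH c) (onBasis_isLinear _) (isLinearMap_comp
      (F := tabZ T i c a) (G := gateH c) (tabZ_isLinear _ _ _ _) (onBasis_isLinear _)))

theorem swapSeq_isLinear (T : Tableau n) (c a r m : ℕ) : IsLinearMap ℂ (swapSeq T c a r m) := by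
  induction m with
  | zero => exact ⟨fun _ _ => rfl, fun _ _ => rfl⟩
  | succ m ih =>
    exact isLinearMap_comp (F := tabSwap T (r + m) (c, m) a) (G := swapSeq T c a r m)
      (tabSwap_isLinear _ _ _ _) ih

theorem flipSeq_isLinear (T : Tableau n) (a m : ℕ) : IsLinearMap ℂ (flipSeq T a m) := by
  induction m with
  | zero => exact ⟨fun _ _ => rfl, fun _ _ => rfl⟩
  | succ m ih =>
    exact isLinearMap_comp (F := tabX T m (5, m) a) (G := flipSeq T a m) (tabX_isLinear _ _ _ _) ih

/-- Set the bits `r, …, r + m - 1` to `0`. -/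
def clearRange (r m : ℕ) (y : Bits n) : Bits n :=
  fun j => if r ≤ j ∧ (j : ℕ) < r + m then false else y j

/-- The bits `r, …, r + m - 1`. -/
def slice (r m : ℕ) (y : Bits n) : Bits m :=
  fun i => if h : r + i < n then y ⟨r + i, h⟩ else false

/-- Induction with `swapOp_enc`: each round writes to a qubit `(c, m)` that is still `|0⟩`, and the
bits already moved lie outside the register `a`. -/
theorem swapSeq_enc {a c r : ℕ} {V : Op n} {T : Tableau n} (hT : HasTableau V T) {R : Finset Qubit}
    (hR : (R : Set Qubit) ⊆ {q | q.1 = a ∧ q.2 < n}ᶜ) (hca : c ≠ a) {m : ℕ}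
    (hRc : ∀ i < m, (c, i) ∉ R) (hm : r + m ≤ n) (y : Bits n) :
    swapSeq T c a r m (enc a V y R) =
      enc a V (clearRange r m y) (R ∪ writeBits c m (slice r m y)) := by
  induction m with
  | zero =>
    have h1 : clearRange r 0 y = y := by
      funext j
      exact if_neg (by omega)
    have h2 : writeBits c 0 (slice r 0 y) = ∅ := by simp [writeBits]
    rw [h1, h2, Finset.union_empty, swapSeq]
  | succ m ih =>
    have hr : r + m < n := by omega
    have hR2 : ((R ∪ writeBits c m (slice r m y) : Finset Qubit) : Set Qubit) ⊆
        {q | q.1 = a ∧ q.2 < n}ᶜ := by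
      rw [Finset.coe_union]
      refine Set.union_subset hR fun q hq h => hca ?_
      rw [← (writeBits_subset _ _ _ hq).1, h.1]
    have hc : ¬((c, m).1 = a ∧ (c, m).2 < n) := fun h => hca h.1
    have hcR : (c, m) ∉ R ∪ writeBits c m (slice r m y) := by
      rw [Finset.mem_union, not_or]
      exact ⟨hRc m (by omega), fun h => absurd (writeBits_subset _ _ _ h).2 (lt_irrefl _)⟩
    rw [swapSeq, ih (fun i hi => hRc i (by omega)) (by omega), tabSwap, tabX, tabZ, dif_pos hr,
      dif_pos hr]
    have := swapOp_enc hT ⟨r + m, hr⟩ (rowFn_coe T _) (rowFn_coe T _) hR2 hc hcR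
      (clearRange r m y)
    rw [swapOp] at this
    rw [this]
    have e0 : clearRange r m y ⟨r + m, hr⟩ = y ⟨r + m, hr⟩ := if_neg (by simp)
    have e1 : Function.update (clearRange r m y) ⟨r + m, hr⟩ false = clearRange r (m + 1) y := by
      funext j
      by_cases hj : j = ⟨r + m, hr⟩
      · subst hj
        simp [clearRange]
      · have hj' : (j : ℕ) ≠ r + m := fun h => hj (Fin.ext h)
        rw [Function.update_of_ne hj, clearRange, clearRange]
        congr 1
        simp only [eq_iff_iff]
        omega
    rw [e0, e1]
    congr 1
    have hw : writeBits c (m + 1) (slice r (m + 1) y) = if y ⟨r + m, hr⟩ then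
        insert (c, m) (writeBits c m (slice r m y)) else writeBits c m (slice r m y) := by
      ext ⟨d, l⟩
      have key : (∃ h : l < m + 1, slice r (m + 1) y ⟨l, h⟩ = true) ↔
          (l = m ∧ y ⟨r + m, hr⟩ = true) ∨ ∃ h : l < m, slice r m y ⟨l, h⟩ = true := by
        constructor
        · rintro ⟨h, h'⟩
          by_cases hl : l = m
          · subst hl
            refine Or.inl ⟨rfl, ?_⟩
            simpa [slice, hr] using h'
          · exact Or.inr ⟨by omega, by simpa [slice] using h'⟩
        · rintro (⟨rfl, h⟩ | ⟨h, h'⟩)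
          · exact ⟨by omega, by simpa [slice, hr] using h⟩
          · exact ⟨by omega, by simpa [slice] using h'⟩
      rw [mem_writeBits_iff, key]
      by_cases hy : y ⟨r + m, hr⟩ = true
      · rw [if_pos hy, Finset.mem_insert, mem_writeBits_iff, Prod.mk.injEq]
        generalize (∃ h : l < m, slice r m y ⟨l, h⟩ = true) = E
        simp only [hy, and_true]
        exact and_or_left
      · rw [if_neg hy, mem_writeBits_iff]
        generalize (∃ h : l < m, slice r m y ⟨l, h⟩ = true) = E
        simp [hy]
    rw [hw]
    split_ifs
    · rw [Finset.union_insert]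
    · rfl

theorem flipSeq_enc {a : ℕ} {V : Op n} {T : Tableau n} (hT : HasTableau V T) {R : Finset Qubit}
    (hR : (R : Set Qubit) ⊆ {q | q.1 = a ∧ q.2 < n}ᶜ) (ha : 5 ≠ a) {m : ℕ} (hm : m ≤ n) :
    flipSeq T a m (enc a V (fun _ => false) R) =
      enc a V (fun j => if (j : ℕ) < m then readBits 5 n R j else false) R := by
  induction m with
  | zero => simp [flipSeq]
  | succ m ih =>
    have hm' : m < n := by omega
    rw [flipSeq, ih (by omega), tabX, dif_pos hm', ctrlPauli_enc_inl hT ⟨m, hm'⟩ (rowFn_coe T _) hR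
      (fun h => ha h.1)]
    congr 1
    funext j
    by_cases hj : j = ⟨m, hm'⟩
    · subst hj
      by_cases h5 : (5, m) ∈ R <;> simp [readBits, h5]
    · have hj' : (j : ℕ) ≠ m := fun h => hj (Fin.ext h)
      have e : (if (j : ℕ) < m + 1 then readBits 5 n R j else false) =
          if (j : ℕ) < m then readBits 5 n R j else false := by
        congr 1
        simp only [eq_iff_iff]
        omega
      rw [e]
      by_cases h1 : (5, m) ∈ R
      · rw [if_pos h1, Function.update_of_ne hj]
      · rw [if_neg h1]

/-- Prepare the encoded state given by the first `n` qubits of the array `5`, in a fresh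
register `a`, with a fresh ancilla array `c`. -/
theorem flipSeq_swapSeq {a c : ℕ} {V : Op n} {T : Tableau n} (hT : HasTableau V T)
    {R : Finset Qubit} (hRa : ∀ i, (a, i) ∉ R) (hRc : ∀ i, (c, i) ∉ R) (hca : c ≠ a) (ha : 5 ≠ a)
    (hc : 5 ≠ c) :
    flipSeq T a n (swapSeq T c a 0 n (Finsupp.single R 1)) =
      tens (ket a (V *ᵥ basisKet (readBits 5 n R)))
        (tens (ket c (Vᴴ *ᵥ basisKet fun _ => false)) (Finsupp.single R 1)) := by
  have hR : (R : Set Qubit) ⊆ {q | q.1 = a ∧ q.2 < n}ᶜ := by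
    rintro ⟨d, i⟩ hq ⟨h, -⟩
    simp only at h
    subst h
    exact hRa i hq
  set δ := Vᴴ *ᵥ basisKet fun _ : Fin n => false with hδ
  have hV : V * Vᴴ = 1 := Matrix.mem_unitaryGroup_iff.1 hT.1.1
  -- The empty register is itself a superposition of encoded states, `|0…0⟩ = V V†|0…0⟩ = ∑ δ_y
  -- V|y⟩`. Moving the encoded bits out puts `δ` into the ancillas and leaves the definite state
  -- `V|0…0⟩`, to which the flips can be applied.
  have h0 : Finsupp.single R (1 : ℂ) = ∑ y, δ y • enc a V y R := by
    simp only [enc]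
    have : ∑ y, δ y • tens (ket a (V *ᵥ basisKet y)) (Finsupp.single R (1 : ℂ)) =
        tens (ket a (V *ᵥ δ)) (Finsupp.single R 1) := by
      conv_rhs => rw [← sum_smul_basisKet δ]
      simp only [Matrix.mulVec_sum, Matrix.mulVec_smul, ket_sum, ket_smul, map_sum, map_smul,
        LinearMap.sum_apply, LinearMap.smul_apply]
    rw [this, hδ, Matrix.mulVec_mulVec, hV, Matrix.one_mulVec, ket_basisKet, writeBits_false,
      tens_single]
    simp
  have hlin : ∀ (F : QMem → QMem), IsLinearMap ℂ F → ∀ w : Bits n → QMem,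
      F (∑ y, δ y • w y) = ∑ y, δ y • F (w y) := fun F hF w => by
    have : ∀ v, F v = hF.mk' F v := fun _ => rfl
    simp only [this, map_sum, map_smul]
  rw [h0, hlin _ (swapSeq_isLinear _ _ _ _ _), hlin _ (flipSeq_isLinear _ _ _)]
  have hy : ∀ y, flipSeq T a n (swapSeq T c a 0 n (enc a V y R)) =
      tens (ket a (V *ᵥ basisKet (readBits 5 n R)))
        (tens (ket c (basisKet y)) (Finsupp.single R 1)) := by
    intro y
    rw [swapSeq_enc hT hR hca (fun i _ => hRc i) (by omega)]
    have e1 : clearRange 0 n y = fun _ => false := by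
      funext j; simp [clearRange]
    have e2 : slice 0 n y = y := by
      funext j; simp [slice]
    have e3 : readBits 5 n (R ∪ writeBits c n y) = readBits 5 n R := by
      funext j
      simp [readBits, mem_writeBits_iff, hc]
    rw [e1, e2, flipSeq_enc hT _ ha le_rfl]
    · simp only [Fin.is_lt, if_true]
      rw [show (fun j : Fin n => readBits 5 n (R ∪ writeBits c n y) j) = readBits 5 n R from e3,
        enc, ket_basisKet, tens_single, one_mul, Finset.union_comm]
    · rw [Finset.coe_union]
      refine Set.union_subset hR fun q hq h => hca ?_
      rw [← (writeBits_subset _ _ _ hq).1, h.1]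
  simp only [hy]
  rw [← h0]
  conv_rhs => rw [← sum_smul_basisKet δ]
  simp only [ket_sum, ket_smul, map_sum, map_smul, LinearMap.sum_apply, LinearMap.smul_apply]

end Operators

/-! ## Programs that use a tableau in memory -/

variable {n k : ℕ} {O : Option (Oracle n k)}

theorem getTableau_rowFn {s : Config} {ax az asgn : ℕ} {T : Tableau n}
    (hT : s.getTableau n ax az asgn = T) (g : Fin n ⊕ Fin n) :
    (∀ j < n, (decide (s.arr ax (rowIndex g * n + j) ≠ 0),
      decide (s.arr az (rowIndex g * n + j) ≠ 0)) = rowFn T g j) ∧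
    decide (s.arr asgn (rowIndex g) ≠ 0) = (T g).2 := by
  subst hT
  exact ⟨fun j hj => by simp [rowFn, hj, Config.getTableau], rfl⟩

theorem ctrlPauliProg_row {c ci ax az asgn reg : ℕ} (hci : 17 < ci) (hc : c ≠ reg) (s : Config)
    (h0 : s.var 0 = n) (h3 : s.var 3 = 1) {T : Tableau n} (hT : s.getTableau n ax az asgn = T)
    (g : Fin n ⊕ Fin n) (h14 : s.var 14 = rowIndex g * n) (h15 : s.var 15 = rowIndex g) :
    ∃ s', (ctrlPauliProg c ci ax az asgn reg).run O s = {s'} ∧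
      Frame pauliScratch ∅ (30 * (n + 1)) s s' ∧
      s'.vec = ctrlPauli (rowFn T g) (T g).2 (c, s.var ci) reg n s.vec := by
  obtain ⟨s', hr, hf, hv⟩ := ctrlPauliProg_spec (O := O) (ax := ax) (az := az) (asgn := asgn)
    hci hc s h3
  refine ⟨s', hr, by rwa [h0] at hf, ?_⟩
  obtain ⟨h1, h2⟩ := getTableau_rowFn hT g
  rw [hv, h14, h15, h0, h2, ctrlPauli, ctrlPauli, ctrlSites_congr h1]

theorem getTableau_congr {s s' : Config} (h : s'.arr = s.arr) (ax az asgn : ℕ) :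
    s'.getTableau n ax az asgn = s.getTableau n ax az asgn := by
  funext g
  simp only [Config.getTableau, h]

/-- Move the encoded bit with number in the variable `26` to the qubit of the array `c` with
number in the variable `28`, and increase these numbers. -/
def swapProg (c ax az asgn reg : ℕ) : Program := block [
  .had c 28, .add 14 25 2, .add 15 27 2, ctrlPauliProg c 28 ax az asgn reg,
  .had c 28, .add 14 24 2, .add 15 26 2, ctrlPauliProg c 28 ax az asgn reg,
  .add 24 24 0, .add 25 25 0, .add 26 26 3, .add 27 27 3, .add 28 28 3]

/-- Apply `C X_i C†` if the qubit `i` of the array `5` is set, where `i` is in the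
variable `26`, and increase `i`. -/
def flipProg (ax az asgn reg : ℕ) : Program := block [
  .add 14 24 2, .add 15 26 2, ctrlPauliProg 5 26 ax az asgn reg, .add 24 24 0, .add 26 26 3]

/-- Variables used by the loops. -/
abbrev workVars : Set ℕ := Set.Icc 10 39

theorem pauliScratch_subset : pauliScratch ⊆ workVars := by
  intro x hx
  simp only [Set.mem_insert_iff, Set.mem_singleton_iff] at hx
  simp only [Set.mem_Icc]
  omega

theorem frame_getTableau {X A : Set ℕ} {t ax az asgn : ℕ} {s s' : Config} (h : Frame X A t s s')
    (h1 : ax ∉ A) (h2 : az ∉ A) (h3 : asgn ∉ A) :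
    s'.getTableau n ax az asgn = s.getTableau n ax az asgn := by
  funext g
  simp only [Config.getTableau, h.arr _ h1, h.arr _ h2, h.arr _ h3]

/-- The machine cannot multiply, so the offsets `i * n` and `(n + i) * n` of the rows of `X_i` and
`Z_i` travel along in the variables `24` and `25` and advance by `n` each round. Variable `2` is
constantly `0`, which turns `add` into a copy instruction. -/
theorem swapProg_spec {c ax az asgn reg : ℕ} (hc : c ≠ reg) (s : Config) (h0 : s.var 0 = n)
    (h2 : s.var 2 = 0) (h3 : s.var 3 = 1) {T : Tableau n} (hT : s.getTableau n ax az asgn = T)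
    {i : ℕ} (hi : i < n) (h24 : s.var 24 = i * n) (h25 : s.var 25 = (n + i) * n)
    (h26 : s.var 26 = i) (h27 : s.var 27 = n + i) :
    ∃ s', (swapProg c ax az asgn reg).run O s = {s'} ∧
      Frame workVars ∅ (60 * (n + 1) + 20) s s' ∧
      s'.vec = tabSwap T i (c, s.var 28) reg s.vec ∧
      s'.var 24 = (i + 1) * n ∧ s'.var 25 = (n + (i + 1)) * n ∧ s'.var 26 = i + 1 ∧
      s'.var 27 = n + (i + 1) ∧ s'.var 28 = s.var 28 + 1 := by
  obtain ⟨s1, hs1⟩ : ∃ s1, s1 = (((s.tick.mapVec (gateH (c, s.var 28))).tick.setVar 14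
    (s.var 25 + s.var 2)).tick.setVar 15 (s.var 27 + s.var 2)) := ⟨_, rfl⟩
  have e1 : ∀ x, s1.var x = if x = 15 then n + i else if x = 14 then (n + i) * n else s.var x := by
    intro x
    simp [hs1, Config.setVar, Config.tick, Config.mapVec, Function.update_apply, h2, h25, h27]
  have a1 : s1.arr = s.arr := by rw [hs1]; rfl
  have t1 : s1.time = s.time + 3 := by rw [hs1]; rfl
  have c1 : s1.calls = s.calls := by rw [hs1]; rfl
  have v1 : s1.vec = gateH (c, s.var 28) s.vec := by rw [hs1]; rfl
  obtain ⟨s2, r2, f2, v2⟩ := ctrlPauliProg_row (O := O) (ci := 28) (ax := ax) (az := az)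
    (asgn := asgn) (by norm_num) hc s1 (by simp [e1, h0]) (by simp [e1, h3]) (T := T)
    ((getTableau_congr a1 _ _ _).trans hT) (Sum.inr ⟨i, hi⟩) (by simp [e1, rowIndex])
    (by simp [e1, rowIndex])
  have e2 : ∀ x ∉ pauliScratch, s2.var x = s1.var x := f2.var
  have a2 : s2.arr = s.arr := by rw [← a1]; exact funext fun a => f2.arr a (by simp)
  have t2 := f2.time
  have c2 := f2.calls
  obtain ⟨s3, hs3⟩ : ∃ s3, s3 = (((s2.tick.mapVec (gateH (c, s2.var 28))).tick.setVar 14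
    (s2.var 24 + s2.var 2)).tick.setVar 15 (s2.var 26 + s2.var 2)) := ⟨_, rfl⟩
  have e3 : ∀ x ∉ pauliScratch, s3.var x =
      if x = 15 then i else if x = 14 then i * n else s.var x := by
    intro x hx
    have q1 : s2.var 24 = i * n := by rw [e2 _ (by simp), e1]; simp [h24]
    have q2 : s2.var 26 = i := by rw [e2 _ (by simp), e1]; simp [h26]
    have q3 : s2.var 2 = 0 := by rw [e2 _ (by simp), e1]; simp [h2]
    simp only [hs3, Config.setVar, Config.tick, Config.mapVec, Function.update_apply, q1, q2, q3]
    by_cases hx15 : x = 15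
    · simp [hx15]
    by_cases hx14 : x = 14
    · simp [hx14]
    simp [hx15, hx14, e2 x hx, e1]
  have a3 : s3.arr = s.arr := by rw [← a2, hs3]; rfl
  have t3 : s3.time = s2.time + 3 := by rw [hs3]; rfl
  have c3 : s3.calls = s2.calls := by rw [hs3]; rfl
  have q28 : s2.var 28 = s.var 28 := by rw [e2 _ (by simp), e1]; simp
  have v3 : s3.vec = gateH (c, s.var 28) s2.vec := by rw [← q28, hs3]; rfl
  obtain ⟨s4, r4, f4, v4⟩ := ctrlPauliProg_row (O := O) (ci := 28) (ax := ax) (az := az)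
    (asgn := asgn) (by norm_num) hc s3 (by rw [e3 _ (by simp)]; simp [h0])
    (by rw [e3 _ (by simp)]; simp [h3]) (T := T)
    ((getTableau_congr a3 _ _ _).trans hT) (Sum.inl ⟨i, hi⟩)
    (by rw [e3 _ (by simp)]; simp [rowIndex]) (by rw [e3 _ (by simp)]; simp [rowIndex])
  have e4 : ∀ x ∉ pauliScratch, s4.var x =
      if x = 15 then i else if x = 14 then i * n else s.var x :=
    fun x hx => by rw [f4.var x hx, e3 x hx]
  have a4 : s4.arr = s.arr := by rw [← a3]; exact funext fun a => f4.arr a (by simp)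
  have t4 := f4.time
  have c4 := f4.calls
  have p0 : s4.var 0 = n := by rw [e4 _ (by simp)]; simpa using h0
  have p3 : s4.var 3 = 1 := by rw [e4 _ (by simp)]; simpa using h3
  have p24 : s4.var 24 = i * n := by rw [e4 _ (by simp)]; simpa using h24
  have p25 : s4.var 25 = (n + i) * n := by rw [e4 _ (by simp)]; simpa using h25
  have p26 : s4.var 26 = i := by rw [e4 _ (by simp)]; simpa using h26
  have p27 : s4.var 27 = n + i := by rw [e4 _ (by simp)]; simpa using h27
  have p28 : s4.var 28 = s.var 28 := by rw [e4 _ (by simp)]; simp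
  have hrun : (swapProg c ax az asgn reg).run O s = (block [.add 24 24 0, .add 25 25 0,
      .add 26 26 3, .add 27 27 3, .add 28 28 3]).run O s4 := by
    have A1 : (Program.had c 28).run O s = {s.tick.mapVec (gateH (c, s.var 28))} := rfl
    rw [swapProg, block, run_seq A1, block, run_seq rfl, block, run_seq (s' := s1) (by rw [hs1]; rfl),
      block, run_seq r2, block, run_seq rfl, block, run_seq rfl, block,
      run_seq (s' := s3) (by rw [hs3]; rfl), block, run_seq r4]
  rw [hrun]
  simp only [block, Program.run, Config.tick, Config.setVar, Multiset.singleton_bind,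
    Function.update_apply, if_false, Nat.reduceEqDiff]
  refine ⟨_, rfl, ⟨fun x hx => ?_, fun a _ => by rw [← a4], ?_, ?_⟩, ?_, ?_, ?_, ?_, ?_, ?_⟩
  · have hx' : x ∉ pauliScratch := fun h => hx (pauliScratch_subset h)
    have : x ∉ ({14, 15, 24, 25, 26, 27, 28} : Set ℕ) := fun h => hx (by
      simp only [Set.mem_insert_iff, Set.mem_singleton_iff] at h
      simp only [Set.mem_Icc]
      omega)
    simp only [Set.mem_insert_iff, Set.mem_singleton_iff, not_or] at this
    simp [this, e4 x hx']
  · simp only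
    omega
  · simp only
    rw [c4, c3, c2, c1]
  · simp only
    have q28' : s3.var 28 = s.var 28 := by rw [e3 _ (by simp)]; simp
    have q28'' : s1.var 28 = s.var 28 := by rw [e1]; simp
    rw [v4, v3, v2, v1, q28', q28'', tabSwap, tabX, tabZ, dif_pos hi, dif_pos hi]
  · simp [p24, p0, add_mul]
  · simp [p25, p0]; ring
  · simp [p26, p3]
  · simp [p27, p3]; ring
  · simp [p28, p3]

theorem flipProg_spec {ax az asgn reg : ℕ} (hc : 5 ≠ reg) (s : Config) (h0 : s.var 0 = n)
    (h2 : s.var 2 = 0) (h3 : s.var 3 = 1) {T : Tableau n} (hT : s.getTableau n ax az asgn = T)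
    {i : ℕ} (hi : i < n) (h24 : s.var 24 = i * n) (h26 : s.var 26 = i) :
    ∃ s', (flipProg ax az asgn reg).run O s = {s'} ∧
      Frame workVars ∅ (60 * (n + 1) + 20) s s' ∧
      s'.vec = tabX T i (5, i) reg s.vec ∧
      s'.var 24 = (i + 1) * n ∧ s'.var 26 = i + 1 := by
  obtain ⟨s1, hs1⟩ : ∃ s1, s1 = ((s.tick.setVar 14
    (s.var 24 + s.var 2)).tick.setVar 15 (s.var 26 + s.var 2)) := ⟨_, rfl⟩
  have e1 : ∀ x, s1.var x = if x = 15 then i else if x = 14 then i * n else s.var x := by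
    intro x
    simp [hs1, Config.setVar, Config.tick, Function.update_apply, h2, h24, h26]
  have a1 : s1.arr = s.arr := by rw [hs1]; rfl
  have t1 : s1.time = s.time + 2 := by rw [hs1]; rfl
  have c1 : s1.calls = s.calls := by rw [hs1]; rfl
  have v1 : s1.vec = s.vec := by rw [hs1]; rfl
  obtain ⟨s4, r4, f4, v4⟩ := ctrlPauliProg_row (O := O) (ci := 26) (ax := ax) (az := az)
    (asgn := asgn) (by norm_num) hc s1 (by simp [e1, h0]) (by simp [e1, h3]) (T := T)
    ((getTableau_congr a1 _ _ _).trans hT) (Sum.inl ⟨i, hi⟩) (by simp [e1, rowIndex])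
    (by simp [e1, rowIndex])
  have e4 : ∀ x ∉ pauliScratch, s4.var x =
      if x = 15 then i else if x = 14 then i * n else s.var x :=
    fun x hx => by rw [f4.var x hx, e1 x]
  have a4 : s4.arr = s.arr := by rw [← a1]; exact funext fun a => f4.arr a (by simp)
  have t4 := f4.time
  have c4 := f4.calls
  have p0 : s4.var 0 = n := by rw [e4 _ (by simp)]; simpa using h0
  have p3 : s4.var 3 = 1 := by rw [e4 _ (by simp)]; simpa using h3
  have p24 : s4.var 24 = i * n := by rw [e4 _ (by simp)]; simpa using h24
  have p26 : s4.var 26 = i := by rw [e4 _ (by simp)]; simpa using h26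
  have hrun : (flipProg ax az asgn reg).run O s =
      (block [.add 24 24 0, .add 26 26 3]).run O s4 := by
    rw [flipProg, block, run_seq rfl, block, run_seq (s' := s1) (by rw [hs1]; rfl),
      block, run_seq r4]
  rw [hrun]
  simp only [block, Program.run, Config.tick, Config.setVar, Multiset.singleton_bind,
    Function.update_apply, if_false, Nat.reduceEqDiff]
  refine ⟨_, rfl, ⟨fun x hx => ?_, fun a _ => by rw [← a4], ?_, ?_⟩, ?_, ?_, ?_⟩
  · have hx' : x ∉ pauliScratch := fun h => hx (pauliScratch_subset h)
    have : x ∉ ({14, 15, 24, 25, 26, 27, 28} : Set ℕ) := fun h => hx (by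
      simp only [Set.mem_insert_iff, Set.mem_singleton_iff] at h
      simp only [Set.mem_Icc]
      omega)
    simp only [Set.mem_insert_iff, Set.mem_singleton_iff, not_or] at this
    simp [this, e4 x hx']
  · simp only
    omega
  · simp only
    rw [c4, c1]
  · simp only
    have q26 : s1.var 26 = i := by rw [e1]; simp [h26]
    rw [v4, v1, q26, tabX, dif_pos hi]
  · simp [p24, p0, add_mul]
  · simp [p26, p3]

theorem frame_tick {X A : Set ℕ} {t : ℕ} {s s' : Config} (h : Frame X A t s.tick s') :
    Frame X A (t + 1) s s' :=
  ⟨h.var, h.arr, by have := h.time; simp only [Config.tick] at this; omega, h.calls⟩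

theorem swapLoop_spec {x c ax az asgn reg : ℕ} (hc : c ≠ reg) (s : Config) (h0 : s.var 0 = n)
    (h2 : s.var 2 = 0) (h3 : s.var 3 = 1) {T : Tableau n} (hT : s.getTableau n ax az asgn = T)
    {r : ℕ} (hr : r + s.var x ≤ n) (h24 : s.var 24 = r * n) (h25 : s.var 25 = (n + r) * n)
    (h26 : s.var 26 = r) (h27 : s.var 27 = n + r) (h28 : s.var 28 = 0) :
    ∃ s', (Program.loop x (swapProg c ax az asgn reg)).run O s = {s'} ∧
      Frame workVars ∅ (1 + s.var x * (60 * (n + 1) + 21)) s s' ∧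
      s'.vec = swapSeq T c reg r (s.var x) s.vec ∧
      s'.var 24 = (r + s.var x) * n ∧ s'.var 25 = (n + (r + s.var x)) * n ∧
      s'.var 26 = r + s.var x ∧ s'.var 27 = n + (r + s.var x) := by
  obtain ⟨s', hrun, h⟩ := run_loop (O := O) (P := swapProg c ax az asgn reg) (x := x) (s := s)
    (fun i c' => Frame workVars ∅ (1 + i * (60 * (n + 1) + 21)) s c' ∧
      c'.vec = swapSeq T c reg r i s.vec ∧ c'.var 28 = i ∧
      c'.var 24 = (r + i) * n ∧ c'.var 25 = (n + (r + i)) * n ∧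
      c'.var 26 = r + i ∧ c'.var 27 = n + (r + i))
    ⟨(frame_tick (Frame.refl _ _ _)).mono subset_rfl subset_rfl (by omega), rfl, h28, h24, h25,
      h26, h27⟩ (by
    rintro i hi c' ⟨f, hv, g28, g24, g25, g26, g27⟩
    obtain ⟨c'', hr'', f'', hv'', g⟩ := swapProg_spec (O := O) (ax := ax) (az := az)
      (asgn := asgn) hc c'.tick ((f.var 0 (by simp)).trans h0) ((f.var 2 (by simp)).trans h2)
      ((f.var 3 (by simp)).trans h3)
      ((frame_getTableau f (by simp) (by simp) (by simp)).trans hT)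
      (i := r + i) (by omega) g24 g25 g26 g27
    refine ⟨c'', hr'', (f.trans' (frame_tick f'')).mono subset_rfl subset_rfl ?_, ?_, ?_, g.1,
      g.2.1, g.2.2.1, g.2.2.2.1⟩
    · rw [add_mul]; omega
    · rw [hv'', swapSeq, ← hv]
      change tabSwap T (r + i) (c, c'.var 28) reg c'.vec = _
      rw [g28]
    · rw [g.2.2.2.2]
      change c'.var 28 + 1 = _
      rw [g28])
  exact ⟨s', hrun, h.1, h.2.1, h.2.2.2⟩

theorem flipLoop_spec {ax az asgn reg : ℕ} (hc : 5 ≠ reg) (s : Config) (h0 : s.var 0 = n)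
    (h2 : s.var 2 = 0) (h3 : s.var 3 = 1) {T : Tableau n} (hT : s.getTableau n ax az asgn = T)
    (h24 : s.var 24 = 0) (h26 : s.var 26 = 0) :
    ∃ s', (Program.loop 0 (flipProg ax az asgn reg)).run O s = {s'} ∧
      Frame workVars ∅ (1 + n * (60 * (n + 1) + 21)) s s' ∧
      s'.vec = flipSeq T reg n s.vec := by
  obtain ⟨s', hrun, h⟩ := run_loop (O := O) (P := flipProg ax az asgn reg) (x := 0) (s := s)
    (fun i c' => Frame workVars ∅ (1 + i * (60 * (n + 1) + 21)) s c' ∧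
      c'.vec = flipSeq T reg i s.vec ∧ c'.var 24 = i * n ∧ c'.var 26 = i)
    ⟨(frame_tick (Frame.refl _ _ _)).mono subset_rfl subset_rfl (by omega), rfl,
      h24.trans (by simp), h26⟩ (by
    rintro i hi c' ⟨f, hv, g24, g26⟩
    obtain ⟨c'', hr'', f'', hv'', g⟩ := flipProg_spec (O := O) (ax := ax) (az := az)
      (asgn := asgn) hc c'.tick ((f.var 0 (by simp)).trans h0) ((f.var 2 (by simp)).trans h2)
      ((f.var 3 (by simp)).trans h3)
      ((frame_getTableau f (by simp) (by simp) (by simp)).trans hT)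
      (i := i) (by omega) g24 g26
    refine ⟨c'', hr'', (f.trans' (frame_tick f'')).mono subset_rfl subset_rfl ?_, ?_, g.1, g.2⟩
    · rw [add_mul]; omega
    · rw [hv'', flipSeq, ← hv]; rfl)
  rw [h0] at h
  exact ⟨s', hrun, h.1, h.2.1⟩

end LSN

end

/-! ### Pauli noise seen through a Clifford encoding. -/

noncomputable section

namespace LSN

/-! ## Tensor products of one-qubit operators -/

/-- The operator `A₁ ⊗ ⋯ ⊗ Aₙ`. -/
def tensOp {n : ℕ} (A : Fin n → Matrix Bool Bool ℂ) : Op n :=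
  Matrix.of fun r c => ∏ j, A j (r j) (c j)

theorem pauliOp_eq_tensOp {n : ℕ} (P : PauliString n) :
    pauliOp P = tensOp fun j => pauliMatrix (P j) := rfl

theorem tensOp_mul {n : ℕ} (A B : Fin n → Matrix Bool Bool ℂ) :
    tensOp A * tensOp B = tensOp fun j => A j * B j := by
  ext r c
  simp only [tensOp, Matrix.mul_apply, Matrix.of_apply, ← Finset.prod_mul_distrib]
  rw [Finset.prod_univ_sum, Fintype.piFinset_univ]

theorem tensOp_one {n : ℕ} : tensOp (fun _ : Fin n => 1) = 1 := by
  ext r c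
  simp only [tensOp, Matrix.of_apply, Matrix.one_apply]
  by_cases h : r = c
  · simp [h]
  · rw [if_neg h]
    obtain ⟨j, hj⟩ := Function.ne_iff.1 h
    exact Finset.prod_eq_zero (Finset.mem_univ j) (if_neg hj)

theorem tensOp_conjTranspose {n : ℕ} (A : Fin n → Matrix Bool Bool ℂ) :
    (tensOp A)ᴴ = tensOp fun j => (A j)ᴴ := by
  ext r c
  simp [tensOp, Matrix.conjTranspose_apply]

theorem tensOp_smul {n : ℕ} (c : Fin n → ℂ) (A : Fin n → Matrix Bool Bool ℂ) :
    tensOp (fun j => c j • A j) = (∏ j, c j) • tensOp A := by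
  ext x y
  simp [tensOp, Finset.prod_mul_distrib]

theorem prod_sign {ι : Type*} (s : Finset ι) {c : ι → ℂ} (h : ∀ i, c i = 1 ∨ c i = -1) :
    ∏ i ∈ s, c i = 1 ∨ ∏ i ∈ s, c i = -1 := by
  refine Finset.prod_induction c (fun z => z = 1 ∨ z = -1) ?_ (Or.inl rfl) fun i _ => h i
  rintro a b (rfl | rfl) (rfl | rfl) <;> simp

theorem pauliMatrix_comm (P Q : Bool × Bool) : ∃ c : ℂ, (c = 1 ∨ c = -1) ∧
    pauliMatrix P * pauliMatrix Q = c • (pauliMatrix Q * pauliMatrix P) := by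
  refine ⟨if xor (P.1 && Q.2) (P.2 && Q.1) then -1 else 1, by split_ifs <;> simp, ?_⟩
  obtain ⟨x, z⟩ := P
  obtain ⟨x', z'⟩ := Q
  cases x <;> cases z <;> cases x' <;> cases z' <;>
    · ext r c
      cases r <;> cases c <;> simp [pauliMatrix, Matrix.mul_apply]

/-- Whether two Pauli strings do not commute. -/
def anti {n : ℕ} (P Q : PauliString n) : Bool :=
  decide (pauliOp P * pauliOp Q ≠ pauliOp Q * pauliOp P)

/-- The two orders differ by a sign at every qubit, hence by a sign altogether; this sign can only
be `-1` when the strings do not commute. -/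
theorem pauliOp_comm {n : ℕ} (P Q : PauliString n) : pauliOp P * pauliOp Q =
    (if anti P Q then -1 else 1 : ℂ) • (pauliOp Q * pauliOp P) := by
  by_cases h : pauliOp P * pauliOp Q = pauliOp Q * pauliOp P
  · simp [anti, h]
  · choose c hc hPQ using fun j => pauliMatrix_comm (P j) (Q j)
    have : pauliOp P * pauliOp Q = (∏ j, c j) • (pauliOp Q * pauliOp P) := by
      simp only [pauliOp_eq_tensOp, tensOp_mul, ← tensOp_smul, hPQ]
    rcases prod_sign Finset.univ hc with h1 | h1
    · rw [h1, one_smul] at this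
      exact absurd this h
    · rw [this, h1]
      simp [anti, h]

theorem signedPauliOp_comm {n : ℕ} (P : PauliString n) (Q : SignedPauli n) :
    pauliOp P * signedPauliOp Q =
      (if anti P Q.1 then -1 else 1 : ℂ) • (signedPauliOp Q * pauliOp P) := by
  have := pauliOp_comm P Q.1
  rcases Q with ⟨Q, s⟩
  cases s
  · simpa [signedPauliOp] using this
  · simp only [signedPauliOp, if_true, Matrix.mul_neg, Matrix.neg_mul, smul_neg]
    rw [this]

/-! ## Unitary operators and norms -/

theorem ketNormSq_eq {n : ℕ} (v : Ket n) : (ketNormSq v : ℂ) = star v ⬝ᵥ v := by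
  simp only [ketNormSq, dotProduct, Pi.star_apply, Complex.ofReal_sum]
  refine Finset.sum_congr rfl fun b _ => ?_
  rw [RCLike.star_def, Complex.conj_mul']
  norm_cast

theorem ketNormSq_unitary {n : ℕ} {U : Op n} (hU : U ∈ Matrix.unitaryGroup (Bits n) ℂ)
    (v : Ket n) : ketNormSq (U *ᵥ v) = ketNormSq v := by
  have h : Uᴴ * U = 1 := Matrix.mem_unitaryGroup_iff'.1 hU
  apply Complex.ofReal_injective
  rw [ketNormSq_eq, ketNormSq_eq, Matrix.star_mulVec, Matrix.dotProduct_mulVec,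
    Matrix.vecMul_vecMul, h, Matrix.vecMul_one]

theorem ketNormSq_smul {n : ℕ} (c : ℂ) (v : Ket n) : ketNormSq (c • v) = ‖c‖ ^ 2 * ketNormSq v := by
  simp [ketNormSq, mul_pow, Finset.mul_sum]

theorem ketNormSq_nonneg {n : ℕ} (v : Ket n) : 0 ≤ ketNormSq v :=
  Finset.sum_nonneg fun _ _ => by positivity

theorem ketNormSq_basisKet {n : ℕ} (x : Bits n) : ketNormSq (basisKet x) = 1 := by
  rw [ketNormSq, Finset.sum_eq_single x]
  · simp [basisKet]
  · intro b _ hb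
    simp [basisKet, hb]
  · simp

theorem pauliMatrix_unitary (P : Bool × Bool) : (pauliMatrix P)ᴴ * pauliMatrix P = 1 := by
  obtain ⟨x, z⟩ := P
  cases x <;> cases z <;>
    · ext r c
      cases r <;> cases c <;> simp [pauliMatrix, Matrix.mul_apply]

theorem pauliOp_unitary {n : ℕ} (P : PauliString n) :
    pauliOp P ∈ Matrix.unitaryGroup (Bits n) ℂ := by
  rw [Matrix.mem_unitaryGroup_iff', Matrix.star_eq_conjTranspose, pauliOp_eq_tensOp,
    tensOp_conjTranspose, tensOp_mul]
  simp only [pauliMatrix_unitary, tensOp_one]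

theorem ext_basisKet {n : ℕ} {A B : Op n} (h : ∀ y, A *ᵥ basisKet y = B *ᵥ basisKet y) :
    A = B := by
  ext r c
  have := congrFun (h c) r
  simpa [basisKet] using this

/-! ## Noise on encoded basis states -/

/-- Every string is reached from the zero string by flipping one bit at a time. -/
theorem eq_of_flip_invariant {n : ℕ} {f : Bits n → ℂ}
    (h : ∀ y i, f (Function.update y i (!y i)) = f y) (y : Bits n) :
    f y = f fun _ => false := by
  suffices hs : ∀ s : Finset (Fin n), f (fun j => if j ∈ s then y j else false) =
      f fun _ => false by
    simpa using hs Finset.univ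
  intro s
  induction s using Finset.induction with
  | empty => simp
  | insert i s hi ih =>
    rw [← ih]
    set z : Bits n := fun j => if j ∈ s then y j else false with hz
    have hzi : z i = false := by simp [hz, hi]
    cases hy : y i
    · congr 1
      funext j
      by_cases hj : j = i
      · subst hj; simp [hz, hi, hy]
      · simp [hz, hj]
    · rw [← h z i]
      congr 1
      funext j
      by_cases hj : j = i
      · subst hj; simp [hzi, hy]
      · simp [hz, hj]

/-- The sign `(-1)^(b · y)`. -/
def zsign {m : ℕ} (b y : Bits m) : ℂ := ∏ i, if b i && y i then -1 else 1

theorem zsign_mul_self {m : ℕ} (b y : Bits m) : zsign b y * zsign b y = 1 := by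
  rw [zsign, ← Finset.prod_mul_distrib]
  exact Finset.prod_eq_one fun i _ => by split_ifs <;> simp

theorem zsign_zero {m : ℕ} (b : Bits m) : zsign b (fun _ => false) = 1 := by simp [zsign]

theorem norm_zsign {m : ℕ} (b y : Bits m) : ‖zsign b y‖ = 1 := by
  rw [zsign, norm_prod]
  exact Finset.prod_eq_one fun i _ => by split_ifs <;> simp

theorem zsign_flip {m : ℕ} (b y : Bits m) (i : Fin m) :
    zsign b (Function.update y i (!y i)) = (if b i then -1 else 1) * zsign b y := by
  rw [zsign, zsign, ← Finset.mul_prod_erase _ _ (Finset.mem_univ i),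
    ← Finset.mul_prod_erase Finset.univ (fun i => if b i && y i then (-1 : ℂ) else 1)
      (Finset.mem_univ i), ← mul_assoc]
  congr 1
  · cases b i <;> cases y i <;> simp
  · refine Finset.prod_congr rfl fun j hj => ?_
    rw [Function.update_of_ne (Finset.ne_of_mem_erase hj)]

/-- The bits `i` for which the noise `E` does not commute with `C Z_i C†`. -/
def zsyn {n : ℕ} (T : Tableau n) (E : PauliString n) : Bits n :=
  fun i => anti E (T (Sum.inr i)).1

/-- The bits `i` for which the noise `E` does not commute with `C X_i C†`. -/
def xsyn {n : ℕ} (T : Tableau n) (E : PauliString n) : Bits n :=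
  fun i => anti E (T (Sum.inl i)).1

/-- `M = V† E V` commutes up to sign with every `X_i` and `Z_i`. The signs for the `Z_i` force
`M|y⟩` to be a multiple of `|y ⊕ zsyn⟩`; the signs for the `X_i` tell how the multiple changes when
a bit of `y` is flipped, so it is `μ (-1)^{xsyn · y}`. That `M` is a Pauli string is not needed
beforehand. -/
theorem HasTableau.noise {n : ℕ} {V : Op n} {T : Tableau n} (hV : HasTableau V T)
    (E : PauliString n) : ∃ μ : ℂ, ‖μ‖ = 1 ∧ ∀ y, pauliOp E *ᵥ (V *ᵥ basisKet y) =
      (μ * zsign (xsyn T E) y) • (V *ᵥ basisKet (bxor y (zsyn T E))) := by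
  have hV1 : Vᴴ * V = 1 := Matrix.mem_unitaryGroup_iff'.1 hV.1.1
  have hV2 : V * Vᴴ = 1 := Matrix.mem_unitaryGroup_iff.1 hV.1.1
  set M : Op n := Vᴴ * pauliOp E * V with hM
  have hEV : pauliOp E * V = V * M := by
    rw [hM, Matrix.mul_assoc, ← Matrix.mul_assoc, hV2, Matrix.one_mul]
  have hcomm : ∀ g, M * pauliOp (generator g) =
      (if anti E (T g).1 then -1 else 1 : ℂ) • (pauliOp (generator g) * M) := by
    intro g
    have h1 : V * pauliOp (generator g) = signedPauliOp (T g) * V := by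
      rw [← hV.2 g, Matrix.mul_assoc, hV1, Matrix.mul_one]
    have h2 : pauliOp (generator g) * Vᴴ = Vᴴ * signedPauliOp (T g) := by
      rw [← hV.2 g, Matrix.mul_assoc, ← Matrix.mul_assoc Vᴴ, hV1, Matrix.one_mul]
    calc M * pauliOp (generator g) = Vᴴ * (pauliOp E * signedPauliOp (T g)) * V := by
          rw [hM, Matrix.mul_assoc, h1]; simp only [Matrix.mul_assoc]
      _ = _ := by
          rw [signedPauliOp_comm, hM, Matrix.mul_smul, Matrix.smul_mul, ← Matrix.mul_assoc,
            ← h2]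
          simp only [Matrix.mul_assoc]
  have hMg : ∀ g χ, M *ᵥ (pauliOp (generator g) *ᵥ χ) =
      (if anti E (T g).1 then -1 else 1 : ℂ) • (pauliOp (generator g) *ᵥ (M *ᵥ χ)) := by
    intro g χ
    rw [Matrix.mulVec_mulVec, hcomm, Matrix.smul_mulVec, Matrix.mulVec_mulVec]
  -- Comparing the coefficient at `r` on both sides of the relation with `Z_i`: if it is nonzero,
  -- then `(-1)^{y_i}` and `(-1)^{r_i}` differ exactly by the commutation sign.
  have hzero : ∀ y r, (M *ᵥ basisKet y) r ≠ 0 → r = bxor y (zsyn T E) := by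
    intro y r hr
    funext i
    have h1 := congrFun (hMg (Sum.inr i) (basisKet y)) r
    have h2 : ∀ χ : Ket n, (pauliOp (generator (Sum.inr i)) *ᵥ χ) r =
        (if r i then -1 else 1 : ℂ) * χ r := by
      intro χ
      conv_lhs => rw [← sum_smul_basisKet χ]
      simp only [Matrix.mulVec_sum, Matrix.mulVec_smul, generator_inr_mulVec, Finset.sum_apply]
      rw [Finset.sum_eq_single r]
      · cases r i <;> simp [basisKet]
      · intro b _ hb
        cases b i <;> simp [basisKet, hb.symm]
      · simp
    rw [generator_inr_mulVec, Matrix.mulVec_smul, Pi.smul_apply, Pi.smul_apply, h2, smul_eq_mul,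
      smul_eq_mul, ← mul_assoc] at h1
    have h3 := mul_right_cancel₀ hr h1
    change r i = xor (y i) (anti E (T (Sum.inr i)).1)
    cases hy : y i <;> cases hri : r i <;> cases ha : anti E (T (Sum.inr i)).1 <;>
      simp [hy, hri, ha] at h3 ⊢ <;> norm_num at h3
  set μ : Bits n → ℂ := fun y => (M *ᵥ basisKet y) (bxor y (zsyn T E)) with hμ
  have hMy : ∀ y, M *ᵥ basisKet y = μ y • basisKet (bxor y (zsyn T E)) := by
    intro y
    funext r
    by_cases h : r = bxor y (zsyn T E)
    · simp [h, hμ, basisKet]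
    · have : (M *ᵥ basisKet y) r = 0 := by
        by_contra h'
        exact h (hzero y r h')
      rw [this, Pi.smul_apply, basisKet, Pi.single_eq_of_ne h, smul_zero]
  have hflip : ∀ y i, μ (Function.update y i (!y i)) =
      (if xsyn T E i then -1 else 1) * μ y := by
    intro y i
    have h1 := hMg (Sum.inl i) (basisKet y)
    rw [generator_inl_mulVec, hMy, hMy, Matrix.mulVec_smul, generator_inl_mulVec] at h1
    have e : bxor (Function.update y i (!y i)) (zsyn T E) = Function.update (bxor y (zsyn T E)) i
        (!bxor y (zsyn T E) i) := by
      funext j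
      by_cases hj : j = i
      · subst hj; simp [bxor]
      · simp [bxor, hj]
    have h2 := congrFun h1 (bxor (Function.update y i (!y i)) (zsyn T E))
    rw [e] at h2
    cases ha : anti E (T (Sum.inl i)).1 <;> simpa [basisKet, xsyn, ha] using h2
  -- Under a flip, `zsign` picks up the same sign as `μ`, so the product is invariant under all
  -- flips.
  have hconst : ∀ y, μ y * zsign (xsyn T E) y = μ fun _ => false := by
    intro y
    have := eq_of_flip_invariant (f := fun y => μ y * zsign (xsyn T E) y) (fun y i => by
      rw [hflip, zsign_flip]
      split_ifs <;> ring) y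
    simpa [zsign_zero] using this
  refine ⟨μ fun _ => false, ?_, fun y => ?_⟩
  · have h1 : ketNormSq (M *ᵥ basisKet fun _ => false) = 1 := by
      rw [hM, ← Matrix.mulVec_mulVec, ← Matrix.mulVec_mulVec, ketNormSq_unitary,
        ketNormSq_unitary (pauliOp_unitary E), ketNormSq_unitary hV.1.1, ketNormSq_basisKet]
      rw [Matrix.mem_unitaryGroup_iff, Matrix.star_eq_conjTranspose,
        Matrix.conjTranspose_conjTranspose, hV1]
    rw [hMy, ketNormSq_smul, ketNormSq_basisKet, mul_one] at h1
    exact (pow_eq_one_iff_of_nonneg (norm_nonneg _) two_ne_zero).1 h1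
  · rw [← hconst y, mul_assoc, zsign_mul_self, mul_one, Matrix.mulVec_mulVec, hEV,
      ← Matrix.mulVec_mulVec, hMy, Matrix.mulVec_smul]

/-! ## Exchanging `X` and `Z` on the logical qubits -/

/-- The tableau of `C (I ⊗ H ⊗ ⋯ ⊗ H)`, with Hadamard gates on the last `k` qubits. -/
def twist {n : ℕ} (k : ℕ) (T : Tableau n) : Tableau n
  | Sum.inl i => if n - k ≤ i then T (Sum.inr i) else T (Sum.inl i)
  | Sum.inr i => if n - k ≤ i then T (Sum.inl i) else T (Sum.inr i)

theorem twist_twist {n : ℕ} (k : ℕ) (T : Tableau n) : twist k (twist k T) = T := by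
  funext g
  rcases g with i | i <;> by_cases h : n - k ≤ (i : ℕ) <;> simp [twist, h]

/-- The Hadamard matrix. -/
def hadamard : Matrix Bool Bool ℂ :=
  Matrix.of fun r c => ((√2 : ℝ) : ℂ)⁻¹ * if r && c then -1 else 1

/-- `H` exchanges `X` and `Z` and negates only `Y`. Since the generators contain no `Y`, the rows of
the twisted tableau are permuted without any change of sign. -/
theorem hadamard_conj (P : Bool × Bool) : ∃ c : ℂ, (c = 1 ∨ c = -1) ∧
    (¬(P.1 ∧ P.2) → c = 1) ∧
    hadamard * pauliMatrix P * hadamardᴴ = c • pauliMatrix P.swap := by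
  have h2 : ((√2 : ℝ) : ℂ)⁻¹ * ((√2 : ℝ) : ℂ)⁻¹ = 1 / 2 := by
    rw [← mul_inv, ← Complex.ofReal_mul, Real.mul_self_sqrt (by norm_num)]
    norm_num
  refine ⟨if P.1 && P.2 then -1 else 1, by split_ifs <;> simp, fun h => ?_, ?_⟩
  · rw [if_neg]
    simpa using h
  obtain ⟨x, z⟩ := P
  cases x <;> cases z <;>
    · ext r c
      cases r <;> cases c <;>
        simp [pauliMatrix, Matrix.mul_apply, hadamard] <;>
        first | (rw [h2]; norm_num) | linear_combination (2 * Complex.I) * h2 |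
          linear_combination (-2 * Complex.I) * h2

end LSN

end

/-! ### Twisted Clifford operators, and the law of a random sample. -/

noncomputable section

namespace LSN

theorem hadamard_unitary : hadamard * hadamardᴴ = 1 := by
  obtain ⟨c, -, hc, h⟩ := hadamard_conj (false, false)
  rw [hc (by simp)] at h
  have e : pauliMatrix (false, false) = 1 := rfl
  simpa [e] using h

/-- Hadamard gates on the last `k` qubits. -/
def hadLayer (n k : ℕ) : Op n := tensOp fun j : Fin n => if n - k ≤ (j : ℕ) then hadamard else 1

theorem hadLayer_conj {n : ℕ} (k : ℕ) (P : PauliString n) : ∃ c : ℂ, (c = 1 ∨ c = -1) ∧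
    ((∀ j, ¬((P j).1 ∧ (P j).2)) → c = 1) ∧
    hadLayer n k * pauliOp P * (hadLayer n k)ᴴ =
      c • pauliOp fun j => if n - k ≤ (j : ℕ) then (P j).swap else P j := by
  have h : ∀ j : Fin n, ∃ c : ℂ, (c = 1 ∨ c = -1) ∧ (¬((P j).1 ∧ (P j).2) → c = 1) ∧
      (if n - k ≤ (j : ℕ) then hadamard else 1) * pauliMatrix (P j) *
        (if n - k ≤ (j : ℕ) then hadamard else 1)ᴴ =
      c • pauliMatrix (if n - k ≤ (j : ℕ) then (P j).swap else P j) := by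
    intro j
    by_cases hj : n - k ≤ (j : ℕ)
    · simpa only [if_pos hj] using hadamard_conj (P j)
    · exact ⟨1, Or.inl rfl, fun _ => rfl, by simp only [if_neg hj]; simp⟩
  choose c h1 h2 h3 using h
  refine ⟨∏ j, c j, prod_sign _ h1, fun hP => Finset.prod_eq_one fun j _ => h2 j (hP j), ?_⟩
  simp only [hadLayer, pauliOp_eq_tensOp, tensOp_conjTranspose, tensOp_mul, h3, tensOp_smul]

theorem hadLayer_mul_conjTranspose (n k : ℕ) : hadLayer n k * (hadLayer n k)ᴴ = 1 := by
  rw [hadLayer, tensOp_conjTranspose, tensOp_mul, ← tensOp_one]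
  congr 1
  funext j
  split_ifs
  · exact hadamard_unitary
  · simp

theorem twist_mem_cliffords {n : ℕ} (k : ℕ) {T : Tableau n} (hT : T ∈ cliffords n) :
    twist k T ∈ cliffords n := by
  have hV := cliffordOp_hasTableau hT
  set V := cliffordOp T
  have hconj : ∀ P : Op n, V * hadLayer n k * P * (V * hadLayer n k)ᴴ =
      V * (hadLayer n k * P * (hadLayer n k)ᴴ) * Vᴴ := fun P => by
    rw [Matrix.conjTranspose_mul]
    simp only [Matrix.mul_assoc]
  have key : HasTableau (V * hadLayer n k) (twist k T) := by
    refine ⟨⟨mul_mem hV.1.1 (Matrix.mem_unitaryGroup_iff.2 (hadLayer_mul_conjTranspose n k)),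
      fun P => ?_⟩, fun g => ?_⟩
    · obtain ⟨c, hc, -, h⟩ := hadLayer_conj k P
      obtain ⟨Q, c', hc', h'⟩ := hV.1.2 fun j => if n - k ≤ (j : ℕ) then (P j).swap else P j
      refine ⟨Q, c * c', ?_, ?_⟩
      · rcases hc with rfl | rfl <;> rcases hc' with rfl | rfl | rfl | rfl <;> simp
      · rw [hconj, h, Matrix.mul_smul, Matrix.smul_mul, h', smul_smul]
    · obtain ⟨c, -, hc, h⟩ := hadLayer_conj k (generator g)
      rw [hc (by rcases g with i | i <;> simp [generator]), one_smul] at h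
      rw [hconj, h]
      have e : ∀ (g' : Fin n ⊕ Fin n),
          (fun j : Fin n => if n - k ≤ (j : ℕ) then (generator g j).swap else generator g j) =
            generator g' → twist k T g = T g' →
          V * pauliOp (fun j : Fin n => if n - k ≤ (j : ℕ) then (generator g j).swap
            else generator g j) * Vᴴ = signedPauliOp (twist k T g) := by
        intro g' h1 h2
        rw [h1, h2, hV.2]
      rcases g with i | i <;> by_cases hi : n - k ≤ (i : ℕ)
      · refine e (Sum.inr i) (funext fun j => ?_) (by simp [twist, hi])
        by_cases hj : j = i
        · subst hj; simp [generator, hi]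
        · simp [generator, hj]
      · refine e (Sum.inl i) (funext fun j => ?_) (by simp [twist, hi])
        by_cases hj : j = i
        · subst hj; simp [generator, hi]
        · simp [generator, hj]
      · refine e (Sum.inl i) (funext fun j => ?_) (by simp [twist, hi])
        by_cases hj : j = i
        · subst hj; simp [generator, hi]
        · simp [generator, hj]
      · refine e (Sum.inr i) (funext fun j => ?_) (by simp [twist, hi])
        by_cases hj : j = i
        · subst hj; simp [generator, hi]
        · simp [generator, hj]
  simpa [cliffords] using ⟨_, key⟩

/-- The twist is an involution of the Clifford group, so a uniformly random operator and its twist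
have the same law; a solver is as good on twisted queries as on plain ones. -/
theorem sum_cliffords_twist {n : ℕ} (k : ℕ) (f : Tableau n → ℝ) :
    ∑ T ∈ cliffords n, f (twist k T) = ∑ T ∈ cliffords n, f T :=
  Finset.sum_bij' (fun T _ => twist k T) (fun T _ => twist k T)
    (fun _ h => twist_mem_cliffords k h) (fun _ h => twist_mem_cliffords k h)
    (fun T _ => twist_twist k T) (fun T _ => twist_twist k T) fun _ _ => rfl

theorem card_cliffords_pos (n : ℕ) : 0 < (cliffords n).card := by
  refine Finset.card_pos.2 ⟨fun g => (generator g, false), ?_⟩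
  have : HasTableau (1 : Op n) fun g => (generator g, false) := by
    refine ⟨⟨one_mem _, fun P => ⟨P, 1, Or.inl rfl, by simp⟩⟩, fun g => by simp [signedPauliOp]⟩
  simpa [cliffords] using ⟨_, this⟩

/-! ## Samples -/

/-- The string `s` followed by the string `x`. -/
def glue {n k : ℕ} (hk : k ≤ n) (s : Bits (n - k)) (x : Bits k) : Bits n :=
  fun j => if h : (j : ℕ) < n - k then s ⟨j, h⟩ else x ⟨j - (n - k), by omega⟩

theorem slice_glue_left {n k : ℕ} (hk : k ≤ n) (s : Bits (n - k)) (x : Bits k) :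
    slice 0 (n - k) (glue hk s x) = s := by
  funext i
  have : (i : ℕ) < n := by omega
  simp [slice, glue, this]

theorem slice_glue_right {n k : ℕ} (hk : k ≤ n) (s : Bits (n - k)) (x : Bits k) :
    slice (n - k) k (glue hk s x) = x := by
  funext i
  have : n - k + (i : ℕ) < n := by omega
  simp [slice, glue, this]

theorem bxor_glue {n k : ℕ} (hk : k ≤ n) (x : Bits k) (a : Bits n) :
    bxor (glue hk (fun _ => false) x) a =
      glue hk (slice 0 (n - k) a) (bxor x (slice (n - k) k a)) := by
  funext j
  by_cases h : (j : ℕ) < n - k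
  · simp [bxor, glue, slice, h]
  · have h' : n - k + ((j : ℕ) - (n - k)) = j := by omega
    simp [bxor, glue, slice, h, h']

theorem zsign_glue {n k : ℕ} (hk : k ≤ n) (b : Bits n) (x : Bits k) :
    zsign b (glue hk (fun _ => false) x) = zsign (slice (n - k) k b) x := by
  have hnk : n - k + k = n := Nat.sub_add_cancel hk
  have h := Fin.prod_univ_add (a := n - k) (b := k)
    (fun i => if b (Fin.cast hnk i) && glue hk (fun _ => false) x (Fin.cast hnk i) then -1
      else (1 : ℂ))
  have e : ∏ i : Fin (n - k + k), (if b (Fin.cast hnk i) &&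
      glue hk (fun _ => false) x (Fin.cast hnk i) then -1 else (1 : ℂ)) =
      zsign b (glue hk (fun _ => false) x) :=
    Fintype.prod_equiv (finCongr hnk) _ _ fun i => rfl
  rw [e] at h
  rw [h, Finset.prod_eq_one, one_mul, zsign]
  · refine Finset.prod_congr rfl fun i _ => ?_
    have h1 : n - k + (i : ℕ) < n := by omega
    have e1 : Fin.cast hnk (Fin.natAdd (n - k) i) = ⟨n - k + i, h1⟩ := rfl
    have e2 : glue hk (fun _ => false) x ⟨n - k + i, h1⟩ = x i := by simp [glue]
    rw [e1, e2, slice, dif_pos h1]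
  · intro i _
    have : glue hk (fun _ => false) x (Fin.cast hnk (Fin.castAdd k i)) = false := by
      simp [glue]
    simp [this]

theorem padKet_eq {n k : ℕ} (hk : k ≤ n) (ψ : Ket k) :
    padKet hk ψ = ∑ x, ψ x • basisKet (glue hk (fun _ => false) x) := by
  funext b
  rw [Finset.sum_apply]
  by_cases h : ∀ j : Fin n, (j : ℕ) < n - k → b j = false
  · rw [padKet, if_pos h, Finset.sum_eq_single fun i : Fin k => b ⟨n - k + i, by omega⟩]
    · have : glue hk (fun _ => false) (fun i : Fin k => b ⟨n - k + i, by omega⟩) = b := by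
        funext j
        by_cases hj : (j : ℕ) < n - k
        · simp [glue, hj, h j hj]
        · have h' : n - k + ((j : ℕ) - (n - k)) = j := by omega
          simp [glue, hj, h']
      rw [this]
      simp [basisKet]
    · intro x _ hx
      have : b ≠ glue hk (fun _ => false) x := by
        rintro rfl
        apply hx
        funext i
        simp [glue]
      simp [basisKet, this]
    · simp
  · rw [padKet, if_neg h]
    refine (Finset.sum_eq_zero fun x _ => ?_).symm
    have : b ≠ glue hk (fun _ => false) x := by
      rintro rfl
      apply h
      intro j hj
      simp [glue, hj]
    simp [basisKet, this]

theorem padKet_basisKet {n k : ℕ} (hk : k ≤ n) (x : Bits k) :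
    padKet hk (basisKet x) = basisKet (glue hk (fun _ => false) x) := by
  rw [padKet_eq, Finset.sum_eq_single x]
  · simp [basisKet]
  · intro y _ hy
    simp [basisKet, hy]
  · simp

/-- Addition of `a` as a permutation of the bit strings. -/
def bxorEquiv {k : ℕ} (a : Bits k) : Bits k ≃ Bits k where
  toFun x := bxor x a
  invFun x := bxor x a
  left_inv x := bxor_bxor_cancel x a
  right_inv x := bxor_bxor_cancel x a

/-- The Pauli operator `X^a Z^b`. -/
def applyXZ {k : ℕ} (a b : Bits k) (ψ : Ket k) : Ket k := fun y => zsign b (bxor y a) * ψ (bxor y a)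

/-- The noise turns into a shift of the first `n - k` bits to the syndrome and a Pauli operator `X^a
Z^b` on the logical qubits. On basis states `Z^b` is only a phase, so the sample of Search LSN is an
encoded basis state. For a known syndrome it can be prepared without knowing `a`: only the correct
answer depends on `a`. -/
theorem noisyCodeword_eq {n k : ℕ} (hk : k ≤ n) {T : Tableau n} (hT : T ∈ cliffords n)
    (E : PauliString n) : ∃ μ : ℂ, ‖μ‖ = 1 ∧
    (∀ ψ, noisyCodeword hk T E ψ = μ • ∑ y,
      applyXZ (slice (n - k) k (zsyn T E)) (slice (n - k) k (xsyn T E)) ψ y •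
        (cliffordOp T *ᵥ basisKet (glue hk (slice 0 (n - k) (zsyn T E)) y))) ∧
    ∀ x, ∃ c : ℂ, ‖c‖ = 1 ∧ noisyCodeword hk T E (basisKet x) = c • (cliffordOp T *ᵥ
      basisKet (glue hk (slice 0 (n - k) (zsyn T E)) (bxor x (slice (n - k) k (zsyn T E))))) := by
  obtain ⟨μ, hμ, h⟩ := (cliffordOp_hasTableau hT).noise E
  refine ⟨μ, hμ, fun ψ => ?_, fun x => ⟨μ * zsign (slice (n - k) k (xsyn T E)) x, ?_, ?_⟩⟩
  · rw [noisyCodeword, padKet_eq, ← Matrix.mulVec_mulVec]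
    simp only [Matrix.mulVec_sum, Matrix.mulVec_smul, h, bxor_glue, zsign_glue, Finset.smul_sum,
      smul_smul]
    refine Fintype.sum_equiv (bxorEquiv (slice (n - k) k (zsyn T E))) _ _ fun x => ?_
    rw [bxorEquiv, Equiv.coe_fn_mk, applyXZ, bxor_bxor_cancel]
    congr 1
    ring
  · rw [norm_mul, hμ, norm_zsign, one_mul]
  · rw [noisyCodeword, padKet_basisKet, ← Matrix.mulVec_mulVec, h, bxor_glue, zsign_glue]

/-- This and the next lemma make the second query possible: the twist preserves the syndrome, so the
one extracted from the sample serves both queries, while the logical error asked for changes from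
`a` to `b`. -/
theorem slice_left_zsyn_twist {n : ℕ} (k : ℕ) (T : Tableau n) (E : PauliString n) :
    slice 0 (n - k) (zsyn (twist k T) E) = slice 0 (n - k) (zsyn T E) := by
  funext i
  have h : (i : ℕ) < n := by omega
  have : ¬ n - k ≤ (i : ℕ) := by omega
  simp [slice, zsyn, h, twist, this]

theorem slice_right_zsyn_twist {n k : ℕ} (T : Tableau n) (E : PauliString n) :
    slice (n - k) k (zsyn (twist k T) E) = slice (n - k) k (xsyn T E) := by
  funext i
  simp [slice, zsyn, xsyn, twist]

/-- The success probability of a solver for Search LSN on noise `E`, in terms of the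
deterministic answer to a known encoded state. -/
theorem lsnAverage_eq {n k : ℕ} (hk : k ≤ n) (p : ℝ) {f : Tableau n → Ket n → Bits k → ℝ}
    (hf : ∀ T φ x (c : ℂ), ‖c‖ = 1 → f T (c • φ) x = f T φ x) :
    lsnAverage hk p f = (∑ T ∈ cliffords n, ∑ E : PauliString n, ∑ u : Bits k, depolarizing p E *
      f T (cliffordOp T *ᵥ basisKet (glue hk (slice 0 (n - k) (zsyn T E)) u))
        (bxor u (slice (n - k) k (zsyn T E)))) / ((cliffords n).card * 2 ^ k) := by
  rw [lsnAverage]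
  refine congrArg (fun z : ℝ => z / ((cliffords n).card * 2 ^ k)) ?_
  refine Finset.sum_congr rfl fun T hT => Finset.sum_congr rfl fun E _ => ?_
  obtain ⟨-, -, -, hE⟩ := noisyCodeword_eq hk hT E
  generalize slice (n - k) k (zsyn T E) = a at hE ⊢
  refine Fintype.sum_equiv (bxorEquiv a) _ _ fun x => ?_
  rw [bxorEquiv, Equiv.coe_fn_mk]
  obtain ⟨c, hc, h⟩ := hE x
  rw [h, hf _ _ _ _ hc, bxor_bxor_cancel]

/-- The same success probability, written as an average over the twisted query for the syndrome of
the original tableau, where the correct answer is `u ⊕ b`. -/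
theorem lsnAverage_eq_twist {n k : ℕ} (hk : k ≤ n) (p : ℝ) {f : Tableau n → Ket n → Bits k → ℝ}
    (hf : ∀ T φ x (c : ℂ), ‖c‖ = 1 → f T (c • φ) x = f T φ x) :
    lsnAverage hk p f = (∑ T ∈ cliffords n, ∑ E : PauliString n, ∑ u : Bits k, depolarizing p E *
      f (twist k T) (cliffordOp (twist k T) *ᵥ
        basisKet (glue hk (slice 0 (n - k) (zsyn T E)) u))
        (bxor u (slice (n - k) k (xsyn T E)))) / ((cliffords n).card * 2 ^ k) := by
  rw [lsnAverage_eq hk p hf, ← sum_cliffords_twist k]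
  simp only [slice_left_zsyn_twist, slice_right_zsyn_twist]

theorem sum_depolarizing {n : ℕ} (p : ℝ) : ∑ E : PauliString n, depolarizing p E = 1 := by
  simp only [depolarizing]
  have := (Finset.prod_univ_sum (fun _ : Fin n => (Finset.univ : Finset (Bool × Bool)))
    fun _ e => if e = (false, false) then 1 - p else p / 3).symm
  rw [Fintype.piFinset_univ] at this
  rw [this]
  refine Finset.prod_eq_one fun j _ => ?_
  rw [Fintype.sum_prod_type]
  simp
  ring

theorem depolarizing_nonneg {n : ℕ} {p : ℝ} (h0 : 0 < p) (h1 : p < 1) (E : PauliString n) :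
    0 ≤ depolarizing p E :=
  Finset.prod_nonneg fun j _ => by split_ifs <;> linarith

end LSN

end

noncomputable section

namespace LSN

/-! ## Haar-random states -/

theorem continuous_haarVec (k : ℕ) : Continuous fun U : Matrix.unitaryGroup (Bits k) ℂ =>
    (U : Op k) *ᵥ basisKet fun _ => false :=
  Continuous.matrix_mulVec continuous_subtype_val continuous_const

instance isProbabilityMeasure_haarUnitary (k : ℕ) : IsProbabilityMeasure (haarUnitary k) :=
  ⟨Measure.haarMeasure_self (K₀ := ⊤)⟩

instance isProbabilityMeasure_haarState (k : ℕ) : IsProbabilityMeasure (haarState k) :=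
  Measure.isProbabilityMeasure_map (continuous_haarVec k).measurable.aemeasurable

theorem integral_haarState {k : ℕ} {f : Ket k → ℝ} (hf : Continuous f) :
    ∫ ψ, f ψ ∂haarState k = ∫ U, f ((U : Op k) *ᵥ basisKet fun _ => false) ∂haarUnitary k :=
  integral_map (continuous_haarVec k).measurable.aemeasurable hf.aestronglyMeasurable

theorem integrable_haarState {k : ℕ} {f : Ket k → ℝ} (hf : Continuous f) :
    Integrable f (haarState k) := by
  refine (integrable_map_measure hf.aestronglyMeasurable
    (continuous_haarVec k).measurable.aemeasurable).2 ?_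
  have hc : Continuous fun U : Matrix.unitaryGroup (Bits k) ℂ =>
    f ((U : Op k) *ᵥ basisKet fun _ => false) := hf.comp (continuous_haarVec k)
  have : IsFiniteMeasureOnCompacts (haarUnitary k) := ⟨fun _ _ => measure_lt_top _ _⟩
  exact hc.integrable_of_hasCompactSupport (HasCompactSupport.of_compactSpace _)

theorem integral_haarState_mono {k : ℕ} {f g : Ket k → ℝ} (hf : Continuous f) (hg : Continuous g)
    (h : ∀ ψ, ketNormSq ψ = 1 → f ψ ≤ g ψ) :
    ∫ ψ, f ψ ∂haarState k ≤ ∫ ψ, g ψ ∂haarState k := by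
  rw [integral_haarState hf, integral_haarState hg]
  have : IsFiniteMeasureOnCompacts (haarUnitary k) := ⟨fun _ _ => measure_lt_top _ _⟩
  refine integral_mono
    ((hf.comp (continuous_haarVec k)).integrable_of_hasCompactSupport
      (HasCompactSupport.of_compactSpace _))
    ((hg.comp (continuous_haarVec k)).integrable_of_hasCompactSupport
      (HasCompactSupport.of_compactSpace _)) fun U => h _ ?_
  rw [ketNormSq_unitary U.2, ketNormSq_basisKet]

theorem integral_haarState_congr {k : ℕ} {f g : Ket k → ℝ} (hf : Continuous f) (hg : Continuous g)
    (h : ∀ ψ, ketNormSq ψ = 1 → f ψ = g ψ) :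
    ∫ ψ, f ψ ∂haarState k = ∫ ψ, g ψ ∂haarState k :=
  le_antisymm (integral_haarState_mono hf hg fun ψ hψ => (h ψ hψ).le)
    (integral_haarState_mono hg hf fun ψ hψ => (h ψ hψ).ge)

/-- Left invariance of Haar measure. The second moments below come from this alone, applied to
phases on a single amplitude and to one mixing unitary. -/
theorem integral_haarState_mulVec {k : ℕ} {f : Ket k → ℝ} (hf : Continuous f) {V : Op k}
    (hV : V ∈ Matrix.unitaryGroup (Bits k) ℂ) :
    ∫ ψ, f (V *ᵥ ψ) ∂haarState k = ∫ ψ, f ψ ∂haarState k := by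
  have hf' : Continuous fun ψ => f (V *ᵥ ψ) :=
    hf.comp (Continuous.matrix_mulVec continuous_const continuous_id)
  rw [integral_haarState hf, integral_haarState hf']
  have : (haarUnitary k).IsMulLeftInvariant := by
    unfold haarUnitary
    infer_instance
  rw [← integral_mul_left_eq_self (μ := haarUnitary k)
    (fun U => f ((U : Op k) *ᵥ basisKet fun _ => false)) ⟨V, hV⟩]
  simp only [Matrix.mulVec_mulVec]
  rfl

section Moments

variable {k : ℕ}

/-- The operator that multiplies the amplitude of `y` by `c`. -/
theorem phase_unitary (y : Bits k) {c : ℂ} (hc : ‖c‖ = 1) :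
    Matrix.diagonal (Function.update (fun _ => (1 : ℂ)) y c) ∈ Matrix.unitaryGroup (Bits k) ℂ := by
  rw [Matrix.mem_unitaryGroup_iff, Matrix.star_eq_conjTranspose, Matrix.diagonal_conjTranspose,
    Matrix.diagonal_mul_diagonal, ← Matrix.diagonal_one]
  congr 1
  funext z
  by_cases h : z = y
  · subst h
    simp [Complex.mul_conj, Complex.normSq_eq_norm_sq, hc]
  · simp [h]

theorem integral_phase {f : Ket k → ℝ} (hf : Continuous f) (y : Bits k) {c : ℂ} (hc : ‖c‖ = 1) :
    ∫ ψ, f (fun z => if z = y then c * ψ z else ψ z) ∂haarState k = ∫ ψ, f ψ ∂haarState k := by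
  rw [← integral_haarState_mulVec hf (phase_unitary y hc)]
  congr 1
  funext ψ
  congr 1
  funext z
  rw [Matrix.mulVec_diagonal]
  by_cases h : z = y
  · subst h; simp
  · simp [h]

/-- The operator `(1 + iS) / √2`, where `S` exchanges two basis states. -/
theorem integral_mix {f : Ket k → ℝ} (hf : Continuous f) (x y : Bits k) :
    ∫ ψ, f (fun z => ((√2 : ℝ) : ℂ)⁻¹ * (ψ z + Complex.I * ψ (Equiv.swap x y z))) ∂haarState k =
      ∫ ψ, f ψ ∂haarState k := by
  have h2 : ((√2 : ℝ) : ℂ)⁻¹ * ((√2 : ℝ) : ℂ)⁻¹ = 1 / 2 := by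
    rw [← mul_inv, ← Complex.ofReal_mul, Real.mul_self_sqrt (by norm_num)]
    norm_num
  set S : Op k := Matrix.of fun r c => if Equiv.swap x y r = c then 1 else 0 with hS
  have hSψ : ∀ ψ : Ket k, S *ᵥ ψ = fun z => ψ (Equiv.swap x y z) := by
    intro ψ
    funext z
    simp [hS, Matrix.mulVec, dotProduct]
  have hSS : S * S = 1 := ext_basisKet fun z => by
    rw [← Matrix.mulVec_mulVec, hSψ, hSψ, Matrix.one_mulVec]
    funext b
    simp
  have hSt : Sᴴ = S := by
    ext r c
    have : (Equiv.swap x y c = r) = (Equiv.swap x y r = c) := by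
      rw [eq_iff_iff, Equiv.swap_apply_eq_iff, eq_comm]
    by_cases h : Equiv.swap x y r = c
    · simp [hS, Matrix.conjTranspose_apply, this, h]
    · simp [hS, Matrix.conjTranspose_apply, this, h]
  have hU : ((√2 : ℝ) : ℂ)⁻¹ • (1 + Complex.I • S) ∈ Matrix.unitaryGroup (Bits k) ℂ := by
    rw [Matrix.mem_unitaryGroup_iff, Matrix.star_eq_conjTranspose, Matrix.conjTranspose_smul,
      Matrix.conjTranspose_add, Matrix.conjTranspose_smul, hSt, Matrix.conjTranspose_one]
    have e : star (((√2 : ℝ) : ℂ)⁻¹) = ((√2 : ℝ) : ℂ)⁻¹ := by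
      rw [RCLike.star_def, map_inv₀, Complex.conj_ofReal]
    have e' : star Complex.I = -Complex.I := Complex.conj_I
    rw [e, e', Matrix.smul_mul, Matrix.mul_smul, smul_smul, h2]
    simp only [add_mul, mul_add, Matrix.smul_mul, Matrix.mul_smul, hSS, smul_smul, mul_one, one_mul, mul_neg, Complex.I_mul_I, one_smul, neg_smul]
    module
  rw [← integral_haarState_mulVec hf hU]
  congr 1
  funext ψ
  congr 1
  funext z
  rw [Matrix.smul_mulVec, Matrix.add_mulVec, Matrix.smul_mulVec, hSψ, Matrix.one_mulVec]
  simp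

/-- The second moments of the probabilities of basis states. -/
def moment (x y : Bits k) : ℝ := ∫ ψ, ‖ψ x‖ ^ 2 * ‖ψ y‖ ^ 2 ∂haarState k

/-- Invariance under `ψ_y ↦ -ψ_y` reverses the sign of the integrand. -/
theorem integral_cross_eq_zero {x y z : Bits k} (hyz : y ≠ z) (a : ℂ) :
    ∫ ψ : Ket k, (a * ψ y * star (ψ z)).re * ‖ψ x‖ ^ 2 ∂haarState k = 0 := by
  have h := integral_phase (k := k) (f := fun ψ => (a * ψ y * star (ψ z)).re * ‖ψ x‖ ^ 2)
    (by fun_prop) y (c := -1) (by simp)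
  have e : ∀ ψ : Ket k, (a * (if y = y then -1 * ψ y else ψ y) *
      star (if z = y then -1 * ψ z else ψ z)).re * ‖if x = y then -1 * ψ x else ψ x‖ ^ 2 =
      -((a * ψ y * star (ψ z)).re * ‖ψ x‖ ^ 2) := by
    intro ψ
    rw [if_pos rfl, if_neg hyz.symm]
    have : ‖if x = y then -1 * ψ x else ψ x‖ = ‖ψ x‖ := by split_ifs <;> simp
    rw [this]
    simp
    ring
  have h' : ∫ ψ : Ket k, (a * (if y = y then -1 * ψ y else ψ y) *
      star (if z = y then -1 * ψ z else ψ z)).re * ‖if x = y then -1 * ψ x else ψ x‖ ^ 2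
      ∂haarState k = -∫ ψ : Ket k, (a * ψ y * star (ψ z)).re * ‖ψ x‖ ^ 2 ∂haarState k := by
    rw [← integral_neg]
    congr 1
    funext ψ
    exact e ψ
  have := h'.symm.trans h
  linarith

/-- Invariance under `(1 + iS)/√2` replaces `|ψ_x|²` by `(|ψ_x|² + |ψ_y|² + 2 Im(ψ_x ψ̄_y))/2`.
Squared and integrated, the terms odd in `Im(ψ_x ψ̄_y)` vanish, and the mean of `Im(ψ_x ψ̄_y)²` is
half of `moment x y`, since the phase `i` on `ψ_y` exchanges real and imaginary part up to sign.
What remains is a linear system for the three moments. -/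
theorem moment_eq {x y : Bits k} (hxy : x ≠ y) :
    moment x x = 2 * moment x y ∧ moment y y = 2 * moment x y := by
  set R := ∫ ψ : Ket k, ((ψ x * star (ψ y)).im) ^ 2 ∂haarState k with hR
  have hsum : R + ∫ ψ : Ket k, ((ψ x * star (ψ y)).re) ^ 2 ∂haarState k = moment x y := by
    rw [hR, moment, ← integral_add (integrable_haarState (by fun_prop))
      (integrable_haarState (by fun_prop))]
    congr 1
    funext ψ
    have : ‖ψ x‖ ^ 2 * ‖ψ y‖ ^ 2 = ‖ψ x * star (ψ y)‖ ^ 2 := by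
      rw [norm_mul, norm_star, mul_pow]
    rw [this, ← Complex.normSq_eq_norm_sq, Complex.normSq_apply]
    ring
  have hphase : ∫ ψ : Ket k, ((ψ x * star (ψ y)).re) ^ 2 ∂haarState k = R := by
    rw [← integral_phase (k := k) (f := fun ψ => ((ψ x * star (ψ y)).re) ^ 2) (by fun_prop) y
      (c := Complex.I) (by simp)]
    congr 1
    funext ψ
    simp [hxy]
    ring
  have hRm : 2 * R = moment x y := by rw [← hsum, hphase]; ring
  have hcr : ∀ z : Bits k, ∫ ψ : Ket k, (ψ x * star (ψ y)).im * ‖ψ z‖ ^ 2 ∂haarState k = 0 := by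
    intro z
    rw [← integral_cross_eq_zero (x := z) hxy (-Complex.I)]
    congr 1
    funext ψ
    simp
  have key : ∀ (ψ : Ket k) (z w : Bits k),
      (‖((√2 : ℝ) : ℂ)⁻¹ * (ψ z + Complex.I * ψ w)‖ ^ 2) =
        (‖ψ z‖ ^ 2 + ‖ψ w‖ ^ 2 + 2 * (ψ z * star (ψ w)).im) / 2 := by
    intro ψ z w
    rw [norm_mul, mul_pow, norm_inv, Complex.norm_real, Real.norm_of_nonneg (Real.sqrt_nonneg 2),
      inv_pow, Real.sq_sqrt (by norm_num)]
    simp only [← Complex.normSq_eq_norm_sq, Complex.normSq_apply]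
    simp
    ring
  have hanti : ∀ ψ : Ket k, (ψ y * star (ψ x)).im = -(ψ x * star (ψ y)).im := by
    intro ψ
    simp
    ring
  -- Used with `s = 1` for the coordinate `x` and with `s = -1` for `y`, where the imaginary part
  -- changes sign.
  have expand : ∀ s : ℝ, ∫ ψ : Ket k, ((‖ψ x‖ ^ 2 + ‖ψ y‖ ^ 2 +
      s * (2 * (ψ x * star (ψ y)).im)) / 2) ^ 2 ∂haarState k =
      (moment x x + moment y y + 2 * moment x y + s ^ 2 * (4 * R)) / 4 := by
    intro s
    have e : ∀ ψ : Ket k, ((‖ψ x‖ ^ 2 + ‖ψ y‖ ^ 2 + s * (2 * (ψ x * star (ψ y)).im)) / 2) ^ 2 =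
        (((((1 / 4 * (‖ψ x‖ ^ 2 * ‖ψ x‖ ^ 2) + 1 / 4 * (‖ψ y‖ ^ 2 * ‖ψ y‖ ^ 2)) +
          1 / 2 * (‖ψ x‖ ^ 2 * ‖ψ y‖ ^ 2)) + s ^ 2 * ((ψ x * star (ψ y)).im) ^ 2) +
          s * ((ψ x * star (ψ y)).im * ‖ψ x‖ ^ 2)) +
          s * ((ψ x * star (ψ y)).im * ‖ψ y‖ ^ 2)) := fun ψ => by ring
    simp only [e]
    rw [integral_add (integrable_haarState (by fun_prop)) (integrable_haarState (by fun_prop)),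
      integral_add (integrable_haarState (by fun_prop)) (integrable_haarState (by fun_prop)),
      integral_add (integrable_haarState (by fun_prop)) (integrable_haarState (by fun_prop)),
      integral_add (integrable_haarState (by fun_prop)) (integrable_haarState (by fun_prop)),
      integral_add (integrable_haarState (by fun_prop)) (integrable_haarState (by fun_prop))]
    simp only [integral_const_mul, hcr]
    rw [← hR]
    simp only [moment]
    ring
  have h1 : moment x x = (moment x x + moment y y + 2 * moment x y + 4 * R) / 4 := by
    have := expand 1
    rw [one_pow, one_mul] at this
    rw [← this]
    conv_lhs => rw [moment]
    rw [← integral_mix (f := fun ψ => ‖ψ x‖ ^ 2 * ‖ψ x‖ ^ 2) (by fun_prop) x y]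
    congr 1
    funext ψ
    beta_reduce
    rw [Equiv.swap_apply_left, key ψ x y]
    ring
  have h2 : moment y y = (moment x x + moment y y + 2 * moment x y + 4 * R) / 4 := by
    have := expand (-1)
    rw [neg_one_sq, one_mul] at this
    rw [← this]
    conv_lhs => rw [moment]
    rw [← integral_mix (f := fun ψ => ‖ψ y‖ ^ 2 * ‖ψ y‖ ^ 2) (by fun_prop) x y]
    congr 1
    funext ψ
    beta_reduce
    rw [Equiv.swap_apply_right, key ψ y x, hanti]
    ring
  constructor <;> linarith

theorem card_bits (k : ℕ) : Fintype.card (Bits k) = 2 ^ k := by simp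

/-- All diagonal moments agree and are twice the off-diagonal ones. The sum over all pairs is the
mean of `‖ψ‖⁴`, which is `1`, and with `N = 2^k` it consists of `2N + N(N - 1) = N(N + 1)` copies of
the off-diagonal value. -/
theorem moment_value (x y : Bits k) :
    moment x y = (if x = y then 2 else 1) / (2 ^ k * (2 ^ k + 1)) := by
  have hself : ∀ z, moment z z = moment x x := fun z => by
    by_cases h : x = z
    · rw [h]
    · rw [(moment_eq h).1, (moment_eq h).2]
  have hall : ∀ z w, moment z w = (if z = w then 2 else 1) * (moment x x / 2) := fun z w => by
    by_cases h : z = w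
    · subst h; rw [if_pos rfl, hself]; ring
    · rw [if_neg h, ← hself z, (moment_eq h).1]; ring
  have hone : ∑ z : Bits k, ∑ w, moment z w = 1 := by
    simp only [moment]
    have e : ∀ z : Bits k, ∑ w, ∫ ψ : Ket k, ‖ψ z‖ ^ 2 * ‖ψ w‖ ^ 2 ∂haarState k =
        ∫ ψ : Ket k, ∑ w, ‖ψ z‖ ^ 2 * ‖ψ w‖ ^ 2 ∂haarState k := fun z =>
      (integral_finsetSum _ fun w _ => integrable_haarState (by fun_prop)).symm
    simp only [e]
    rw [← integral_finsetSum _ fun z _ => integrable_haarState (by fun_prop),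
      integral_haarState_congr (g := fun _ => 1) (by fun_prop) (by fun_prop)]
    · simp
    · intro ψ hψ
      rw [← Finset.sum_mul_sum]
      change ketNormSq ψ * ketNormSq ψ = 1
      rw [hψ, one_mul]
  have hcount : ∑ z : Bits k, ∑ w, moment z w =
      (2 ^ k * (2 ^ k + 1)) * (moment x x / 2) := by
    generalize moment x x / 2 = m at hall
    simp only [hall, ← Finset.sum_mul]
    congr 1
    have e : ∀ z : Bits k, ∑ w, (if z = w then 2 else 1 : ℝ) = 2 ^ k + 1 := fun z => by
      have : ∀ w, (if z = w then 2 else 1 : ℝ) = 1 + if z = w then 1 else 0 := fun w => by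
        split_ifs <;> norm_num
      simp only [this, Finset.sum_add_distrib, Finset.sum_ite_eq, Finset.mem_univ, if_true,
        Finset.sum_const, Finset.card_univ, card_bits]
      simp
    simp only [e, Finset.sum_const, Finset.card_univ, card_bits]
    simp
    ring
  rw [hcount] at hone
  have hpos : (0 : ℝ) < 2 ^ k * (2 ^ k + 1) := by positivity
  rw [hall, eq_div_iff hpos.ne', mul_assoc, mul_comm (moment x x / 2), hone, mul_one]

/-- Expanding the square, the terms with two different indices vanish by `integral_cross_eq_zero`;
the rest are second moments. -/
theorem integral_row (w : Bits k → ℂ) (x : Bits k) :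
    ∫ ψ : Ket k, ‖∑ y, w y * ψ y‖ ^ 2 * ‖ψ x‖ ^ 2 ∂haarState k =
      (∑ y, ‖w y‖ ^ 2 + ‖w x‖ ^ 2) / (2 ^ k * (2 ^ k + 1)) := by
  have e : ∀ ψ : Ket k, ‖∑ y, w y * ψ y‖ ^ 2 * ‖ψ x‖ ^ 2 =
      ∑ y, ∑ z, (w y * star (w z) * ψ y * star (ψ z)).re * ‖ψ x‖ ^ 2 := by
    intro ψ
    have h1 : ((‖∑ y, w y * ψ y‖ ^ 2 : ℝ) : ℂ) =
        ∑ y, ∑ z, w y * star (w z) * ψ y * star (ψ z) := by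
      rw [Complex.ofReal_pow, ← Complex.mul_conj', map_sum, Finset.sum_mul_sum]
      refine Finset.sum_congr rfl fun y _ => Finset.sum_congr rfl fun z _ => ?_
      rw [map_mul, RCLike.star_def]
      ring
    have h2 : ‖∑ y, w y * ψ y‖ ^ 2 = ∑ y, ∑ z, (w y * star (w z) * ψ y * star (ψ z)).re := by
      rw [← Complex.ofReal_re (‖∑ y, w y * ψ y‖ ^ 2), h1]
      simp only [Complex.re_sum]
    rw [h2, Finset.sum_mul]
    simp only [Finset.sum_mul]
  simp only [e]
  rw [integral_finsetSum _ fun y _ => integrable_haarState (by fun_prop)]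
  have hy : ∀ y : Bits k, ∫ ψ : Ket k, ∑ z, (w y * star (w z) * ψ y * star (ψ z)).re * ‖ψ x‖ ^ 2
      ∂haarState k = ‖w y‖ ^ 2 * moment y x := by
    intro y
    rw [integral_finsetSum _ fun z _ => integrable_haarState (by fun_prop),
      Finset.sum_eq_single y]
    · rw [moment, ← integral_const_mul]
      congr 1
      funext ψ
      have : w y * star (w y) * ψ y * star (ψ y) = ((‖w y‖ ^ 2 * ‖ψ y‖ ^ 2 : ℝ) : ℂ) := by
        rw [mul_assoc, RCLike.star_def, Complex.mul_conj', Complex.mul_conj']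
        norm_cast
      rw [this, Complex.ofReal_re]
      ring
    · intro z _ hz
      exact integral_cross_eq_zero hz.symm _
    · simp
  simp only [hy, moment_value, mul_div_assoc']
  rw [← Finset.sum_div]
  congr 1
  have : ∀ y, ‖w y‖ ^ 2 * (if y = x then 2 else 1 : ℝ) =
      ‖w y‖ ^ 2 + if y = x then ‖w y‖ ^ 2 else 0 := fun y => by split_ifs <;> ring
  simp only [this, Finset.sum_add_distrib, Finset.sum_ite_eq', Finset.mem_univ, if_true]

/-- The average of the product of two outcome probabilities in a Haar-random state. -/
theorem integral_ketNormSq_mul {n : ℕ} (A : Matrix (Bits n) (Bits k) ℂ) (x : Bits k) :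
    ∫ ψ : Ket k, ketNormSq (A *ᵥ ψ) * ‖ψ x‖ ^ 2 ∂haarState k =
      (∑ y, ketNormSq (A *ᵥ basisKet y) + ketNormSq (A *ᵥ basisKet x)) /
        (2 ^ k * (2 ^ k + 1)) := by
  simp only [ketNormSq, Finset.sum_mul, Matrix.mulVec, dotProduct]
  rw [integral_finsetSum _ fun y _ => integrable_haarState (by fun_prop)]
  simp only [integral_row]
  rw [← Finset.sum_div, Finset.sum_add_distrib, Finset.sum_comm]
  simp [basisKet, Pi.single_apply]

end Moments

end LSN

end

/-! ### The reduction with one call: measure and prepare. -/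

noncomputable section

namespace LSN

/-! ## Inputs and oracles -/

theorem tableEntry_row {n : ℕ} (f : Fin n ⊕ Fin n → Fin n → Bool) (g : Fin n ⊕ Fin n)
    (j : Fin n) : tableEntry f (rowIndex g * n + j) = (f g j).toNat := by
  have hn : 0 < n := j.pos
  have h1 : (rowIndex g * n + j) / n = rowIndex g := by
    rw [mul_comm, Nat.mul_add_div hn, Nat.div_eq_of_lt j.2, add_zero]
  have h2 : (rowIndex g * n + j) % n = j := by
    rw [mul_comm, Nat.mul_add_mod, Nat.mod_eq_of_lt j.2]
  have h3 : rowOfIndex n (rowIndex g) = some g := by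
    rcases g with i | i <;> simp [rowOfIndex, rowIndex]
  rw [tableEntry, h1, h3]
  simp [h2]

theorem rowOfIndex_rowIndex {n : ℕ} (g : Fin n ⊕ Fin n) : rowOfIndex n (rowIndex g) = some g := by
  rcases g with i | i <;> simp [rowOfIndex, rowIndex]

theorem getTableau_of_arr {n k : ℕ} {s : Config} {T : Tableau n} {φ : Ket n} {ax az asgn : ℕ}
    (hx : s.arr ax = (Config.start k T φ).arr 0) (hz : s.arr az = (Config.start k T φ).arr 1)
    (hs : s.arr asgn = (Config.start k T φ).arr 2) : s.getTableau n ax az asgn = T := by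
  funext g
  have e : ∀ b : Bool, decide (b.toNat ≠ 0) = b := by decide
  refine Prod.ext (funext fun j => Prod.ext ?_ ?_) ?_
  · simp only [Config.getTableau, hx, Config.start, if_true]
    rw [tableEntry_row, e]
  · simp only [Config.getTableau, hz, Config.start, if_true, one_ne_zero, if_false]
    rw [tableEntry_row, e]
  · simp only [Config.getTableau, hs, Config.start, if_true, OfNat.ofNat_ne_zero, if_false,
      OfNat.ofNat_ne_one, rowOfIndex_rowIndex]
    rw [e]

theorem start_vec {n k : ℕ} (T : Tableau n) (φ : Ket n) : (Config.start k T φ).vec = ket 0 φ := rfl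

theorem Oracle.sum_prob {n k : ℕ} (O : Oracle n k) (T : Tableau n) (φ : Ket n) :
    ∑ x, O.prob T φ x = ketNormSq φ := by
  apply Complex.ofReal_injective
  rw [Complex.ofReal_sum]
  simp only [Oracle.prob, ketNormSq_eq, Matrix.star_mulVec, Matrix.dotProduct_mulVec,
    Matrix.vecMul_vecMul]
  rw [← sum_dotProduct, ← Matrix.vecMul_sum, O.complete, Matrix.vecMul_one]

theorem Oracle.prob_smul {n k : ℕ} (O : Oracle n k) (T : Tableau n) (φ : Ket n) (x : Bits k)
    (c : ℂ) : O.prob T (c • φ) x = ‖c‖ ^ 2 * O.prob T φ x := by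
  rw [Oracle.prob, Matrix.mulVec_smul, ketNormSq_smul, Oracle.prob]

theorem getBits_setBits {m : ℕ} (s : Config) (a : ℕ) (x : Bits m) :
    (s.setBits a x).getBits a m = x := by
  funext i
  have e : ∀ b : Bool, decide (b.toNat ≠ 0) = b := by decide
  simp only [Config.getBits, Config.setBits, Function.update_self, Fin.is_lt, dif_pos]
  exact e _

/-! ## One query and a basis state -/

/-- The Pauli gate `X` as a program. -/
def xProg (a i : ℕ) : Program := block [
  .had a i, .tgate a i, .tgate a i, .tgate a i, .tgate a i, .had a i]

/-- Query the oracle on the input, and write the answer into the output register. -/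
def guessProg : Program := block [
  .query 0 1 2 0 3, .const 10 0, .const 3 1,
  .loop 1 (block [.load 12 3 10, .ite 12 (xProg 1 10) nop, .add 10 10 3])]

theorem gateX_writeBits {a m : ℕ} (b : Bits m) (i : Fin m) (c : ℂ) :
    gateX (a, (i : ℕ)) (c • Finsupp.single (writeBits a m b) 1) =
      c • Finsupp.single (writeBits a m (Function.update b i (!b i))) 1 := by
  have := symmDiff_writeBits_union (a := a) (b := b) (R := ∅) i (by simp)
  rw [Finset.union_empty, Finset.union_empty] at this
  rw [gateX, onBasis_smul, onBasis_single, this, one_smul]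

theorem guessLoop_spec {n k : ℕ} {O : Option (Oracle n k)} (s : Config) (x : Bits k) (c : ℂ)
    (h1 : s.var 1 = k) (hx : s.getBits 3 k = x) (hv : s.vec = c • vac) :
    ∃ s', (block [.const 10 0, .const 3 1,
        .loop 1 (block [.load 12 3 10, .ite 12 (xProg 1 10) nop, .add 10 10 3])]).run O s = {s'} ∧
      Frame Set.univ ∅ (10 + 20 * k) s s' ∧
      s'.vec = c • Finsupp.single (writeBits 1 k x) 1 := by
  obtain ⟨s1, hs1⟩ : ∃ s1, s1 = ((s.tick.setVar 10 0).tick.setVar 3 1) := ⟨_, rfl⟩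
  obtain ⟨s2, hr, hf, hv2, -⟩ := run_loop (O := O) (x := 1) (s := s1)
    (P := block [.load 12 3 10, .ite 12 (xProg 1 10) nop, .add 10 10 3])
    (fun i s' => Frame Set.univ ∅ (3 + 20 * i) s s' ∧
      s'.vec = c • Finsupp.single (writeBits 1 k fun j => if (j : ℕ) < i then x j else false) 1 ∧
      s'.var 10 = i ∧ s'.var 3 = 1)
    ⟨⟨by simp, by simp [hs1, Config.tick, Config.setVar], by simp [hs1, Config.tick, Config.setVar],
      by simp [hs1, Config.tick, Config.setVar]⟩, by
      simp [hs1, Config.tick, Config.setVar, hv, vac, writeBits_false],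
      by simp [hs1, Config.tick, Config.setVar],
      by simp [hs1, Config.tick, Config.setVar]⟩ (by
    rintro i hi s' ⟨hf, hv, h10, h3⟩
    have hik : i < k := by
      have : s1.var 1 = k := by simp [hs1, Config.tick, Config.setVar, h1]
      omega
    have hx' : x ⟨i, hik⟩ = decide (s'.arr 3 i ≠ 0) := by
      rw [← hx, hf.arr 3 (by simp)]; rfl
    have ht := hf.time
    have e : writeBits 1 k (fun j => if (j : ℕ) < i + 1 then x j else false) =
        writeBits 1 k (if x ⟨i, hik⟩ then Function.update
          (fun j : Fin k => if (j : ℕ) < i then x j else false) ⟨i, hik⟩ true else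
          fun j => if (j : ℕ) < i then x j else false) := by
      congr 1
      funext j
      have hlt : (if (j : ℕ) < i + 1 then x j else false) =
          if (j : ℕ) < i then x j else if j = ⟨i, hik⟩ then x j else false := by
        by_cases h : (j : ℕ) < i
        · rw [if_pos h, if_pos (by omega)]
        · by_cases h' : j = ⟨i, hik⟩
          · subst h'; simp
          · rw [if_neg h, if_neg h', if_neg]
            have : (j : ℕ) ≠ i := fun hh => h' (Fin.ext hh)
            omega
      rw [hlt]
      by_cases h' : j = ⟨i, hik⟩
      · subst h'
        cases hxi : x ⟨i, hik⟩ <;> simp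
      · cases hxi : x ⟨i, hik⟩ <;> simp [h']
    rw [e]
    by_cases h0 : s'.arr 3 i = 0
    · simp only [block, nop, Program.run, Config.tick, Config.setVar, Multiset.singleton_bind,
        Function.update_apply, h10, h0, if_true, if_false, Nat.reduceEqDiff, h3]
      refine ⟨_, rfl, ⟨by simp, fun a ha => hf.arr a ha, ?_, hf.calls⟩, ?_, rfl, ?_⟩
      · simp only; omega
      · rw [hx', h0]; simpa using hv
      · simp [h3]
    · simp only [block, nop, xProg, Program.run, Config.tick, Config.setVar, Config.mapVec,
        Multiset.singleton_bind, Function.update_apply, h10, h0, if_true, if_false,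
        Nat.reduceEqDiff, h3, gateT_gateT, gateS_gateS, gateH_gateZ_gateH]
      refine ⟨_, rfl, ⟨by simp, fun a ha => hf.arr a ha, ?_, hf.calls⟩, ?_, rfl, ?_⟩
      · simp only; omega
      · simp only [hx', h0, ne_eq, not_false_iff, decide_true, if_true, hv]
        rw [gateX_writeBits _ (⟨i, hik⟩ : Fin k)]
        simp
      · simp [h3])
  refine ⟨s2, ?_, ?_, ?_⟩
  · rw [block, run_seq rfl, block, run_seq (s' := s1) (by rw [hs1]; rfl), block, hr]
  · have : s1.var 1 = k := by simp [hs1, Config.tick, Config.setVar, h1]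
    rw [this] at hf
    exact hf.mono subset_rfl subset_rfl (by omega)
  · have : s1.var 1 = k := by simp [hs1, Config.tick, Config.setVar, h1]
    rw [hv2, this]
    simp

theorem bind_map_of_singleton {α β γ : Type*} {m : Multiset α} {f : α → β}
    {r : β → Multiset γ} {g : α → γ} (h : ∀ a, r (f a) = {g a}) :
    (m.map f).bind r = m.map g := by
  rw [Multiset.bind_map]
  simp only [h, Multiset.bind_singleton]

/-- Branches are indexed by the answer and by the outcome of measuring the register that the oracle
consumes; the latter only splits the probability of an answer into squared amplitudes. -/
theorem guessProg_run {n k : ℕ} (O : Oracle n k) (T : Tableau n) (φ : Ket n) :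
    ∃ g : Bits k × Bits n → Config,
      guessProg.run (some O) (Config.start k T φ) = Finset.univ.val.map g ∧
      ∀ o, (g o).time ≤ 11 + 20 * k ∧ (g o).calls = 1 ∧
        (g o).vec = (O.op T o.1 *ᵥ φ) o.2 • Finsupp.single (writeBits 1 k o.1) 1 := by
  have hT : (Config.start k T φ).tick.getTableau n 0 1 2 = T :=
    getTableau_of_arr (k := k) (φ := φ) rfl rfl rfl
  have hT' : (Config.start k T φ).getTableau n 0 1 2 = T :=
    getTableau_of_arr (k := k) (φ := φ) rfl rfl rfl
  set f : Bits k × Bits n → Config := fun o =>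
    { (((Config.start k T φ).tick.setBits 3 o.1).mapVec
        (contract 0 n (O.op ((Config.start k T φ).getTableau n 0 1 2) o.1 o.2))) with
      calls := (Config.start k T φ).calls + 1 } with hf
  have hf1 : ∀ o, (f o).vec = (O.op T o.1 *ᵥ φ) o.2 • vac := by
    intro o
    change contract 0 n _ (ket 0 φ) = _
    rw [contract_ket, hT']
    rfl
  have hspec := fun o => guessLoop_spec (O := some O) (f o) o.1 _ rfl
    (getBits_setBits (Config.start k T φ).tick 3 o.1) (hf1 o)
  choose g hg1 hg2 hg3 using hspec
  refine ⟨g, ?_, fun o => ⟨?_, ?_, hg3 o⟩⟩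
  · rw [guessProg, block, Program.run]
    exact bind_map_of_singleton hg1
  · have := (hg2 o).time
    have h1 : (f o).time = 1 := rfl
    omega
  · rw [(hg2 o).calls]; rfl

theorem sum_map_univ {α : Type*} [Fintype α] {g : α → Config} (F : Config → ℝ) :
    (((Finset.univ : Finset α).val.map g).map F).sum = ∑ o, F (g o) := by
  rw [Multiset.map_map]; rfl

theorem guessProg_fidelity {n k : ℕ} (O : Oracle n k) (T : Tableau n) (φ : Ket n) (ψ : Ket k) :
    guessProg.outputFidelity (some O) T φ ψ = ∑ x, O.prob T φ x * ‖ψ x‖ ^ 2 := by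
  obtain ⟨g, hg, h⟩ := guessProg_run O T φ
  rw [Program.outputFidelity, hg, sum_map_univ, Fintype.sum_prod_type]
  refine Finset.sum_congr rfl fun x _ => ?_
  rw [Oracle.prob, ketNormSq, Finset.sum_mul]
  refine Finset.sum_congr rfl fun o _ => ?_
  rw [(h (x, o)).2.2, contract, onBasis_smul, onBasis_single, clearBits_writeBits,
    readBits_writeBits, one_smul, qmemNormSq_smul, qmemNormSq_single, norm_star]

/-! ## Average fidelity of a guess -/

/-- The noisy encoding as a matrix. -/
def noisyMatrix {n k : ℕ} (hk : k ≤ n) (T : Tableau n) (E : PauliString n) :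
    Matrix (Bits n) (Bits k) ℂ :=
  pauliOp E * cliffordOp T * Matrix.of fun b x => padKet hk (basisKet x) b

theorem noisyCodeword_eq_mulVec {n k : ℕ} (hk : k ≤ n) (T : Tableau n) (E : PauliString n)
    (ψ : Ket k) : noisyCodeword hk T E ψ = noisyMatrix hk T E *ᵥ ψ := by
  rw [noisyCodeword, noisyMatrix, ← Matrix.mulVec_mulVec (v := ψ)]
  congr 1
  rw [padKet_eq]
  funext b
  simp only [Finset.sum_apply, Pi.smul_apply, smul_eq_mul, Matrix.mulVec, dotProduct,
    Matrix.of_apply, padKet_basisKet]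
  exact Finset.sum_congr rfl fun x _ => mul_comm _ _

theorem continuous_ketNormSq {n : ℕ} : Continuous (ketNormSq : Ket n → ℝ) := by
  unfold ketNormSq
  fun_prop

theorem ketNormSq_noisyCodeword {n k : ℕ} (hk : k ≤ n) {T : Tableau n} (hT : T ∈ cliffords n)
    (E : PauliString n) (x : Bits k) : ketNormSq (noisyCodeword hk T E (basisKet x)) = 1 := by
  rw [noisyCodeword, padKet_basisKet, ketNormSq_unitary, ketNormSq_basisKet]
  exact mul_mem (pauliOp_unitary E) (cliffordOp_hasTableau hT).1.1

/-- For fixed `C` and `E`, the fidelity is the sum over `x` of `Pr[x]` times `|ψ_x|²`. By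
`integral_ketNormSq_mul` its Haar average involves only the answers to basis states: the terms `Pr[x
| y]` add up to `2^k` since the measurement is complete, and the terms `Pr[x | x]` to `2^k` times
the success probability. The result is exact, so the gain over `2^{-k}` is the advantage divided by
`2^k + 1`. -/
theorem guessProg_slsnFidelity {n k : ℕ} (hk : k ≤ n) (p : ℝ) (O : Oracle n k) :
    guessProg.slsnFidelity hk p (some O) = (1 + O.lsnSuccess hk p) / (2 ^ k + 1) := by
  have hd : (0 : ℝ) < 2 ^ k := by positivity
  have hint : ∀ T ∈ cliffords n, ∀ E : PauliString n,
      ∫ ψ, guessProg.outputFidelity (some O) T (noisyCodeword hk T E ψ) ψ ∂haarState k =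
      (1 + (∑ x, O.prob T (noisyCodeword hk T E (basisKet x)) x) / 2 ^ k) / (2 ^ k + 1) := by
    intro T hT E
    simp only [guessProg_fidelity, Oracle.prob, noisyCodeword_eq_mulVec, Matrix.mulVec_mulVec]
    rw [integral_finsetSum]
    · simp only [integral_ketNormSq_mul]
      rw [← Finset.sum_div, Finset.sum_add_distrib, Finset.sum_comm]
      have : ∀ y, ∑ x, ketNormSq ((O.op T x * noisyMatrix hk T E) *ᵥ basisKet y) = 1 := by
        intro y
        rw [← ketNormSq_noisyCodeword hk hT E y, ← O.sum_prob T]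
        simp only [Oracle.prob, noisyCodeword_eq_mulVec, Matrix.mulVec_mulVec]
      simp only [this, Finset.sum_const, Finset.card_univ, card_bits]
      simp only [nsmul_eq_mul, Nat.cast_pow, Nat.cast_ofNat, mul_one]
      field_simp
    · intro x _
      refine integrable_haarState ((continuous_ketNormSq.comp ?_).mul (by fun_prop))
      exact Continuous.matrix_mulVec continuous_const continuous_id
  rw [Program.slsnFidelity, slsnAverage, Oracle.lsnSuccess, lsnAverage]
  have hc : (0 : ℝ) < (cliffords n).card := by exact_mod_cast card_cliffords_pos n
  have e1 : ∑ T ∈ cliffords n, ∑ E : PauliString n, depolarizing p E *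
      ∫ ψ, guessProg.outputFidelity (some O) T (noisyCodeword hk T E ψ) ψ ∂haarState k =
      ∑ T ∈ cliffords n, ∑ E : PauliString n, (depolarizing p E / (2 ^ k + 1) +
        (∑ x, depolarizing p E * O.prob T (noisyCodeword hk T E (basisKet x)) x) /
          (2 ^ k * (2 ^ k + 1))) := by
    refine Finset.sum_congr rfl fun T hT => Finset.sum_congr rfl fun E _ => ?_
    rw [hint T hT E, ← Finset.mul_sum]
    field_simp
  rw [e1]
  simp only [Finset.sum_add_distrib, ← Finset.sum_div, sum_depolarizing, Finset.sum_const,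
    nsmul_eq_mul]
  field_simp

theorem guessProg_exceeds {k : ℕ → ℕ} (hk : ∀ n, k n ≤ n) {p : ℕ → ℝ}
    (hlog : Asymptotics.IsBigO Filter.atTop (fun n => (k n : ℝ)) (fun n => Real.log n))
    (O : (n : ℕ) → Oracle n (k n))
    (h : ExceedsByInvPoly (fun n => (O n).lsnSuccess (hk n) (p n)) (fun n => 1 / 2 ^ k n)) :
    ExceedsByInvPoly (fun n => guessProg.slsnFidelity (hk n) (p n) (some (O n)))
      (fun n => 1 / 2 ^ k n) := by
  obtain ⟨d, hd⟩ := h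
  obtain ⟨c, hc⟩ := hlog.bound
  obtain ⟨m, hm⟩ := exists_nat_ge c
  -- The loss is the factor `2^k + 1`. Since `k ≤ m log n` and `log 2 ≤ 1`, one has `2^k ≤ n^m`; one
  -- further factor `n ≥ 2` absorbs the `+ 1`.
  refine ⟨d + (m + 1), ?_⟩
  filter_upwards [hd, hc, eventually_ge_atTop 2] with n hn hcn h2
  have hn2 : (2 : ℝ) ≤ n := by exact_mod_cast h2
  have hn0 : (0 : ℝ) < n := by linarith
  have hlog0 : 0 ≤ Real.log n := Real.log_nonneg (by linarith)
  rw [Real.norm_of_nonneg (by positivity), Real.norm_of_nonneg hlog0] at hcn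
  have hpow : (2 : ℝ) ^ k n ≤ (n : ℝ) ^ m := by
    have h1 : (k n : ℝ) * Real.log 2 ≤ m * Real.log n := by
      have hl2 : Real.log 2 ≤ 1 := by linarith [Real.log_two_lt_d9]
      have hl2' : 0 ≤ Real.log 2 := Real.log_nonneg (by norm_num)
      calc (k n : ℝ) * Real.log 2 ≤ k n * 1 := by gcongr
        _ = k n := mul_one _
        _ ≤ c * Real.log n := hcn
        _ ≤ m * Real.log n := by gcongr
    rw [← Real.log_pow, ← Real.log_pow] at h1
    exact (Real.log_le_log_iff (by positivity) (by positivity)).1 h1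
  have hd1 : (2 : ℝ) ^ k n + 1 ≤ (n : ℝ) ^ (m + 1) := by
    have h1 : (1 : ℝ) ≤ 2 ^ k n := one_le_pow₀ (by norm_num)
    calc (2 : ℝ) ^ k n + 1 ≤ 2 ^ k n + 2 ^ k n := by linarith
      _ = 2 ^ k n * 2 := by ring
      _ ≤ (n : ℝ) ^ m * n := by gcongr
      _ = (n : ℝ) ^ (m + 1) := (pow_succ _ _).symm
  simp only [guessProg_slsnFidelity]
  have hdp : (0 : ℝ) < 2 ^ k n := by positivity
  rw [le_div_iff₀ (by positivity)]
  have h3 : 1 / (n : ℝ) ^ (d + (m + 1)) * (2 ^ k n + 1) ≤ 1 / (n : ℝ) ^ d := by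
    rw [pow_add, one_div_mul_eq_div, div_le_div_iff₀ (by positivity) (by positivity), one_mul,
      mul_comm]
    gcongr
  have h4 : 1 / (2 : ℝ) ^ k n * (2 ^ k n + 1) = 1 + 1 / 2 ^ k n := by field_simp
  rw [add_mul, h4]
  linarith

end LSN

end

/-! ### Relocating a solver in memory, and conservation of probability over its branches. -/

noncomputable section

namespace LSN

/-! ## Programs run on renamed memory -/

/-- Rename the variables, the arrays and the arrays of qubits of a program. -/
def Program.rename (f : ℕ → ℕ) : Program → Program
  | const x m => const (f x) m
  | add x y z => add (f x) (f y) (f z)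
  | sub x y z => sub (f x) (f y) (f z)
  | load x a i => load (f x) (f a) (f i)
  | store a i x => store (f a) (f i) (f x)
  | had a i => had (f a) (f i)
  | tgate a i => tgate (f a) (f i)
  | cx a i b j => cx (f a) (f i) (f b) (f j)
  | meas x a i => meas (f x) (f a) (f i)
  | query ax az asgn a out => query (f ax) (f az) (f asgn) (f a) (f out)
  | seq P Q => seq (P.rename f) (Q.rename f)
  | ite x P Q => ite (f x) (P.rename f) (Q.rename f)
  | loop x P => loop (f x) (P.rename f)

/-- A configuration placed into the part of the memory with names in the range of `f`; the rest
of the memory is taken from `s`. -/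
def embed (f : ℕ → ℕ) (s : Config) (F : QMem → QMem) (c : Config) : Config where
  var := Function.extend f c.var s.var
  arr := Function.extend f c.arr s.arr
  vec := F c.vec
  time := s.time + c.time
  calls := s.calls + c.calls

/-- A linear map on the quantum memory that turns operations on the qubits of the array `a` into
operations on those of the array `f a`. -/
structure Intertwines (f : ℕ → ℕ) (F : QMem → QMem) : Prop where
  had : ∀ a i v, gateH (f a, i) (F v) = F (gateH (a, i) v)
  tgate : ∀ a i v, gateT (f a, i) (F v) = F (gateT (a, i) v)
  cx : ∀ a i b j v, gateCX (f a, i) (f b, j) (F v) = F (gateCX (a, i) (b, j) v)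
  project : ∀ a i o v, projectQubit (f a, i) o (F v) = F (projectQubit (a, i) o v)

theorem update_extend {α : Type*} {f : ℕ → ℕ} (hf : Function.Injective f) (g h : ℕ → α) (x : ℕ)
    (y : α) : Function.update (Function.extend f g h) (f x) y =
      Function.extend f (Function.update g x y) h := by
  funext z
  by_cases hz : ∃ w, f w = z
  · obtain ⟨w, rfl⟩ := hz
    rw [hf.extend_apply, Function.update_apply, hf.extend_apply, Function.update_apply]
    simp only [hf.eq_iff]
  · rw [Function.extend_apply' _ _ _ hz, Function.update_apply, Function.extend_apply' _ _ _ hz,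
      if_neg]
    exact fun hh => hz ⟨x, hh.symm⟩

theorem repeatRun_map {f g : Config → Multiset Config} {e : Config → Config}
    (h : ∀ s, f (e s) = (g s).map e) (m : ℕ) (s : Config) :
    repeatRun f m (e s) = (repeatRun g m s).map e := by
  induction m generalizing s with
  | zero => rfl
  | succ m ih =>
    rw [repeatRun, repeatRun, h, Multiset.bind_map, Multiset.map_bind]
    exact Multiset.bind_congr fun c _ => ih c

section

variable {f : ℕ → ℕ} {F : QMem → QMem} {s : Config}

theorem embed_tick (c : Config) : (embed f s F c).tick = embed f s F c.tick := rfl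

theorem embed_var (hf : Function.Injective f) (c : Config) (x : ℕ) :
    (embed f s F c).var (f x) = c.var x := hf.extend_apply _ _ _

theorem embed_arr (hf : Function.Injective f) (c : Config) (x : ℕ) :
    (embed f s F c).arr (f x) = c.arr x := hf.extend_apply _ _ _

theorem embed_setVar (hf : Function.Injective f) (c : Config) (x m : ℕ) :
    (embed f s F c).setVar (f x) m = embed f s F (c.setVar x m) := by
  simp only [embed, Config.setVar, update_extend hf]

theorem embed_setArr (hf : Function.Injective f) (c : Config) (a i m : ℕ) :
    (embed f s F c).setArr (f a) i m = embed f s F (c.setArr a i m) := by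
  simp only [embed, Config.setArr, update_extend hf, hf.extend_apply]

theorem embed_mapVec {c : Config} {G H : QMem → QMem} (h : ∀ v, G (F v) = F (H v)) :
    (embed f s F c).mapVec G = embed f s F (c.mapVec H) := by
  simp only [embed, Config.mapVec, h]

/-- Injectivity of `f` keeps different names different, and `F` carries every quantum instruction
along, so the renamed program has the same tree of branches. Without an oracle a `query` is a mere
tick, so only gates and projections need to be intertwined. -/
theorem run_rename (n k : ℕ) (hf : Function.Injective f) (hF : Intertwines f F) (P : Program)
    (c : Config) : (P.rename f).run (none : Option (Oracle n k)) (embed f s F c) =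
      (P.run (none : Option (Oracle n k)) c).map (embed f s F) := by
  induction P generalizing c with
  | const x m => simp only [Program.rename, Program.run, embed_tick, embed_setVar hf,
      Multiset.map_singleton]
  | add x y z => simp only [Program.rename, Program.run, embed_tick, embed_setVar hf, embed_var hf,
      Multiset.map_singleton]
  | sub x y z => simp only [Program.rename, Program.run, embed_tick, embed_setVar hf, embed_var hf,
      Multiset.map_singleton]
  | load x a i => simp only [Program.rename, Program.run, embed_tick, embed_setVar hf,
      embed_var hf, embed_arr hf, Multiset.map_singleton]
  | store a i x => simp only [Program.rename, Program.run, embed_tick, embed_setArr hf,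
      embed_var hf, Multiset.map_singleton]
  | had a i => simp only [Program.rename, Program.run, embed_tick, embed_mapVec (hF.had _ _),
      embed_var hf, Multiset.map_singleton]
  | tgate a i => simp only [Program.rename, Program.run, embed_tick, embed_mapVec (hF.tgate _ _),
      embed_var hf, Multiset.map_singleton]
  | cx a i b j => simp only [Program.rename, Program.run, embed_tick,
      embed_mapVec (hF.cx _ _ _ _), embed_var hf, Multiset.map_singleton]
  | meas x a i => simp only [Program.rename, Program.run, embed_tick, embed_setVar hf,
      embed_mapVec (hF.project _ _ _), embed_var hf, Multiset.map_map, Function.comp_def]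
  | query ax az asgn a out => simp only [Program.rename, Program.run, embed_tick,
      Multiset.map_singleton]
  | seq P Q hP hQ =>
    simp only [Program.rename, Program.run, hP, Multiset.bind_map, Multiset.map_bind, hQ]
  | ite x P Q hP hQ =>
    simp only [Program.rename, Program.run, embed_tick, embed_var hf, hP, hQ]
    split_ifs <;> rfl
  | loop x P hP =>
    simp only [Program.rename, Program.run, embed_tick, embed_var hf]
    exact repeatRun_map (fun c => by rw [embed_tick, hP]) _ _

end

theorem rename_id (P : Program) : P.rename id = P := by
  induction P <;> simp_all [Program.rename]

theorem mem_repeatRun {r : Config → Multiset Config} {p : Config → Prop}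
    (h : ∀ c, p c → ∀ c' ∈ r c, p c') {m : ℕ} {c c' : Config} (hc : p c)
    (hm : c' ∈ repeatRun r m c) : p c' := by
  induction m generalizing c with
  | zero => rw [repeatRun, Multiset.mem_singleton] at hm; rwa [hm]
  | succ m ih =>
    rw [repeatRun, Multiset.mem_bind] at hm
    obtain ⟨d, hd, hm⟩ := hm
    exact ih (h c hc d hd) hm

theorem calls_of_mem_run {n k : ℕ} (P : Program) {c c' : Config}
    (h : c' ∈ P.run (none : Option (Oracle n k)) c) : c'.calls = c.calls := by
  induction P generalizing c c' with
  | const | add | sub | load | store | had | tgate | cx | query =>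
    rw [Program.run, Multiset.mem_singleton] at h
    rw [h]; rfl
  | meas x a i =>
    rw [Program.run, Multiset.mem_map] at h
    obtain ⟨b, -, rfl⟩ := h
    rfl
  | seq P Q hP hQ =>
    rw [Program.run, Multiset.mem_bind] at h
    obtain ⟨d, hd, h⟩ := h
    rw [hQ h, hP hd]
  | ite x P Q hP hQ =>
    rw [Program.run] at h
    split_ifs at h
    · exact (hQ h).trans rfl
    · exact (hP h).trans rfl
  | loop x P hP =>
    rw [Program.run] at h
    exact mem_repeatRun (c := c.tick) (r := fun s => P.run none s.tick) (p := fun d => d.calls = c.calls)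
      (fun d hd d' hd' => ((hP hd').trans rfl).trans hd) rfl h

/-! ## Conservation of probability -/

/-- The decomposition `|0⟩a + |1⟩b` with respect to the qubit `q`. -/
theorem exists_split {q : Qubit} (v : QMem) : ∃ a ∈ Supp {q}ᶜ, ∃ b ∈ Supp {q}ᶜ,
    v = a + tens (Finsupp.single {q} 1) b := by
  refine Supp_induction (A := Set.univ) (p := fun v => ∃ a ∈ Supp {q}ᶜ, ∃ b ∈ Supp {q}ᶜ,
    v = a + tens (Finsupp.single {q} 1) b) ?_ ?_ ?_ (v := v) ?_
  · exact ⟨0, zero_mem _, 0, zero_mem _, by simp⟩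
  · rintro _ _ ⟨a, ha, b, hb, rfl⟩ ⟨a', ha', b', hb', rfl⟩
    exact ⟨a + a', add_mem ha ha', b + b', add_mem hb hb', by rw [map_add]; abel⟩
  · intro S z _
    by_cases hq : q ∈ S
    · refine ⟨0, zero_mem _, Finsupp.single (S.erase q) z, single_mem_Supp ?_, ?_⟩
      · intro x hx hxq
        rw [Set.mem_singleton_iff.1 hxq] at hx
        simp at hx
      · rw [tens_single, zero_add, one_mul, ← Finset.insert_eq, Finset.insert_erase hq]
    · refine ⟨Finsupp.single S z, single_mem_Supp ?_, 0, zero_mem _, by simp⟩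
      intro x hx hxq
      rw [Set.mem_singleton_iff.1 hxq] at hx
      exact hq (by simpa using hx)
  · rw [show v = ∑ S ∈ v.support, Finsupp.single S (v S) from (Finsupp.sum_single v).symm]
    exact Submodule.sum_mem _ fun S _ => single_mem_Supp (Set.subset_univ _)

theorem qmemNormSq_split {q : Qubit} {a b : QMem} (ha : a ∈ Supp {q}ᶜ) (hb : b ∈ Supp {q}ᶜ) :
    qmemNormSq (a + tens (Finsupp.single {q} 1) b) = qmemNormSq a + qmemNormSq b := by
  have h1 : tens (Finsupp.single {q} 1) b ∈ Finsupp.supported ℂ ℂ {S : Finset Qubit | q ∈ S} := by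
    refine Supp_induction (p := fun b => tens (Finsupp.single {q} 1) b ∈
      Finsupp.supported ℂ ℂ {S : Finset Qubit | q ∈ S}) ?_ ?_ ?_ hb
    · simp
    · intro u v hu hv
      rw [map_add]
      exact add_mem hu hv
    · intro S z _
      rw [tens_single]
      exact Finsupp.single_mem_supported _ _ (by simp)
  have h2 : Disjoint a.support (tens (Finsupp.single {q} 1) b).support := by
    rw [Finset.disjoint_left]
    intro S hS hS'
    have h3 : (S : Set Qubit) ⊆ {q}ᶜ := (Finsupp.mem_supported _ _).1 ha hS
    exact h3 ((Finsupp.mem_supported _ _).1 h1 hS') rfl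
  have h4 : qmemNormSq (tens (Finsupp.single {q} 1) b) = qmemNormSq b := by
    rw [qmemNormSq_tens (A := {q}) (B := {q}ᶜ) disjoint_compl_right
      (single_mem_Supp (by simp)) hb, qmemNormSq_single]
    simp
  rw [← h4]
  exact Finsupp.sum_add_index_of_disjoint h2 _

theorem qmemNormSq_parallelogram (a b : QMem) :
    qmemNormSq (a + b) + qmemNormSq (a - b) = 2 * (qmemNormSq a + qmemNormSq b) := by
  rw [qmemNormSq_eq_sum (s := a.support ∪ b.support) (v := a) Finset.subset_union_left,
    qmemNormSq_eq_sum (s := a.support ∪ b.support) (v := b) Finset.subset_union_right,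
    qmemNormSq_eq_sum (s := a.support ∪ b.support) Finsupp.support_add,
    qmemNormSq_eq_sum (s := a.support ∪ b.support) Finsupp.support_sub, ← Finset.sum_add_distrib,
    ← Finset.sum_add_distrib, Finset.mul_sum]
  refine Finset.sum_congr rfl fun S _ => ?_
  have := parallelogram_law_with_norm ℝ (a S) (b S)
  simp only [Finsupp.add_apply, Finsupp.sub_apply]
  nlinarith

/-- `H` maps `|0⟩a + |1⟩b` to `(|0⟩(a + b) + |1⟩(a - b))/√2`, and the parallelogram law applies. -/
theorem qmemNormSq_gateH (q : Qubit) (v : QMem) : qmemNormSq (gateH q v) = qmemNormSq v := by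
  obtain ⟨a, ha, b, hb, rfl⟩ := exists_split (q := q) v
  have h1 : gateH q (a + tens (Finsupp.single {q} 1) b) =
      ((√2 : ℝ) : ℂ)⁻¹ • ((a + b) + tens (Finsupp.single {q} 1) (a - b)) := by
    have e1 : gateH q a = ((√2 : ℝ) : ℂ)⁻¹ • (a + tens (Finsupp.single {q} 1) a) := by
      conv_lhs => rw [← vac_tens a]
      rw [gateH_tens _ ha, vac, gateH_single]
      simp only [Finset.erase_empty, Finset.notMem_empty, if_false, one_smul, map_smul, map_add,
        LinearMap.add_apply, LinearMap.smul_apply]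
      congr 2
      exact vac_tens a
    have e2 : gateH q (tens (Finsupp.single {q} 1) b) =
        ((√2 : ℝ) : ℂ)⁻¹ • (b - tens (Finsupp.single {q} 1) b) := by
      rw [gateH_tens _ hb, gateH_single]
      simp only [Finset.erase_singleton, Finset.mem_singleton, if_true, Finset.insert_eq_of_mem,
        map_smul, map_add, LinearMap.add_apply, LinearMap.smul_apply, neg_smul, one_smul,
        sub_eq_add_neg]
      rw [map_neg tens, LinearMap.neg_apply]
      congr 2
      exact vac_tens b
    rw [gateH_add, e1, e2, map_sub]
    module
  rw [h1, qmemNormSq_smul, qmemNormSq_split (add_mem ha hb) (sub_mem ha hb),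
    qmemNormSq_parallelogram, qmemNormSq_split ha hb, norm_inv, Complex.norm_real,
    Real.norm_of_nonneg (Real.sqrt_nonneg _), inv_pow, Real.sq_sqrt (by norm_num)]
  ring

theorem qmemNormSq_onBasis {g : Finset Qubit → Finset Qubit} {w : Finset Qubit → ℂ}
    (hg : Function.Injective g) (hw : ∀ S, ‖w S‖ = 1) (v : QMem) :
    qmemNormSq (onBasis (fun S => Finsupp.single (g S) (w S)) v) = qmemNormSq v := by
  have : onBasis (fun S => Finsupp.single (g S) (w S)) v =
      ∑ S ∈ v.support, Finsupp.single (g S) (v S * w S) := by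
    simp only [onBasis, Finsupp.sum, Finsupp.smul_single, smul_eq_mul]
  rw [this, qmemNormSq_sum_single _ _ _ hg.injOn]
  simp only [norm_mul, hw, mul_one]
  rfl

theorem qmemNormSq_gateT (q : Qubit) (v : QMem) : qmemNormSq (gateT q v) = qmemNormSq v := by
  refine qmemNormSq_onBasis (g := id) Function.injective_id (fun S => ?_) v
  split_ifs
  · rw [show (Real.pi / 4 * Complex.I : ℂ) = ((Real.pi / 4 : ℝ) : ℂ) * Complex.I by push_cast; rfl,
      Complex.norm_exp_ofReal_mul_I]
  · simp

theorem qmemNormSq_gateCX (c t : Qubit) (v : QMem) :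
    qmemNormSq (gateCX c t v) = qmemNormSq v := by
  refine qmemNormSq_onBasis (g := fun S => if c ∈ S ∧ c ≠ t then symmDiff S {t} else S)
    (w := fun _ => 1) (Function.LeftInverse.injective
      (g := fun S => if c ∈ S ∧ c ≠ t then symmDiff S {t} else S) fun S => ?_) (by simp) v
  by_cases hct : c = t
  · simp [hct]
  · by_cases hc : c ∈ S <;> simp [hct, hc, Finset.mem_symmDiff]

theorem qmemNormSq_project (q : Qubit) (v : QMem) :
    qmemNormSq (projectQubit q false v) + qmemNormSq (projectQubit q true v) = qmemNormSq v := by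
  have h : ∀ o, projectQubit q o v = ∑ S ∈ v.support,
      Finsupp.single S (if decide (q ∈ S) = o then v S else 0) := by
    intro o
    rw [projectQubit, onBasis, Finsupp.sum]
    refine Finset.sum_congr rfl fun S _ => ?_
    split_ifs <;> simp
  rw [h, h, qmemNormSq_sum_single v.support (fun S => S) _ (Set.injOn_id _),
    qmemNormSq_sum_single v.support (fun S => S) _ (Set.injOn_id _), ← Finset.sum_add_distrib]
  refine Finset.sum_congr rfl fun S _ => ?_
  by_cases hq : q ∈ S <;> simp [hq]

/-- The total squared norm of a family of configurations. -/
def totalNormSq (M : Multiset Config) : ℝ := (M.map fun s => qmemNormSq s.vec).sum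

theorem totalNormSq_bind {M : Multiset Config} {r : Config → Multiset Config}
    (h : ∀ s, totalNormSq (r s) = qmemNormSq s.vec) : totalNormSq (M.bind r) = totalNormSq M := by
  rw [totalNormSq, Multiset.map_bind, Multiset.sum_bind]
  simp only [totalNormSq] at h
  simp only [h, totalNormSq]

theorem totalNormSq_singleton (s : Config) : totalNormSq {s} = qmemNormSq s.vec := by
  simp [totalNormSq]

/-- Gates preserve the norm and a measurement divides it between its two branches. Hence the output
probabilities of an algorithm add up to the squared norm of its input. -/
theorem totalNormSq_run {n k : ℕ} (P : Program) (s : Config) :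
    totalNormSq (P.run (none : Option (Oracle n k)) s) = qmemNormSq s.vec := by
  induction P generalizing s with
  | const | add | sub | load | store | query =>
    rw [Program.run, totalNormSq_singleton]; rfl
  | had => rw [Program.run, totalNormSq_singleton]; exact qmemNormSq_gateH _ _
  | tgate => rw [Program.run, totalNormSq_singleton]; exact qmemNormSq_gateT _ _
  | cx => rw [Program.run, totalNormSq_singleton]; exact qmemNormSq_gateCX _ _ _
  | meas x a i =>
    rw [Program.run, totalNormSq, sum_map_univ (fun s => qmemNormSq s.vec), Fintype.sum_bool,
      add_comm]
    exact qmemNormSq_project _ _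
  | seq P Q hP hQ => rw [Program.run, totalNormSq_bind hQ, hP]
  | ite x P Q hP hQ =>
    rw [Program.run]
    split_ifs
    · exact hQ _
    · exact hP _
  | loop x P hP =>
    rw [Program.run]
    suffices h : ∀ m c, totalNormSq (repeatRun (fun s' => P.run (none : Option (Oracle n k)) s'.tick) m c) =
        qmemNormSq c.vec from h _ _
    intro m
    induction m with
    | zero => exact totalNormSq_singleton
    | succ m ih =>
      intro c
      rw [repeatRun, totalNormSq_bind ih]
      exact hP _

theorem sum_map_ite {α ι : Type*} [Fintype ι] [DecidableEq ι] (M : Multiset α) (g : α → ι)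
    (w : α → ℝ) : ∑ x, (M.map fun s => if g s = x then w s else 0).sum = (M.map w).sum := by
  rw [← Multiset.sum_map_sum]
  simp

theorem sum_outputProb {n k : ℕ} (P : Program) (T : Tableau n) (φ : Ket n) :
    ∑ x : Bits k, P.outputProb none T φ x = ketNormSq φ := by
  simp only [Program.outputProb]
  rw [sum_map_ite (g := fun s : Config => s.getBits 3 k)]
  exact (totalNormSq_run P _).trans (qmemNormSq_ket 0 φ)

theorem outputProb_nonneg {n k : ℕ} (O : Option (Oracle n k)) (P : Program) (T : Tableau n)
    (φ : Ket n) (x : Bits k) : 0 ≤ P.outputProb O T φ x := by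
  refine Multiset.sum_nonneg fun y hy => ?_
  obtain ⟨s, -, rfl⟩ := Multiset.mem_map.1 hy
  split_ifs
  · exact qmemNormSq_nonneg _
  · exact le_rfl

theorem intertwines_smul (c : ℂ) : Intertwines id fun v => c • v :=
  ⟨fun _ _ v => gateH_smul _ c v, fun _ _ v => onBasis_smul _ c v,
    fun _ _ _ _ v => onBasis_smul _ c v, fun _ _ _ v => onBasis_smul _ c v⟩

/-- Multiplication by a scalar commutes with all quantum instructions, so this is `run_rename` for
the identity renaming. -/
theorem outputProb_smul {n k : ℕ} (P : Program) (T : Tableau n) (φ : Ket n) (x : Bits k) (c : ℂ) :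
    P.outputProb none T (c • φ) x = ‖c‖ ^ 2 * P.outputProb none T φ x := by
  -- The background configuration is arbitrary apart from its counters, which must be `0`: the
  -- identity reaches every name, so nothing else of it remains.
  obtain ⟨e, he⟩ : ∃ e, e = embed id
    { var := fun _ => 0, arr := fun _ _ => 0, vec := 0, time := 0, calls := 0 } fun v => c • v :=
    ⟨_, rfl⟩
  have hx : ∀ {α : Type} (g h : ℕ → α), Function.extend id g h = g := fun g h => by
    funext x
    exact Function.injective_id.extend_apply g h x
  have h1 : Config.start k T (c • φ) = e (Config.start k T φ) := by
    simp only [he, embed, hx]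
    have : (Config.start k T (c • φ)).vec = c • (Config.start k T φ).vec := ket_smul 0 c φ
    rw [← this]
    rfl
  rw [Program.outputProb, h1, he]
  conv_lhs => rw [← rename_id P]
  rw [run_rename n k Function.injective_id (intertwines_smul c), Multiset.map_map,
    Program.outputProb, ← Multiset.sum_map_mul_left]
  congr 1
  refine Multiset.map_congr rfl fun s _ => ?_
  simp only [Function.comp_apply, embed, hx, qmemNormSq_smul, mul_ite, mul_zero]
  rfl

end LSN

end

noncomputable section

namespace LSN

/-! ## Two private parts of the memory, one for each call of a solver -/

/-- The name `x` in the private part `d ∈ {0, 1}` of the memory. -/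
def chan (d x : ℕ) : ℕ := 100 + 2 * x + d

theorem chan_injective (d : ℕ) : Function.Injective (chan d) := fun x y h => by
  simp only [chan] at h; omega

/-- Names below `100` belong to the reduction itself; above, parity separates the two private parts.
-/
theorem notMem_range_chan {d x : ℕ} (h : x < 100) : x ∉ Set.range (chan d) := by
  rintro ⟨y, rfl⟩
  simp only [chan] at h; omega

theorem chan_one_notMem (x : ℕ) : chan 1 x ∉ Set.range (chan 0) := by
  rintro ⟨y, h⟩
  simp only [chan] at h; omega

theorem chan_zero_notMem (x : ℕ) : chan 0 x ∉ Set.range (chan 1) := by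
  rintro ⟨y, h⟩
  simp only [chan] at h; omega

/-- The qubits of the private part `d`. -/
abbrev chanQubits (d : ℕ) : Set Qubit := {q | q.1 ∈ Set.range (chan d)}

/-- Move the quantum memory to the private part `d`. -/
def chanMap (d : ℕ) : QMem → QMem := onBasis fun S =>
  Finsupp.single (S.image fun q => (chan d q.1, q.2)) 1

theorem chanQubit_injective (d : ℕ) :
    Function.Injective fun q : Qubit => ((chan d q.1, q.2) : Qubit) := fun q r h => by
  simp only [Prod.mk.injEq] at h
  exact Prod.ext (chan_injective d h.1) h.2

theorem mem_image_chan {d a i : ℕ} {S : Finset Qubit} :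
    ((chan d a, i) : Qubit) ∈ S.image (fun q => (chan d q.1, q.2)) ↔ (a, i) ∈ S :=
  (chanQubit_injective d).mem_finset_image (a := (a, i))

theorem chanMap_single (d : ℕ) (S : Finset Qubit) (z : ℂ) :
    chanMap d (Finsupp.single S z) = Finsupp.single (S.image fun q => (chan d q.1, q.2)) z := by
  rw [chanMap, onBasis_single, Finsupp.smul_single, smul_eq_mul, mul_one]

theorem chanMap_isLinear (d : ℕ) : IsLinearMap ℂ (chanMap d) := onBasis_isLinear _

theorem qmemNormSq_chanMap (d : ℕ) (v : QMem) : qmemNormSq (chanMap d v) = qmemNormSq v :=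
  qmemNormSq_onBasis (w := fun _ => 1) (Finset.image_injective (chanQubit_injective d))
    (fun _ => norm_one) v

theorem chanMap_mem_Supp (d : ℕ) (v : QMem) : chanMap d v ∈ Supp (chanQubits d) := by
  rw [chanMap, onBasis]
  refine Submodule.sum_mem _ fun S _ => ?_
  refine Submodule.smul_mem _ _ (single_mem_Supp ?_)
  intro q hq
  obtain ⟨r, -, rfl⟩ := Finset.mem_image.1 (Finset.mem_coe.1 hq)
  exact ⟨_, rfl⟩

theorem chanMap_ket (d a : ℕ) {m : ℕ} (χ : Ket m) : chanMap d (ket a χ) = ket (chan d a) χ := by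
  have h : ∀ b : Bits m, (writeBits a m b).image (fun q => (chan d q.1, q.2)) =
      writeBits (chan d a) m b := by
    intro b
    rw [writeBits, writeBits, Finset.image_image]
    rfl
  rw [ket, ket, chanMap, onBasis_sum]
  refine Finset.sum_congr rfl fun b _ => ?_
  rw [onBasis_single, h, Finsupp.smul_single, smul_eq_mul, mul_one]

theorem gateH_chanMap (d a i : ℕ) (v : QMem) :
    gateH (chan d a, i) (chanMap d v) = chanMap d (gateH (a, i) v) := by
  refine eq_of_basis (isLinearMap_comp (F := gateH (chan d a, i)) (onBasis_isLinear _)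
    (chanMap_isLinear d)) (isLinearMap_comp (F := chanMap d) (G := gateH (a, i))
    (chanMap_isLinear d) (onBasis_isLinear _)) (fun S => ?_) v
  rw [chanMap_single, gateH_single, gateH_single, (chanMap_isLinear d).map_smul,
    (chanMap_isLinear d).map_add, (chanMap_isLinear d).map_smul, chanMap_single, chanMap_single,
    Finset.image_insert, Finset.image_erase (chanQubit_injective d)]
  simp only [mem_image_chan]

theorem gateT_chanMap (d a i : ℕ) (v : QMem) :
    gateT (chan d a, i) (chanMap d v) = chanMap d (gateT (a, i) v) := by
  refine eq_of_basis (isLinearMap_comp (F := gateT (chan d a, i)) (onBasis_isLinear _)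
    (chanMap_isLinear d)) (isLinearMap_comp (F := chanMap d) (G := gateT (a, i))
    (chanMap_isLinear d) (onBasis_isLinear _)) (fun S => ?_) v
  rw [chanMap_single, gateT, gateT, onBasis_single, onBasis_single, one_smul, one_smul,
    chanMap_single]
  simp only [mem_image_chan]

theorem projectQubit_chanMap (d a i : ℕ) (o : Bool) (v : QMem) :
    projectQubit (chan d a, i) o (chanMap d v) = chanMap d (projectQubit (a, i) o v) := by
  refine eq_of_basis (isLinearMap_comp (F := projectQubit (chan d a, i) o) (onBasis_isLinear _)
    (chanMap_isLinear d)) (isLinearMap_comp (F := chanMap d) (G := projectQubit (a, i) o)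
    (chanMap_isLinear d) (onBasis_isLinear _)) (fun S => ?_) v
  rw [chanMap_single, projectQubit, projectQubit, onBasis_single, onBasis_single, one_smul,
    one_smul]
  simp only [mem_image_chan]
  split_ifs
  · rw [chanMap_single]
  · rw [chanMap, onBasis_zero]

theorem gateCX_chanMap (d a i b j : ℕ) (v : QMem) :
    gateCX (chan d a, i) (chan d b, j) (chanMap d v) = chanMap d (gateCX (a, i) (b, j) v) := by
  refine eq_of_basis (isLinearMap_comp (F := gateCX (chan d a, i) (chan d b, j))
    (onBasis_isLinear _) (chanMap_isLinear d)) (isLinearMap_comp (F := chanMap d)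
    (G := gateCX (a, i) (b, j)) (chanMap_isLinear d) (onBasis_isLinear _)) (fun S => ?_) v
  rw [chanMap_single, gateCX_single, gateCX_single, chanMap_single]
  congr 1
  have h : ((chan d a, i) : Qubit) ≠ (chan d b, j) ↔ ((a, i) : Qubit) ≠ (b, j) :=
    (chanQubit_injective d).ne_iff (x := (a, i)) (y := (b, j))
  simp only [mem_image_chan, h]
  split_ifs
  · rw [Finset.image_symmDiff _ _ (chanQubit_injective d), Finset.image_singleton]
  · rfl

/-- `rest` does not involve the qubits of the private part, so every instruction of the relocated
solver acts on the other factor. -/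
theorem intertwines_chanMap {d : ℕ} {rest : QMem} (h : rest ∈ Supp (chanQubits d)ᶜ) :
    Intertwines (chan d) fun v => tens (chanMap d v) rest where
  had a i v := by
    rw [gateH_tens _ (Supp_mono _ h), gateH_chanMap]
    exact Set.compl_subset_compl.2 (by simp)
  tgate a i v := by
    rw [gateT_tens _ (Supp_mono _ h), gateT_chanMap]
    exact Set.compl_subset_compl.2 (by simp)
  cx a i b j v := by
    rw [gateCX_tens _ (Supp_mono _ h), gateCX_chanMap]
    exact Set.compl_subset_compl.2 (by simp [Set.insert_subset_iff])
  project a i o v := by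
    rw [projectQubit_tens _ (Supp_mono _ h), projectQubit_chanMap]
    exact Set.compl_subset_compl.2 (by simp)

/-- When `P` runs in one of the two private parts of the memory, on a tableau `T` and a state `φ`
that are stored there, it answers `x` with probability `f T φ x`, in at most `t` steps and with
`m` queries. -/
def Answers {n k : ℕ} (O : Option (Oracle n k)) (P : Program)
    (f : Tableau n → Ket n → Bits k → ℝ) (t m : ℕ) : Prop :=
  ∀ d, ∀ T ∈ cliffords n, ∀ (φ : Ket n) (s : Config) (rest : QMem),
    rest ∈ Supp (chanQubits d)ᶜ →
    (∀ x, s.var (chan d x) = (Config.start k T φ).var x) →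
    (∀ a, s.arr (chan d a) = (Config.start k T φ).arr a) →
    s.vec = tens (ket (chan d 0) φ) rest →
    ∃ M : Multiset (Config × QMem), (P.rename (chan d)).run O s = M.map Prod.fst ∧
      (∀ c ∈ M, c.1.vec = tens c.2 rest ∧ c.2 ∈ Supp (chanQubits d) ∧
        (∀ x ∉ Set.range (chan d), c.1.var x = s.var x) ∧
        (∀ a ∉ Set.range (chan d), c.1.arr a = s.arr a) ∧
        c.1.time ≤ s.time + t ∧ c.1.calls = s.calls + m) ∧
      ∀ x : Bits k, (M.map fun c =>
        if c.1.getBits (chan d 3) k = x then qmemNormSq c.2 else 0).sum = f T φ x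

theorem answers_of_program {n k : ℕ} {A : Program} {t : ℕ}
    (ht : A.TimeAtMost (none : Option (Oracle n k)) t) :
    Answers none A (A.outputProb (none : Option (Oracle n k))) t 0 := by
  intro d T hT φ s rest hrest hvar harr hvec
  obtain ⟨F, hF⟩ : ∃ F : QMem → QMem, F = fun v => tens (chanMap d v) rest := ⟨_, rfl⟩
  -- The configuration `s` is the embedding of a starting configuration into `s` itself, as its
  -- private part looks like a start and everything else is inherited; thus `run_rename` applies.
  have hs : embed (chan d) s F (Config.start k T φ) = s := by
    have e : ∀ {α : Type} (g h : ℕ → α), (∀ x, h (chan d x) = g x) →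
        Function.extend (chan d) g h = h := by
      intro α g h hgh
      funext x
      by_cases hx : ∃ y, chan d y = x
      · obtain ⟨y, rfl⟩ := hx
        rw [(chan_injective d).extend_apply, hgh]
      · exact Function.extend_apply' _ _ _ hx
    rw [embed, e _ _ hvar, e _ _ harr, hF, start_vec]
    simp only
    rw [chanMap_ket, ← hvec]
    rfl
  have hrun := run_rename n k (s := s) (chan_injective d) (hF ▸ intertwines_chanMap hrest) A
    (Config.start k T φ)
  rw [hs] at hrun
  refine ⟨(A.run (none : Option (Oracle n k)) (Config.start k T φ)).map fun c => (embed (chan d) s F c, chanMap d c.vec),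
    ?_, ?_, ?_⟩
  · rw [hrun, Multiset.map_map]
    rfl
  · intro c hc
    obtain ⟨c, hc', rfl⟩ := Multiset.mem_map.1 hc
    refine ⟨by simp only [embed, hF], chanMap_mem_Supp d _,
      fun x hx => Function.extend_apply' _ _ _ hx, fun x hx => Function.extend_apply' _ _ _ hx,
      Nat.add_le_add_left (ht T hT φ c hc') _, ?_⟩
    simp only [embed, calls_of_mem_run A hc']
    rfl
  · intro x
    rw [Multiset.map_map, Program.outputProb]
    congr 1
    refine Multiset.map_congr rfl fun c _ => ?_
    have : (embed (chan d) s F c).getBits (chan d 3) k = c.getBits 3 k := by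
      funext i
      simp only [Config.getBits, embed_arr (chan_injective d)]
    simp only [Function.comp_apply, this, qmemNormSq_chanMap]

/-- After the call the consumed register is `|0…0⟩`, so the private factor of a branch is its
amplitude times `vac`; summing the squares over the discarded outcome gives `Oracle.prob`. -/
theorem answers_of_oracle {n k : ℕ} (O : Oracle n k) :
    Answers (some O) (.query 0 1 2 0 3) O.prob 1 1 := by
  intro d T hT φ s rest hrest hvar harr hvec
  have hTs : s.tick.getTableau n (chan d 0) (chan d 1) (chan d 2) = T :=
    getTableau_of_arr (k := k) (φ := φ) (harr 0) (harr 1) (harr 2)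
  have hTs' : s.getTableau n (chan d 0) (chan d 1) (chan d 2) = T := hTs
  obtain ⟨g, hg⟩ : ∃ g : Bits k × Bits n → Config, g = fun o =>
    { (s.tick.setBits (chan d 3) o.1).mapVec (contract (chan d 0) n
        (O.op (s.getTableau n (chan d 0) (chan d 1) (chan d 2)) o.1 o.2)) with
      calls := s.calls + 1 } := ⟨_, rfl⟩
  refine ⟨Finset.univ.val.map fun o => (g o, (O.op T o.1 *ᵥ φ) o.2 • vac), ?_, ?_, ?_⟩
  · rw [Multiset.map_map, hg]
    rfl
  · intro c hc
    obtain ⟨o, -, rfl⟩ := Multiset.mem_map.1 hc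
    refine ⟨?_, Submodule.smul_mem _ _ (vac_mem_Supp _), fun x _ => by rw [hg]; rfl, fun a ha => ?_,
      by rw [hg]; exact le_rfl, by rw [hg]⟩
    · rw [hg]
      change contract (chan d 0) n (O.op (s.getTableau n (chan d 0) (chan d 1) (chan d 2)) o.1 o.2)
        s.vec = _
      rw [hTs', hvec, contract_tens, contract_ket]
      · rfl
      · refine Supp_mono (Set.compl_subset_compl.2 ?_) hrest
        rintro q ⟨hq, -⟩
        exact ⟨0, hq.symm⟩
    · rw [hg]
      have : a ≠ chan d 3 := fun h => ha ⟨3, h.symm⟩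
      change Function.update s.arr (chan d 3) _ a = _
      rw [Function.update_of_ne this]
  · intro x
    rw [Multiset.map_map]
    have hb : ∀ o : Bits k × Bits n, (g o).getBits (chan d 3) k = o.1 := fun o => by
      rw [hg]
      exact getBits_setBits s.tick (chan d 3) o.1
    simp only [Function.comp_def, hb, qmemNormSq_smul, qmemNormSq_vac, mul_one]
    change ∑ o : Bits k × Bits n, _ = _
    rw [Fintype.sum_prod_type, Finset.sum_eq_single x (by
      intro y _ hy
      simp [hy]) (by simp)]
    simp only [if_true]
    rfl

theorem Answers.sum_eq {n k : ℕ} {f : Tableau n → Ket n → Bits k → ℝ} {T : Tableau n} {φ : Ket n}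
    {M : Multiset (Config × QMem)} {g : Config × QMem → Bits k}
    (h : ∀ x : Bits k, (M.map fun c => if g c = x then qmemNormSq c.2 else 0).sum = f T φ x)
    (w : Bits k → ℝ) : (M.map fun c => w (g c) * qmemNormSq c.2).sum = ∑ x, w x * f T φ x := by
  rw [← sum_map_ite M g]
  refine Finset.sum_congr rfl fun x _ => ?_
  rw [← h x, ← Multiset.sum_map_mul_left]
  congr 1
  refine Multiset.map_congr rfl fun c _ => ?_
  split_ifs with hx
  · rw [hx]
  · simp

end LSN

end

/-! ### Copying in classical memory, and the twist as an exchange of blocks of rows. -/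

noncomputable section

namespace LSN

/-! ## Arithmetic and copying -/

section

variable {n k : ℕ} {O : Option (Oracle n k)}

/-- Multiplication by repeated addition; each round costs a tick and an `add`. -/
theorem run_mulLoop {x y z : ℕ} (hyz : z ≠ y) (s : Config) :
    (Program.loop x (.add y y z)).run O s = {{ s with
      var := Function.update s.var y (s.var y + s.var x * s.var z)
      time := s.time + 1 + 2 * s.var x }} := by
  have h : ∀ m (c : Config), repeatRun (fun c' => (Program.add y y z).run O c'.tick) m c =
      {{ c with var := Function.update c.var y (c.var y + m * c.var z), time := c.time + 2 * m }} := by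
    intro m
    induction m with
    | zero => intro c; simp [repeatRun]
    | succ m ih =>
      intro c
      rw [repeatRun, Program.run, Multiset.singleton_bind, ih]
      simp only [Config.tick, Config.setVar, Function.update_self, Function.update_of_ne hyz,
        Function.update_idem]
      congr 2
      · congr 1; ring
      · ring
  rw [Program.run, h]
  rfl

/-- Copy a range of entries of the array `src` to a range of entries of the array `dst`. The
variables `o`, `o'` hold the first addresses, and `x` holds the number of entries. -/
def copyProg (src dst o o' x : ℕ) : Program := block [.add 18 o 2, .add 19 o' 2,
  .loop x (block [.load 12 src 18, .store dst 19 12, .add 18 18 3, .add 19 19 3])]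

theorem copyProg_spec {src dst o o' x : ℕ} (hsd : src ≠ dst) (hx : x ∉ workVars)
    (ho' : o' ∉ workVars) (s : Config)
    (h2 : s.var 2 = 0) (h3 : s.var 3 = 1) :
    ∃ s', (copyProg src dst o o' x).run O s = {s'} ∧
      Frame workVars {dst} (3 + 5 * s.var x) s s' ∧ s'.vec = s.vec ∧
      s'.arr dst = fun m => if s.var o' ≤ m ∧ m < s.var o' + s.var x then
        s.arr src (m - s.var o' + s.var o) else s.arr dst m := by
  have w : ∀ {y}, y ∉ workVars → y ≠ 12 ∧ y ≠ 18 ∧ y ≠ 19 := fun {y} hy => by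
    simp only [Set.mem_Icc] at hy; omega
  obtain ⟨s1, hs1⟩ : ∃ s1, s1 = ((s.tick.setVar 18 (s.var o)).tick.setVar 19 (s.var o')) :=
    ⟨_, rfl⟩
  have hvar : ∀ y ∉ workVars, s1.var y = s.var y := fun y hy => by
    simp [hs1, Config.tick, Config.setVar, w hy]
  obtain ⟨s2, hr, hf, hv, -, -, ha⟩ := run_loop (O := O) (x := x) (s := s1)
    (P := block [.load 12 src 18, .store dst 19 12, .add 18 18 3, .add 19 19 3])
    (fun i c => Frame workVars {dst} (3 + 5 * i) s c ∧ c.vec = s.vec ∧ c.var 18 = s.var o + i ∧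
      c.var 19 = s.var o' + i ∧ c.arr dst = fun m => if s.var o' ≤ m ∧ m < s.var o' + i then
        s.arr src (m - s.var o' + s.var o) else s.arr dst m)
    ⟨⟨hvar, fun _ _ => by rw [hs1]; rfl, by rw [hs1]; exact le_rfl, by rw [hs1]; rfl⟩,
      by rw [hs1]; rfl, by simp [hs1, Config.tick, Config.setVar],
      by simp [hs1, Config.tick, Config.setVar], by
        funext m
        rw [if_neg (by omega), hs1]
        rfl⟩ (by
    rintro i - c ⟨hf, hv, h18, h19, ha⟩
    have hsrc : c.arr src = s.arr src := hf.arr src hsd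
    have h3' : c.var 3 = 1 := by rw [hf.var 3 (by simp), h3]
    have ht := hf.time
    simp only [block, Program.run, Config.tick, Config.setVar, Config.setArr,
      Multiset.singleton_bind, Function.update_apply, h18, h19, h3', hsrc, if_true, if_false,
      Nat.reduceEqDiff]
    refine ⟨_, rfl, ⟨fun y hy => ?_, fun a ha => ?_, ?_, hf.calls⟩, hv, ?_, ?_, ?_⟩
    · have := w hy
      simp only [Function.update_apply, this, if_false]
      exact hf.var y hy
    · have : a ≠ dst := ha
      simp only [Function.update_apply, this, if_false]
      exact hf.arr a ha
    · simp only; omega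
    · simp [add_assoc]
    · simp [add_assoc]
    · funext m
      simp only [if_true, Function.update_apply, ha]
      by_cases hm : m = s.var o' + i
      · rw [if_pos hm, if_pos (by omega), hm]
        congr 1
        omega
      · rw [if_neg hm]
        exact if_congr (by omega) rfl rfl)
  rw [hvar x hx] at hf ha
  refine ⟨s2, ?_, hf, hv, ha⟩
  have e2 : s.tick.var 2 = 0 := h2
  have e2' : (s.tick.setVar 18 (s.var o)).tick.var 2 = 0 := by
    simp [Config.tick, Config.setVar, h2]
  have e3 : (s.tick.setVar 18 (s.var o)).tick.var o' = s.var o' := by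
    simp [Config.tick, Config.setVar, w ho']
  rw [copyProg, block, run_seq (s' := s.tick.setVar 18 (s.var o)) (by
    rw [Program.run, h2, add_zero]), block, run_seq (s' := s1) (by
    rw [Program.run, hs1]
    congr 2
    have : (s.tick.setVar 18 (s.var o)).var 2 = 0 := e2'
    rw [this, add_zero]
    exact e3), block, hr]

/-- Copy an array twice, with two ranges exchanged in the second copy. -/
def copyTwiceProg (src dst dst' x o o' y : ℕ) : Program := block [
  copyProg src dst 2 2 x, copyProg src dst' 2 2 x, copyProg src dst' o o' y,
  copyProg src dst' o' o y]

/-- Past its first `s.var x` entries the source is zero, as the fresh destinations are. Hence the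
first copy equals the source as a function on all of `ℕ`, as required for a private part that must
look like a starting configuration. -/
theorem copyTwiceProg_spec {src dst dst' x o o' y : ℕ} (hsd : src ≠ dst) (hsd' : src ≠ dst')
    (hdd : dst ≠ dst') (hx : x ∉ workVars) (ho : o ∉ workVars) (ho' : o' ∉ workVars)
    (hy : y ∉ workVars) (s : Config) (h2 : s.var 2 = 0) (h3 : s.var 3 = 1)
    (h0 : s.arr dst = fun _ => 0) (h0' : s.arr dst' = fun _ => 0)
    (hsrc : ∀ m, s.var x ≤ m → s.arr src m = 0) :
    ∃ s', (copyTwiceProg src dst dst' x o o' y).run O s = {s'} ∧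
      Frame workVars {dst, dst'} (12 + 10 * s.var x + 10 * s.var y) s s' ∧ s'.vec = s.vec ∧
      s'.arr dst = s.arr src ∧ s'.arr dst' = fun m =>
        if s.var o ≤ m ∧ m < s.var o + s.var y then s.arr src (m - s.var o + s.var o')
        else if s.var o' ≤ m ∧ m < s.var o' + s.var y then s.arr src (m - s.var o' + s.var o)
        else s.arr src m := by
  have w2 : 2 ∉ workVars := by simp
  have w3 : 3 ∉ workVars := by simp
  obtain ⟨s1, r1, f1, v1, a1⟩ := copyProg_spec (O := O) (x := x) hsd hx w2 s h2 h3
  obtain ⟨s2, r2, f2, v2, a2⟩ := copyProg_spec (O := O) (x := x) hsd' hx w2 s1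
    (by rw [f1.var 2 w2, h2]) (by rw [f1.var 3 w3, h3])
  have f12 := f1.trans f2
  rw [Set.union_self] at f12
  obtain ⟨s3, r3, f3, v3, a3⟩ := copyProg_spec (O := O) (x := y) hsd' hy ho' s2
    (by rw [f12.var 2 w2, h2]) (by rw [f12.var 3 w3, h3])
  have f13 := f12.trans f3
  rw [Set.union_self] at f13
  obtain ⟨s4, r4, f4, v4, a4⟩ := copyProg_spec (O := O) (x := y) hsd' hy ho s3
    (by rw [f13.var 2 w2, h2]) (by rw [f13.var 3 w3, h3])
  have f14 := f13.trans f4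
  rw [Set.union_self] at f14
  have hs1 : s1.arr src = s.arr src := f1.arr src hsd
  have hs2 : s2.arr src = s.arr src := f12.arr src (by simp [hsd, hsd'])
  have hs3 : s3.arr src = s.arr src := f13.arr src (by simp [hsd, hsd'])
  have hd1 : s1.arr dst' = fun _ => 0 := by rw [f1.arr dst' (by simpa using hdd.symm), h0']
  refine ⟨s4, ?_, f14.mono (by simp) ?_ ?_, ?_, ?_, ?_⟩
  · rw [copyTwiceProg, block, run_seq r1, block, run_seq r2, block, run_seq r3, block, r4]
  · intro a
    simp only [Set.mem_union, Set.mem_singleton_iff, Set.mem_insert_iff]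
    tauto
  · rw [f1.var x hx, f12.var y hy, f13.var y hy]
    omega
  · rw [v4, v3, v2, v1]
  · rw [f4.arr dst hdd, f3.arr dst hdd, f2.arr dst hdd, a1, h2, h0]
    funext m
    simp only [zero_le, zero_add, true_and, Nat.sub_zero, add_zero]
    split_ifs with h
    · rfl
    · exact (hsrc m (by omega)).symm
  · rw [a4, a3, a2, hs3, hs2, hs1, hd1, f13.var o ho, f13.var o' ho', f13.var y hy, f12.var o ho,
      f12.var o' ho', f12.var y hy, f1.var 2 w2, f1.var x hx, h2]
    funext m
    simp only [zero_le, zero_add, true_and, Nat.sub_zero, add_zero]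
    split_ifs with h h' h''
    · rfl
    · rfl
    · rfl
    · exact (hsrc m (by omega)).symm

end

/-! ## The twisted tableau in memory -/

/-- Exchange the rows of `X_i` and `Z_i` for the last `k` qubits. -/
def twistRow {n : ℕ} (k : ℕ) : Fin n ⊕ Fin n → Fin n ⊕ Fin n
  | Sum.inl i => if n - k ≤ i then Sum.inr i else Sum.inl i
  | Sum.inr i => if n - k ≤ i then Sum.inl i else Sum.inr i

theorem twist_apply {n : ℕ} (k : ℕ) (T : Tableau n) (g : Fin n ⊕ Fin n) :
    twist k T g = T (twistRow k g) := by
  rcases g with i | i <;> simp only [twist, twistRow] <;> split_ifs <;> rfl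

theorem rowOfIndex_of_le {n r : ℕ} (h : 2 * n ≤ r) : rowOfIndex n r = none := by
  rw [rowOfIndex, dif_neg (by omega), dif_neg (by omega)]

/-- In the list of `2n` rows, the twist exchanges the block of `k` rows starting at `n - k` with the
one starting at `n + (n - k)`. -/
theorem rowOfIndex_twist {n k : ℕ} (hk : k ≤ n) (r : ℕ) :
    rowOfIndex n (if n - k ≤ r ∧ r < n - k + k then r - (n - k) + (n + (n - k))
      else if n + (n - k) ≤ r ∧ r < n + (n - k) + k then r - (n + (n - k)) + (n - k) else r) =
      (rowOfIndex n r).map (twistRow k) := by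
  by_cases h1 : n - k ≤ r ∧ r < n - k + k
  · rw [if_pos h1, rowOfIndex, rowOfIndex, dif_neg (by omega), dif_pos (by omega),
      dif_pos (by omega)]
    simp only [Option.map_some, twistRow, if_pos h1.1]
    congr 3
    omega
  · rw [if_neg h1]
    by_cases h2 : n + (n - k) ≤ r ∧ r < n + (n - k) + k
    · rw [if_pos h2, rowOfIndex, rowOfIndex, dif_pos (by omega), dif_neg (by omega),
        dif_pos (by omega)]
      simp only [Option.map_some, twistRow]
      rw [if_pos (by omega)]
      congr 3
      omega
    · rw [if_neg h2, rowOfIndex]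
      split_ifs with h3 h4
      · simp only [Option.map_some, twistRow]
        rw [if_neg (by omega)]
      · simp only [Option.map_some, twistRow]
        rw [if_neg (by omega)]
      · rfl

theorem tableEntry_of_le {n : ℕ} (f : Fin n ⊕ Fin n → Fin n → Bool) {m : ℕ}
    (h : n * n + n * n ≤ m) : tableEntry f m = 0 := by
  rcases Nat.eq_zero_or_pos n with rfl | hn
  · rw [tableEntry, rowOfIndex_of_le (by omega)]
  · rw [tableEntry, rowOfIndex_of_le]
    rw [Nat.le_div_iff_mul_le hn]
    linarith

theorem tableEntry_twist {n k : ℕ} (hk : k ≤ n) (f : Fin n ⊕ Fin n → Fin n → Bool) :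
    (fun m => if (n - k) * n ≤ m ∧ m < (n - k) * n + k * n then
        tableEntry f (m - (n - k) * n + (n * n + (n - k) * n))
      else if n * n + (n - k) * n ≤ m ∧ m < n * n + (n - k) * n + k * n then
        tableEntry f (m - (n * n + (n - k) * n) + (n - k) * n)
      else tableEntry f m) = tableEntry fun g => f (twistRow k g) := by
  funext m
  -- For `n = 0` the quotient `m / n` is the default `0`; the tables are empty anyway.
  rcases Nat.eq_zero_or_pos n with rfl | hn
  · rw [if_neg (by omega), if_neg (by omega), tableEntry, tableEntry, rowOfIndex_of_le (by omega)]
  -- The exchanged ranges are `n * n` entries apart, that is `n` rows: the column `m % n` is kept,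
  -- and the row `m / n` moves as in `rowOfIndex_twist`.
  have key : ∀ m', m' % n = m % n → m' / n = (if n - k ≤ m / n ∧ m / n < n - k + k then
      m / n - (n - k) + (n + (n - k)) else if n + (n - k) ≤ m / n ∧ m / n < n + (n - k) + k then
      m / n - (n + (n - k)) + (n - k) else m / n) →
      tableEntry f m' = tableEntry (fun g => f (twistRow k g)) m := by
    intro m' h1 h2
    rw [tableEntry, tableEntry, h1, h2, rowOfIndex_twist hk]
    cases rowOfIndex n (m / n) <;> rfl
  have c1 : ((n - k) * n ≤ m ∧ m < (n - k) * n + k * n) ↔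
      n - k ≤ m / n ∧ m / n < n - k + k := by
    rw [Nat.le_div_iff_mul_le hn, Nat.div_lt_iff_lt_mul hn, add_mul]
  have c2 : (n * n + (n - k) * n ≤ m ∧ m < n * n + (n - k) * n + k * n) ↔
      n + (n - k) ≤ m / n ∧ m / n < n + (n - k) + k := by
    rw [Nat.le_div_iff_mul_le hn, Nat.div_lt_iff_lt_mul hn, add_mul, add_mul, add_mul]
  by_cases h1 : (n - k) * n ≤ m ∧ m < (n - k) * n + k * n
  · rw [if_pos h1]
    have e : m - (n - k) * n + (n * n + (n - k) * n) = m + n * n := by omega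
    apply key
    · rw [e, Nat.add_mul_mod_self_left]
    · rw [e, Nat.add_mul_div_left _ _ hn, if_pos (c1.1 h1)]
      have := (c1.1 h1).1
      omega
  · rw [if_neg h1]
    by_cases h2 : n * n + (n - k) * n ≤ m ∧ m < n * n + (n - k) * n + k * n
    · rw [if_pos h2]
      have e : m = m - (n * n + (n - k) * n) + (n - k) * n + n * n := by omega
      apply key
      · conv_rhs => rw [e, Nat.add_mul_mod_self_left]
      · rw [if_neg (fun h => h1 (c1.2 h)), if_pos (c2.1 h2)]
        have h3 : m / n = (m - (n * n + (n - k) * n) + (n - k) * n) / n + n := by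
          conv_lhs => rw [e, Nat.add_mul_div_left _ _ hn]
        have := (c2.1 h2).1
        omega
    · rw [if_neg h2]
      exact key m rfl (by rw [if_neg (fun h => h1 (c1.2 h)), if_neg (fun h => h2 (c2.2 h))])

theorem start_arr_sign_of_le {n k : ℕ} (T : Tableau n) (φ : Ket n) {m : ℕ} (h : n + n ≤ m) :
    (Config.start k T φ).arr 2 m = 0 := by
  simp [Config.start, rowOfIndex_of_le (show 2 * n ≤ m by omega)]

theorem start_arr_sign_twist {n k : ℕ} (hk : k ≤ n) (T : Tableau n) (φ : Ket n) :
    (fun m => if n - k ≤ m ∧ m < n - k + k then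
        (Config.start k T φ).arr 2 (m - (n - k) + (n + (n - k)))
      else if n + (n - k) ≤ m ∧ m < n + (n - k) + k then
        (Config.start k T φ).arr 2 (m - (n + (n - k)) + (n - k))
      else (Config.start k T φ).arr 2 m) = (Config.start k (twist k T) φ).arr 2 := by
  funext m
  have e : ∀ S : Tableau n, ∀ r, (Config.start k S φ).arr 2 r =
    match rowOfIndex n r with
      | some g => (S g).2.toNat
      | none => 0 := fun S r => rfl
  rw [← apply_ite, ← apply_ite, e, e, rowOfIndex_twist hk]
  cases rowOfIndex n m with
  | none => rfl
  | some g => simp only [Option.map_some, twist_apply]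

end LSN

end

noncomputable section

namespace LSN

/-! ## Preparation of the classical memory -/

variable {n k : ℕ} {O : Option (Oracle n k)}

/-- Compute the parameters used by the reduction. -/
def paramProg : Program := block [.const 3 1, .sub 4 0 1, .loop 0 (.add 5 5 0), .add 6 5 5,
  .add 7 0 0, .loop 4 (.add 8 8 0), .add 9 5 8, .loop 1 (.add 40 40 0), .add 41 0 4,
  .add (chan 0 0) 0 2, .add (chan 0 1) 1 2, .add (chan 1 0) 0 2, .add (chan 1 1) 1 2]

/-- The values of the variables after `paramProg`. -/
def paramVar (n k x : ℕ) : ℕ :=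
  if x = 0 then n else if x = 1 then k else if x = 3 then 1 else if x = 4 then n - k
  else if x = 5 then n * n else if x = 6 then n * n + n * n else if x = 7 then n + n
  else if x = 8 then (n - k) * n else if x = 9 then n * n + (n - k) * n else if x = 40 then k * n
  else if x = 41 then n + (n - k) else if x = 100 then n else if x = 101 then n
  else if x = 102 then k else if x = 103 then k else 0

/-- A configuration described by the values of its variables and its clock, with the arrays and
the quantum memory of `s₀`. -/
def Config.withVar (s₀ : Config) (f : ℕ → ℕ) (t : ℕ) : Config := { s₀ with var := f, time := t }

theorem run_const_withVar {s₀ : Config} {f : ℕ → ℕ} {t x m : ℕ} :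
    (Program.const x m).run O (s₀.withVar f t) =
      {s₀.withVar (Function.update f x m) (t + 1)} := rfl

theorem run_add_withVar {s₀ : Config} {f : ℕ → ℕ} {t x y z : ℕ} (v : ℕ) (h : f y + f z = v) :
    (Program.add x y z).run O (s₀.withVar f t) =
      {s₀.withVar (Function.update f x v) (t + 1)} := by rw [← h]; rfl

theorem run_sub_withVar {s₀ : Config} {f : ℕ → ℕ} {t x y z : ℕ} (v : ℕ) (h : f y - f z = v) :
    (Program.sub x y z).run O (s₀.withVar f t) =
      {s₀.withVar (Function.update f x v) (t + 1)} := by rw [← h]; rfl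

theorem run_mulLoop_withVar {s₀ : Config} {f : ℕ → ℕ} {t x y z : ℕ} (hyz : z ≠ y) (v w : ℕ)
    (h : f y + f x * f z = v) (hx : f x = w) :
    (Program.loop x (.add y y z)).run O (s₀.withVar f t) =
      {s₀.withVar (Function.update f y v) (t + 1 + 2 * w)} := by
  rw [← h, ← hx, run_mulLoop hyz]; rfl

theorem paramProg_spec (hk : k ≤ n) (T : Tableau n) (φ : Ket n) :
    ∃ s, paramProg.run O (Config.start k T φ) = {s} ∧
      Frame Set.univ ∅ (13 + 6 * n) (Config.start k T φ) s ∧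
      s.vec = ket 0 φ ∧ s.var = paramVar n k := by
  obtain ⟨s₀, hs₀⟩ : ∃ s₀, s₀ = Config.start k T φ := ⟨_, rfl⟩
  have h0 : Config.start k T φ = s₀.withVar
      (fun x => if x = 0 then n else if x = 1 then k else 0) 0 := by rw [hs₀]; rfl
  rw [h0, paramProg]
  rw [block, run_seq run_const_withVar, block, run_seq (run_sub_withVar (n - k) (by simp)), block,
    run_seq (run_mulLoop_withVar (by decide) (n * n) n (by simp) (by simp)), block,
    run_seq (run_add_withVar (n * n + n * n) (by simp)), block,
    run_seq (run_add_withVar (n + n) (by simp)), block,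
    run_seq (run_mulLoop_withVar (by decide) ((n - k) * n) (n - k) (by simp) (by simp)), block,
    run_seq (run_add_withVar (n * n + (n - k) * n) (by simp)), block,
    run_seq (run_mulLoop_withVar (by decide) (k * n) k (by simp) (by simp)), block,
    run_seq (run_add_withVar (n + (n - k)) (by simp)), block,
    run_seq (run_add_withVar n (by simp)), block,
    run_seq (run_add_withVar k (by simp [chan])), block,
    run_seq (run_add_withVar n (by simp [chan])), block,
    run_add_withVar k (by simp [chan])]
  refine ⟨_, rfl, ⟨by simp, fun _ _ => rfl, ?_, rfl⟩, by rw [hs₀]; rfl, ?_⟩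
  · simp only [Config.withVar]
    omega
  · funext x
    simp only [Config.withVar, Function.update_apply, chan, Nat.reduceMul, Nat.reduceAdd]
    by_cases h : x < 104
    · interval_cases x <;> rfl
    · have h' : ∀ y < 104, x ≠ y := fun y hy => by omega
      simp [paramVar, h']

theorem start_arr_zero (T : Tableau n) (φ : Ket n) :
    (Config.start k T φ).arr 0 = tableEntry fun g j => ((T g).1 j).1 := rfl

theorem start_arr_one (T : Tableau n) (φ : Ket n) :
    (Config.start k T φ).arr 1 = tableEntry fun g j => ((T g).1 j).2 := rfl

/-- Copy the tableau to the first private part of the memory, and its twist to the second. -/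
def copyTableauProg : Program := block [
  copyTwiceProg 0 (chan 0 0) (chan 1 0) 6 8 9 40, copyTwiceProg 1 (chan 0 1) (chan 1 1) 6 8 9 40,
  copyTwiceProg 2 (chan 0 2) (chan 1 2) 7 4 41 1]

theorem copyTableauProg_spec (hk : k ≤ n) (T : Tableau n) (φ : Ket n) (s : Config)
    (hvar : s.var = paramVar n k) (harr : s.arr = (Config.start k T φ).arr) :
    ∃ s', copyTableauProg.run O s = {s'} ∧
      Frame workVars {x | 100 ≤ x} (36 + 60 * n + 60 * n * n) s s' ∧ s'.vec = s.vec ∧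
      (∀ a, s'.arr (chan 0 a) = (Config.start k T φ).arr a) ∧
      ∀ a, s'.arr (chan 1 a) = (Config.start k (twist k T) φ).arr a := by
  have z : ∀ a, 3 ≤ a → s.arr a = fun _ => 0 := fun a ha => by
    funext m
    rw [harr]
    simp only [Config.start]
    rw [if_neg (by omega), if_neg (by omega), if_neg (by omega)]
  have w : ∀ x, x < 10 ∨ 39 < x → x ∉ workVars := fun x hx => by
    simp only [Set.mem_Icc]; omega
  have e : ∀ x, paramVar n k x = s.var x := fun x => by rw [hvar]
  obtain ⟨s1, r1, f1, v1, a1, b1⟩ := copyTwiceProg_spec (O := O) (src := 0) (dst := chan 0 0)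
    (dst' := chan 1 0) (x := 6) (o := 8) (o' := 9) (y := 40) (by decide) (by decide) (by decide)
    (w _ (by decide)) (w _ (by decide)) (w _ (by decide)) (w _ (by decide)) s (by rw [hvar]; rfl)
    (by rw [hvar]; rfl) (z _ (by decide)) (z _ (by decide)) (by
      intro m hm
      rw [hvar] at hm
      rw [harr, start_arr_zero, tableEntry_of_le _ hm])
  obtain ⟨s2, r2, f2, v2, a2, b2⟩ := copyTwiceProg_spec (O := O) (src := 1) (dst := chan 0 1)
    (dst' := chan 1 1) (x := 6) (o := 8) (o' := 9) (y := 40) (by decide) (by decide) (by decide)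
    (w _ (by decide)) (w _ (by decide)) (w _ (by decide)) (w _ (by decide)) s1
    (by rw [f1.var _ (w _ (by decide)), hvar]; rfl)
    (by rw [f1.var _ (w _ (by decide)), hvar]; rfl)
    (by rw [f1.arr _ (by decide), z _ (by decide)])
    (by rw [f1.arr _ (by decide), z _ (by decide)]) (by
      intro m hm
      rw [f1.var _ (w _ (by decide)), hvar] at hm
      rw [f1.arr _ (by decide), harr, start_arr_one, tableEntry_of_le _ hm])
  have f12 := f1.trans f2
  obtain ⟨s3, r3, f3, v3, a3, b3⟩ := copyTwiceProg_spec (O := O) (src := 2) (dst := chan 0 2)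
    (dst' := chan 1 2) (x := 7) (o := 4) (o' := 41) (y := 1) (by decide) (by decide) (by decide)
    (w _ (by decide)) (w _ (by decide)) (w _ (by decide)) (w _ (by decide)) s2
    (by rw [f12.var _ (by simp), hvar]; rfl)
    (by rw [f12.var _ (by simp), hvar]; rfl)
    (by rw [f12.arr _ (by decide), z _ (by decide)])
    (by rw [f12.arr _ (by decide), z _ (by decide)]) (by
      intro m hm
      rw [f12.var _ (by simp), hvar] at hm
      rw [f12.arr _ (by decide), harr]
      exact start_arr_sign_of_le _ _ hm)
  have f13 := f12.trans f3
  have c3 : ∀ {x : ℕ}, x ≠ chan 0 0 → x ≠ chan 1 0 → x ≠ chan 0 1 → x ≠ chan 1 1 → x ≠ chan 0 2 →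
      x ≠ chan 1 2 → s3.arr x = s.arr x := fun h1 h2 h3 h4 h5 h6 =>
    f13.arr _ (by simp [h1, h2, h3, h4, h5, h6])
  refine ⟨s3, ?_, f13.mono (by simp) ?_ ?_, by rw [v3, v2, v1], ?_, ?_⟩
  · rw [copyTableauProg, block, run_seq r1, block, run_seq r2, block, r3]
  · intro a
    simp only [Set.mem_union, Set.mem_singleton_iff, Set.mem_insert_iff, Set.mem_ofPred_eq, chan]
    omega
  · have h1 : s.var 6 = n * n + n * n := by rw [hvar]; rfl
    have h2 : s.var 40 = k * n := by rw [hvar]; rfl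
    have h3 : s.var 7 = n + n := by rw [hvar]; rfl
    have h4 : s.var 1 = k := by rw [hvar]; rfl
    rw [f1.var 6 (by simp), f1.var 40 (by simp), f12.var 7 (by simp), f12.var 1 (by simp), h1, h2,
      h3, h4]
    nlinarith [Nat.mul_le_mul_right n hk]
  · intro a
    match a with
    | 0 => rw [f3.arr _ (by decide), f2.arr _ (by decide), a1, harr]
    | 1 => rw [f3.arr _ (by decide), a2, f1.arr _ (by decide), harr]
    | 2 => rw [a3, f12.arr _ (by decide), harr]
    | a + 3 =>
      rw [c3, z _ (by simp only [chan]; omega)]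
      · funext m
        simp [Config.start]
      all_goals simp only [chan]; omega
  · intro a
    match a with
    | 0 =>
      rw [f3.arr _ (by decide), f2.arr _ (by decide), b1, hvar, harr, start_arr_zero,
        start_arr_zero]
      refine (tableEntry_twist hk _).trans ?_
      simp only [twist_apply]
    | 1 =>
      rw [f3.arr _ (by decide), b2, f1.arr _ (by decide), f1.var 8 (by simp), f1.var 9 (by simp),
        f1.var 40 (by simp), hvar, harr, start_arr_one, start_arr_one]
      refine (tableEntry_twist hk _).trans ?_
      simp only [twist_apply]
    | 2 =>
      rw [b3, f12.arr _ (by decide), f12.var 4 (by simp), f12.var 41 (by simp),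
        f12.var 1 (by simp), hvar, harr]
      exact start_arr_sign_twist hk T φ
    | a + 3 =>
      rw [c3, z _ (by simp only [chan]; omega)]
      · funext m
        simp [Config.start]
      all_goals simp only [chan]; omega

/-- The parameters and the input tableau are in their places. -/
structure Ready (k : ℕ) (T : Tableau n) (s : Config) : Prop where
  var : ∀ x ∉ workVars, x < 100 → s.var x = paramVar n k x
  tab : s.getTableau n 0 1 2 = T

/-- The private part `d` of the classical memory is as at the start on input `T`. -/
structure Loaded (k d : ℕ) (T : Tableau n) (s : Config) : Prop where
  var : ∀ (φ : Ket n) x, s.var (chan d x) = (Config.start k T φ).var x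
  arr : ∀ (φ : Ket n) a, s.arr (chan d a) = (Config.start k T φ).arr a

theorem Ready.frame {T : Tableau n} {t : ℕ} {s s' : Config} (h : Ready k T s)
    (hf : Frame workVars ∅ t s s') : Ready k T s' :=
  ⟨fun x hx hx' => by rw [hf.var x hx, h.var x hx hx'],
    by rw [frame_getTableau hf (by simp) (by simp) (by simp), h.tab]⟩

theorem Loaded.frame {d : ℕ} {T : Tableau n} {t : ℕ} {s s' : Config} (h : Loaded k d T s)
    (hf : Frame workVars ∅ t s s') : Loaded k d T s' :=
  ⟨fun φ x => by rw [hf.var _ (by simp only [Set.mem_Icc, chan]; omega), h.var φ x],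
    fun φ a => by rw [hf.arr _ (by simp), h.arr φ a]⟩

theorem Loaded.getTableau {d : ℕ} {T : Tableau n} {s : Config} (h : Loaded k d T s) :
    s.getTableau n (chan d 0) (chan d 1) (chan d 2) = T :=
  getTableau_of_arr (k := k) (φ := fun _ => 0) (h.arr _ 0) (h.arr _ 1) (h.arr _ 2)

/-- Preparation of the classical memory. -/
def setupProg : Program := .seq paramProg copyTableauProg

theorem setupProg_spec (hk : k ≤ n) (T : Tableau n) (φ : Ket n) :
    ∃ s, setupProg.run O (Config.start k T φ) = {s} ∧ s.time ≤ 49 + 66 * n + 60 * n * n ∧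
      s.calls = 0 ∧ s.vec = ket 0 φ ∧ Ready k T s ∧ Loaded k 0 T s ∧ Loaded k 1 (twist k T) s := by
  obtain ⟨s1, r1, f1, v1, e1⟩ := paramProg_spec (O := O) hk T φ
  have a1 : s1.arr = (Config.start k T φ).arr := funext fun a => f1.arr a (by simp)
  obtain ⟨s2, r2, f2, v2, h0, h1⟩ := copyTableauProg_spec (O := O) hk T φ s1 e1 a1
  have hv : ∀ (T' : Tableau n) (φ' : Ket n) d, d < 2 → ∀ x,
      s2.var (chan d x) = (Config.start k T' φ').var x := by
    intro T' φ' d hd x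
    rw [f2.var _ (by simp only [Set.mem_Icc, chan]; omega), e1]
    by_cases hx : x < 2
    · interval_cases d <;> interval_cases x <;> rfl
    · have h' : ∀ y < 104, chan d x ≠ y := fun y hy => by simp only [chan]; omega
      simp only [Config.start]
      rw [if_neg (by omega), if_neg (by omega)]
      simp [paramVar, h']
  refine ⟨s2, by rw [setupProg, run_seq r1, r2], ?_, ?_, by rw [v2, v1], ⟨fun x hx _ => ?_, ?_⟩,
    ⟨fun φ' => hv _ φ' 0 (by decide), fun φ' => h0⟩,
    ⟨fun φ' => hv _ φ' 1 (by decide), fun φ' => h1⟩⟩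
  · have ht1 := f1.time
    have ht2 := f2.time
    have : (Config.start k T φ).time = 0 := rfl
    omega
  · rw [f2.calls, f1.calls]; rfl
  · rw [f2.var x hx, e1]
  · rw [frame_getTableau f2 (by simp) (by simp) (by simp)]
    exact getTableau_of_arr (k := k) (φ := φ) (by rw [a1]) (by rw [a1]) (by rw [a1])

end LSN

end

noncomputable section

namespace LSN

/-! ## Random bits -/

variable {n k : ℕ} {O : Option (Oracle n k)}

/-- The basis vector in which the qubits `(a, r), …, (a, r + m - 1)` have the values `u`. -/
def shiftBits {m : ℕ} (a r : ℕ) (u : Bits m) : Finset Qubit :=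
  (Finset.univ.filter fun j => u j = true).image fun j : Fin m => (a, r + j)

theorem mem_shiftBits {m a r : ℕ} {u : Bits m} {q : Qubit} :
    q ∈ shiftBits a r u ↔ ∃ j : Fin m, u j = true ∧ (a, r + (j : ℕ)) = q := by
  simp [shiftBits]

theorem shiftBits_succ {m : ℕ} (a r : ℕ) (u : Bits (m + 1)) :
    shiftBits a r u = if u (Fin.last m) then insert (a, r + m) (shiftBits a r (Fin.init u : Bits m))
      else shiftBits a r (Fin.init u : Bits m) := by
  ext q
  rw [mem_shiftBits, Fin.exists_fin_succ', apply_ite (q ∈ ·), Finset.mem_insert, mem_shiftBits]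
  cases h : u (Fin.last m)
  · simp [Fin.init]
  · simp only [if_true, true_and, Fin.val_castSucc, Fin.val_last, Fin.init, or_comm,
      eq_comm (a := q)]

/-- A fair coin from a fresh qubit: either outcome has amplitude `1/√2` and stays in the qubit,
where it can later act as a control. -/
theorem measure_fresh {q : Qubit} {v : QMem} {R : Finset Qubit} (hv : v ∈ Supp {q}ᶜ) (hR : q ∉ R)
    (c : ℂ) (b : Bool) :
    projectQubit q b (gateH q (c • tens v (Finsupp.single R 1))) =
      (c * ((√2 : ℝ) : ℂ)⁻¹) • tens v (Finsupp.single (if b then insert q R else R) 1) := by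
  rw [gateH_smul, tens_comm, gateH_tens _ hv, gateH_single, if_neg hR, one_smul,
    Finset.erase_eq_of_notMem hR, projectQubit, onBasis_smul, ← projectQubit,
    projectQubit_tens _ hv, projectQubit, onBasis_smul, onBasis_add, onBasis_single,
    onBasis_single, tens_comm v]
  have e : ∀ S : Finset Qubit, tens (Finsupp.single S (((√2 : ℝ) : ℂ)⁻¹)) v =
      (((√2 : ℝ) : ℂ)⁻¹) • tens (Finsupp.single S 1) v := fun S => by
    rw [← LinearMap.smul_apply, ← map_smul, Finsupp.smul_single, smul_eq_mul, mul_one]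
  cases b <;> simp [hR, e, smul_smul]

/-- Branching over `m` bits and then over one more bit is branching over `m + 1` bits; a multiset
ignores the order. -/
theorem bind_univ_bits {α : Type*} {m : ℕ} (h : Bits m → Bool → α) :
    ((Finset.univ : Finset (Bits m)).val.bind fun u => (Finset.univ : Finset Bool).val.map (h u)) =
      (Finset.univ : Finset (Bits (m + 1))).val.map fun u => h (Fin.init u) (u (Fin.last m)) := by
  rw [← Multiset.map_univ_val_equiv
    ((Equiv.prodComm (Bits m) Bool).trans (Fin.snocEquiv fun _ => Bool)), Multiset.map_map]
  have : ((fun u : Bits (m + 1) => h (Fin.init u) (u (Fin.last m))) ∘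
      ((Equiv.prodComm (Bits m) Bool).trans (Fin.snocEquiv fun _ => Bool))) =
      fun p => h p.1 p.2 := by
    funext p
    simp [Fin.snocEquiv]
  rw [this]
  change _ = ((Finset.univ : Finset (Bits m)).val ×ˢ (Finset.univ : Finset Bool).val).map _
  change _ = ((Finset.univ : Finset (Bits m)).val.bind fun a =>
    (Finset.univ : Finset Bool).val.map (Prod.mk a)).map _
  rw [Multiset.map_bind]
  simp only [Multiset.map_map, Function.comp_def]

/-- Toss a coin for each of the qubits `(5, n - k), …, (5, n - 1)`. -/
def randProg : Program :=
  .seq (.add 30 4 2) (.loop 1 (block [.had 5 30, .meas 12 5 30, .add 30 30 3]))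

theorem randProg_spec {T : Tableau n} (s : Config) (hs : Ready k T s) (hv : s.vec ∈ Supp (qarr 5)ᶜ) :
    ∃ g : Bits k → Config, randProg.run O s = Finset.univ.val.map g ∧ ∀ u,
      Frame workVars ∅ (2 + 4 * k) s (g u) ∧ (g u).vec = (((√2 : ℝ) : ℂ)⁻¹) ^ k •
        tens s.vec (Finsupp.single (shiftBits 5 (n - k) u) 1) := by
  have h4 : s.var 4 = n - k := hs.var 4 (by simp) (by decide)
  have h1 : s.var 1 = k := hs.var 1 (by simp) (by decide)
  have h2 : s.var 2 = 0 := hs.var 2 (by simp) (by decide)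
  have h3 : s.var 3 = 1 := hs.var 3 (by simp) (by decide)
  obtain ⟨s1, hs1⟩ : ∃ s1, s1 = s.tick.setVar 30 (n - k) := ⟨_, rfl⟩
  have r1 : (Program.add 30 4 2).run O s = {s1} := by rw [Program.run, h4, h2, hs1, add_zero]
  have h11 : s1.var 1 = k := by simp [hs1, Config.tick, Config.setVar, h1]
  rw [randProg, run_seq r1, Program.run, h11]
  suffices H : ∀ m, ∃ g : Bits m → Config, repeatRun (fun s' => (block [.had 5 30, .meas 12 5 30,
      .add 30 30 3]).run O s'.tick) m s1.tick = Finset.univ.val.map g ∧ ∀ u,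
      Frame workVars ∅ (2 + 4 * m) s (g u) ∧ (g u).var 30 = n - k + m ∧
      (g u).vec = (((√2 : ℝ) : ℂ)⁻¹) ^ m •
        tens s.vec (Finsupp.single (shiftBits 5 (n - k) u) 1) by
    obtain ⟨g, hg, h⟩ := H k
    exact ⟨g, hg, fun u => ⟨(h u).1, (h u).2.2⟩⟩
  intro m
  induction m with
  | zero =>
    refine ⟨fun _ => s1.tick, rfl, fun u => ⟨⟨fun x hx => ?_, fun _ _ => by rw [hs1]; rfl,
      by rw [hs1]; exact le_rfl, by rw [hs1]; rfl⟩, by simp [hs1, Config.tick, Config.setVar], ?_⟩⟩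
    · have : x ≠ 30 := by rintro rfl; exact hx (by simp)
      simp [hs1, Config.tick, Config.setVar, this]
    · have : shiftBits 5 (n - k) u = ∅ := by simp [shiftBits]
      rw [this, pow_zero, one_smul, ← vac, tens_vac, hs1]
      rfl
  | succ m ih =>
    obtain ⟨g, hg, h⟩ := ih
    obtain ⟨e, he⟩ : ∃ e : Bits m → Bool → Config, e = fun u b =>
      ⟨Function.update (Function.update (g u).var 12 b.toNat) 30 (n - k + m + 1), (g u).arr,
        projectQubit (5, n - k + m) b (gateH (5, n - k + m) (g u).vec), (g u).time + 4,
        (g u).calls⟩ := ⟨_, rfl⟩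
    refine ⟨fun u => e (Fin.init u) (u (Fin.last m)), ?_, fun u => ?_⟩
    · rw [repeatRun_succ, hg, Multiset.bind_map, ← bind_univ_bits e]
      refine Multiset.bind_congr fun u _ => ?_
      have h30 := (h u).2.1
      have h3' : (g u).var 3 = 1 := by rw [(h u).1.var 3 (by simp), h3]
      rw [block, run_seq (s' := ⟨(g u).var, (g u).arr, gateH (5, n - k + m) (g u).vec,
        (g u).time + 2, (g u).calls⟩) (by rw [← h30]; rfl), block, Program.run, Program.run,
        Multiset.bind_map, ← Multiset.bind_singleton]
      refine Multiset.bind_congr fun b _ => ?_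
      simp only [block, Program.run, Config.tick, Config.setVar, Config.mapVec, he, h30, h3',
        Function.update_apply, if_false, Nat.reduceEqDiff]
    · obtain ⟨hf, h30, hvec⟩ := h (Fin.init u)
      have ht := hf.time
      refine ⟨⟨fun x hx => ?_, fun a ha => by rw [he]; exact hf.arr a ha, ?_, ?_⟩, ?_, ?_⟩
      · have h1 : x ≠ 12 := by rintro rfl; exact hx (by simp)
        have h2 : x ≠ 30 := by rintro rfl; exact hx (by simp)
        simp only [he, Function.update_apply, h1, h2, if_false]
        exact hf.var x hx
      · simp only [he]
        omega
      · rw [he]; exact hf.calls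
      · simp [he, add_assoc]
      · simp only [he]
        rw [hvec, measure_fresh, ← pow_succ, ← shiftBits_succ]
        · exact Supp_mono (Set.compl_subset_compl.2 (by simp [qarr])) hv
        · rw [mem_shiftBits]
          rintro ⟨j, -, hj⟩
          have := j.2
          simp only [Prod.mk.injEq, true_and] at hj
          omega

end LSN

end

/-! ### Decoding the sample and encoding fresh query states. -/

noncomputable section

namespace LSN

/-! ## Decoding the sample and preparing the queries -/

variable {n k : ℕ} {O : Option (Oracle n k)}

/-- Go to the first row of a tableau. -/
def rewindProg : Program := block [.const 24 0, .add 25 5 2, .const 26 0, .add 27 0 2, .const 28 0]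

theorem rewindProg_spec {T : Tableau n} (s : Config) (hs : Ready k T s) :
    ∃ s', rewindProg.run O s = {s'} ∧ Frame workVars ∅ 5 s s' ∧ s'.vec = s.vec ∧
      s'.var 24 = 0 ∧ s'.var 25 = n * n ∧ s'.var 26 = 0 ∧ s'.var 27 = n ∧ s'.var 28 = 0 := by
  have h0 : s.var 0 = n := hs.var 0 (by simp) (by decide)
  have h2 : s.var 2 = 0 := hs.var 2 (by simp) (by decide)
  have h5 : s.var 5 = n * n := hs.var 5 (by simp) (by decide)
  simp only [rewindProg, block, Program.run, Config.tick, Config.setVar, Multiset.singleton_bind]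
  refine ⟨_, rfl, ⟨fun x hx => ?_, fun _ _ => rfl, le_rfl, rfl⟩, rfl, ?_⟩
  · have h : x ≠ 24 ∧ x ≠ 25 ∧ x ≠ 26 ∧ x ≠ 27 ∧ x ≠ 28 := by
      simp only [Set.mem_Icc] at hx
      omega
    simp [h]
  · simp [h0, h2, h5]

theorem run_const_spec {x m : ℕ} (hx : x ∈ workVars) (s : Config) :
    ∃ s', (Program.const x m).run O s = {s'} ∧ Frame workVars ∅ 1 s s' ∧ s'.vec = s.vec ∧
      s'.var = Function.update s.var x m := by
  refine ⟨_, rfl, ⟨fun y hy => ?_, fun _ _ => rfl, le_rfl, rfl⟩, rfl, rfl⟩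
  have : y ≠ x := by rintro rfl; exact hy hx
  simp [Config.tick, Config.setVar, this]

/-- Move the syndrome of the sample to the array `5`, and its logical part to the array `1`. -/
def decodeProg : Program := block [rewindProg, .loop 4 (swapProg 5 0 1 2 0), .const 28 0,
  .loop 1 (swapProg 1 0 1 2 0)]

theorem decodeProg_spec (hk : k ≤ n) {T : Tableau n} (s : Config) (hs : Ready k T s) :
    ∃ s', decodeProg.run O s = {s'} ∧ Frame workVars ∅ (8 + 2 * (n * (60 * (n + 1) + 21))) s s' ∧
      s'.vec = swapSeq T 1 0 (n - k) k (swapSeq T 5 0 0 (n - k) s.vec) := by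
  have w : ∀ x, x < 10 → x ∉ workVars := fun x hx => by simp only [Set.mem_Icc]; omega
  obtain ⟨s1, r1, f1, v1, h24, h25, h26, h27, h28⟩ := rewindProg_spec (O := O) s hs
  have hs1 := hs.frame f1
  have e4 : s1.var 4 = n - k := hs1.var 4 (w _ (by decide)) (by decide)
  obtain ⟨s2, r2, f2, v2, g24, g25, g26, g27⟩ := swapLoop_spec (O := O) (x := 4) (c := 5)
    (reg := 0) (by decide) s1 (hs1.var 0 (w _ (by decide)) (by decide))
    (hs1.var 2 (w _ (by decide)) (by decide)) (hs1.var 3 (w _ (by decide)) (by decide)) hs1.tab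
    (r := 0) (by omega) (by rw [h24, zero_mul]) (by rw [h25, add_zero]) h26 (by rw [h27, add_zero])
    h28
  rw [e4] at v2 f2 g24 g25 g26 g27
  rw [zero_add] at g24 g25 g26 g27
  have hs2 := hs1.frame f2
  -- The row counters now stand at `n - k`, where the logical bits begin; only the index of the
  -- target qubit has to return to `0`.
  obtain ⟨s3, r3, f3, v3, u3⟩ := run_const_spec (O := O) (x := 28) (m := 0) (by simp) s2
  have hs3 := hs2.frame f3
  have e1 : s3.var 1 = k := hs3.var 1 (w _ (by decide)) (by decide)
  obtain ⟨s4, r4, f4, v4, -⟩ := swapLoop_spec (O := O) (x := 1) (c := 1)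
    (reg := 0) (by decide) s3 (hs3.var 0 (w _ (by decide)) (by decide))
    (hs3.var 2 (w _ (by decide)) (by decide)) (hs3.var 3 (w _ (by decide)) (by decide)) hs3.tab
    (r := n - k) (by omega) (by rw [u3]; exact g24) (by rw [u3]; exact g25)
    (by rw [u3]; exact g26) (by rw [u3]; exact g27) (by rw [u3]; exact Function.update_self ..)
  rw [e1] at v4 f4
  refine ⟨s4, ?_, (((f1.trans' f2).trans' f3).trans' f4).mono subset_rfl subset_rfl ?_, ?_⟩
  · rw [decodeProg, block, run_seq r1, block, run_seq r2, block, run_seq r3, block, r4]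
  · have h1 := Nat.mul_le_mul_right (60 * (n + 1) + 21) hk
    have h2 := Nat.mul_le_mul_right (60 * (n + 1) + 21) (Nat.sub_le n k)
    omega
  · rw [v4, v3, v2, v1]

/-- Encode the bits in the array `5` with the tableau in the private part `d` of the memory. -/
def encodeProg (d : ℕ) : Program := block [rewindProg,
  .loop 0 (swapProg (10 + d) (chan d 0) (chan d 1) (chan d 2) (chan d 0)), .const 24 0, .const 26 0,
  .loop 0 (flipProg (chan d 0) (chan d 1) (chan d 2) (chan d 0))]

theorem encodeProg_spec {T S : Tableau n} {d : ℕ} (hd : d < 2) (s : Config) (hs : Ready k T s)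
    (hl : Loaded k d S s) :
    ∃ s', (encodeProg d).run O s = {s'} ∧
      Frame workVars ∅ (9 + 2 * (n * (60 * (n + 1) + 21))) s s' ∧
      s'.vec = flipSeq S (chan d 0) n (swapSeq S (10 + d) (chan d 0) 0 n s.vec) := by
  have w : ∀ x, x < 10 → x ∉ workVars := fun x hx => by simp only [Set.mem_Icc]; omega
  obtain ⟨s1, r1, f1, v1, h24, h25, h26, h27, h28⟩ := rewindProg_spec (O := O) s hs
  have hs1 := hs.frame f1
  have e0 : s1.var 0 = n := hs1.var 0 (w _ (by decide)) (by decide)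
  obtain ⟨s2, r2, f2, v2, -⟩ := swapLoop_spec (O := O) (x := 0) (c := 10 + d)
    (reg := chan d 0) (by simp only [chan]; omega) s1 e0
    (hs1.var 2 (w _ (by decide)) (by decide)) (hs1.var 3 (w _ (by decide)) (by decide))
    (hl.frame f1).getTableau
    (r := 0) (by omega) (by rw [h24, zero_mul]) (by rw [h25, add_zero]) h26 (by rw [h27, add_zero])
    h28
  rw [e0] at v2 f2
  -- The flips read only the rows `C X_i C†`, so of the row counters only `24` and `26` are rewound.
  obtain ⟨s3, r3, f3, v3, u3⟩ := run_const_spec (O := O) (x := 24) (m := 0) (by simp) s2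
  obtain ⟨s4, r4, f4, v4, u4⟩ := run_const_spec (O := O) (x := 26) (m := 0) (by simp) s3
  have f14 := ((f1.trans' f2).trans' f3).trans' f4
  have hs4 := hs.frame f14
  obtain ⟨s5, r5, f5, v5⟩ := flipLoop_spec (O := O) (reg := chan d 0)
    (by simp only [chan]; omega) s4 (hs4.var 0 (w _ (by decide)) (by decide))
    (hs4.var 2 (w _ (by decide)) (by decide)) (hs4.var 3 (w _ (by decide)) (by decide))
    (hl.frame f14).getTableau
    (by rw [u4, u3]; simp) (by rw [u4]; simp)
  refine ⟨s5, ?_, (f14.trans' f5).mono subset_rfl subset_rfl ?_, ?_⟩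
  · rw [encodeProg, block, run_seq r1, block, run_seq r2, block, run_seq r3, block, run_seq r4,
      block, r5]
  · omega
  · rw [v5, v4, v3, v2, v1]

/-! ## The effect on the quantum memory -/

/-- The coins sit right behind the syndrome, so the array `5` spells out `t` followed by `u`, the
string to be encoded for both queries. -/
theorem readBits_shiftBits (hk : k ≤ n) (u : Bits k) (t : Bits (n - k)) (S : Finset Qubit)
    (hS : ∀ i, (5, i) ∉ S) :
    readBits 5 n ((shiftBits 5 (n - k) u ∪ writeBits 5 (n - k) t) ∪ S) = glue hk t u := by
  funext j
  rw [Bool.eq_iff_iff]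
  simp only [readBits, decide_eq_true_eq, Finset.mem_union, hS, or_false, mem_shiftBits,
    mem_writeBits_iff, true_and, glue, Prod.mk.injEq]
  by_cases h : (j : ℕ) < n - k
  · rw [dif_pos h]
    constructor
    · rintro (⟨i, -, hi⟩ | ⟨_, h⟩)
      · omega
      · exact h
    · exact fun hj => Or.inr ⟨h, hj⟩
  · rw [dif_neg h]
    constructor
    · rintro (⟨i, hu, hi⟩ | ⟨h', _⟩)
      · rw [← hu]
        congr 1
        ext
        simp only
        omega
      · exact absurd h' h
    · exact fun hj => Or.inl ⟨_, hj, by simp only; omega⟩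

theorem clearRange_glue (hk : k ≤ n) (t : Bits (n - k)) (y : Bits k) :
    clearRange (n - k) k (clearRange 0 (n - k) (glue hk t y)) = fun _ => false := by
  funext j
  simp only [clearRange]
  split_ifs with h1 h2
  · rfl
  · rfl
  · omega

theorem slice_clearRange_glue (hk : k ≤ n) (t : Bits (n - k)) (y : Bits k) :
    slice (n - k) k (clearRange 0 (n - k) (glue hk t y)) = y := by
  refine Eq.trans ?_ (slice_glue_right hk t y)
  funext j
  simp only [slice, clearRange]
  split_ifs with h1 h2
  · omega
  · rfl
  · rfl

/-- The register ends in `V|0…0⟩` and the array `5` in the same state for every `y`. By linearity a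
superposition over `y` therefore moves to the array `1` without staying entangled with anything. -/
theorem decode_vec (hk : k ≤ n) {V : Op n} {T : Tableau n} (hT : HasTableau V T) (u : Bits k)
    (t : Bits (n - k)) (y : Bits k) :
    swapSeq T 1 0 (n - k) k (swapSeq T 5 0 0 (n - k) (tens (ket 0 (V *ᵥ basisKet (glue hk t y)))
      (Finsupp.single (shiftBits 5 (n - k) u) 1))) =
    tens (Finsupp.single (shiftBits 5 (n - k) u ∪ writeBits 5 (n - k) t) 1)
      (tens (ket 0 (V *ᵥ basisKet fun _ => false)) (ket 1 (basisKet y))) := by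
  have h5 : ∀ q ∈ shiftBits 5 (n - k) u, q.1 = 5 ∧ n - k ≤ q.2 := by
    intro q hq
    obtain ⟨j, -, rfl⟩ := mem_shiftBits.1 hq
    exact ⟨rfl, by simp only; omega⟩
  have h5' : ∀ q ∈ writeBits 5 (n - k) t, q.1 = 5 := fun q hq => (writeBits_subset 5 _ t hq).1
  rw [← enc, swapSeq_enc hT (fun q hq hq' => ?_) (by decide) (fun i hi hh => ?_) (by omega),
    slice_glue_left, swapSeq_enc hT (fun q hq hq' => ?_) (by decide) (fun i hi hh => ?_)
    (by omega), slice_clearRange_glue, clearRange_glue, enc, ket_basisKet, tens_left_comm,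
    tens_single, one_mul]
  · rcases Finset.mem_union.1 (Finset.mem_coe.1 hq) with h | h
    · have := (h5 q h).1.symm.trans hq'.1
      omega
    · have := (h5' q h).symm.trans hq'.1
      omega
  · rcases Finset.mem_union.1 hh with h | h
    · have := (h5 _ h).1
      simp at this
    · have := h5' _ h
      simp at this
  · have := (h5 q hq).1.symm.trans hq'.1
    omega
  · have := (h5 _ hh).2
    simp only at this
    omega

/-- `flipSeq_swapSeq`, extended by linearity from a basis vector outside to an arbitrary state `v`
of the remaining memory. -/
theorem encode_vec {V : Op n} {T : Tableau n} (hT : HasTableau V T) {W : Finset Qubit} {w : Bits n}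
    {a c : ℕ} (hca : c ≠ a) (ha : 5 ≠ a) (hc : 5 ≠ c) (hW : (W : Set Qubit) ⊆ qarr 5)
    (hw : ∀ S : Finset Qubit, (∀ i, (5, i) ∉ S) → readBits 5 n (W ∪ S) = w) {v : QMem}
    (hv : v ∈ Supp (qarr 5 ∪ qarr a ∪ qarr c)ᶜ) :
    flipSeq T a n (swapSeq T c a 0 n (tens (Finsupp.single W 1) v)) =
      tens (Finsupp.single W 1) (tens (ket a (V *ᵥ basisKet w))
        (tens (ket c (Vᴴ *ᵥ basisKet fun _ => false)) v)) := by
  have hlin := isLinearMap_comp (F := flipSeq T a n) (flipSeq_isLinear T a n)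
    (swapSeq_isLinear T c a 0 n)
  refine Supp_induction (p := fun v => flipSeq T a n (swapSeq T c a 0 n
    (tens (Finsupp.single W 1) v)) = tens (Finsupp.single W 1) (tens (ket a (V *ᵥ basisKet w))
        (tens (ket c (Vᴴ *ᵥ basisKet fun _ => false)) v))) ?_ ?_ ?_ hv
  · simp only [map_zero]
    exact hlin.map_zero
  · intro v v' h h'
    simp only [map_add]
    rw [hlin.map_add, h, h']
  · intro S z hS
    have hS' : ∀ q ∈ S, q.1 ≠ 5 ∧ q.1 ≠ a ∧ q.1 ≠ c := by
      intro q hq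
      have := hS hq
      simpa [not_or, and_assoc] using this
    have hsz : Finsupp.single S z = z • Finsupp.single S (1 : ℂ) := by
      rw [Finsupp.smul_single, smul_eq_mul, mul_one]
    rw [hsz]
    simp only [map_smul]
    rw [hlin.map_smul, tens_single, one_mul, flipSeq_swapSeq hT _ _ hca ha hc,
      hw S fun i hi => (hS' _ hi).1 rfl]
    · congr 1
      rw [tens_left_comm (Finsupp.single W 1), tens_left_comm (Finsupp.single W 1), tens_single,
        one_mul]
    · intro i hi
      rcases Finset.mem_union.1 hi with h | h
      · exact ha (hW h).symm
      · exact (hS' _ h).2.1 rfl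
    · intro i hi
      rcases Finset.mem_union.1 hi with h | h
      · exact hc (hW h).symm
      · exact (hS' _ h).2.2 rfl

end LSN

end

/-! ### Preparation of both queries, and the Pauli corrections. -/

noncomputable section

namespace LSN

variable {n k : ℕ} {O : Option (Oracle n k)}

/-- From a sample and random bits, prepare the two queries. -/
def prepareProg : Program := block [decodeProg, encodeProg 0, encodeProg 1]

theorem ket_mem_Supp_compl {m a x y z : ℕ} (hx : a ≠ x) (hy : a ≠ y) (hz : a ≠ z) (χ : Ket m) :
    ket a χ ∈ Supp (qarr x ∪ qarr y ∪ qarr z)ᶜ := by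
  refine Supp_mono ?_ (ket_mem_qarr a χ)
  intro q hq hA
  rcases hA with (h | h) | h
  · exact hx (hq.symm.trans h)
  · exact hy (hq.symm.trans h)
  · exact hz (hq.symm.trans h)

theorem tens_reorder (w a b c d e f : QMem) :
    tens w (tens a (tens b (tens c (tens d (tens e f))))) =
      tens c (tens a (tens (tens e (tens d b)) (tens w f))) := by
  simp only [tens_assoc]
  rw [tens_left_comm d b, tens_left_comm e b, tens_left_comm e d, tens_left_comm e w,
    tens_left_comm d w, tens_left_comm b w, tens_left_comm a w, tens_left_comm c w,
    tens_left_comm c a, tens_left_comm c b]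

/-- What is left over besides the queries, the array `5` and `η` is the emptied register and the two
ancilla states `C†|0…0⟩`. They form a tensor factor that depends on the tableaux only, so they do
not disturb the fidelity. -/
theorem prepareProg_spec (hk : k ≤ n) {T S : Tableau n} (hT : T ∈ cliffords n)
    (hS : S ∈ cliffords n) (s : Config) (hs : Ready k T s) (h0 : Loaded k 0 T s)
    (h1 : Loaded k 1 S s) (u : Bits k) (t : Bits (n - k)) (η : Ket k) (c : ℂ)
    (hv : s.vec = c • tens (ket 0 (∑ y, η y • (cliffordOp T *ᵥ basisKet (glue hk t y))))
      (Finsupp.single (shiftBits 5 (n - k) u) 1)) :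
    ∃ s', prepareProg.run O s = {s'} ∧
      Frame workVars ∅ (26 + 6 * (n * (60 * (n + 1) + 21))) s s' ∧
      s'.vec = c • tens (ket (chan 0 0) (cliffordOp T *ᵥ basisKet (glue hk t u)))
        (tens (ket (chan 1 0) (cliffordOp S *ᵥ basisKet (glue hk t u)))
        (tens (tens (ket 0 (cliffordOp T *ᵥ basisKet fun _ => false))
          (tens (ket 10 ((cliffordOp T)ᴴ *ᵥ basisKet fun _ => false))
            (ket 11 ((cliffordOp S)ᴴ *ᵥ basisKet fun _ => false))))
        (tens (Finsupp.single (shiftBits 5 (n - k) u ∪ writeBits 5 (n - k) t) 1) (ket 1 η)))) := by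
  obtain ⟨s1, r1, f1, v1⟩ := decodeProg_spec (O := O) hk s hs
  obtain ⟨s2, r2, f2, v2⟩ := encodeProg_spec (O := O) (d := 0) (by decide) s1 (hs.frame f1)
    (h0.frame f1)
  have f12 := f1.trans' f2
  obtain ⟨s3, r3, f3, v3⟩ := encodeProg_spec (O := O) (d := 1) (by decide) s2 (hs.frame f12)
    (h1.frame f12)
  refine ⟨s3, ?_, (f12.trans' f3).mono subset_rfl subset_rfl (by omega), ?_⟩
  · rw [prepareProg, block, run_seq r1, block, run_seq r2, block, r3]
  obtain ⟨W, hW⟩ : ∃ W, W = shiftBits 5 (n - k) u ∪ writeBits 5 (n - k) t := ⟨_, rfl⟩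
  have hW5 : (W : Set Qubit) ⊆ qarr 5 := by
    intro q hq
    rw [hW] at hq
    rcases Finset.mem_union.1 (Finset.mem_coe.1 hq) with h | h
    · obtain ⟨j, -, rfl⟩ := mem_shiftBits.1 h
      rfl
    · exact (writeBits_subset 5 _ t h).1
  have hw : ∀ S : Finset Qubit, (∀ i, (5, i) ∉ S) → readBits 5 n (W ∪ S) = glue hk t u :=
    fun S hS => by rw [hW]; exact readBits_shiftBits hk u t S hS
  have e1 : s1.vec = c • tens (Finsupp.single W 1)
      (tens (ket 0 (cliffordOp T *ᵥ basisKet fun _ => false)) (ket 1 η)) := by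
    have hlin := isLinearMap_comp (F := swapSeq T 1 0 (n - k) k) (swapSeq_isLinear T 1 0 _ _)
      (swapSeq_isLinear T 5 0 0 (n - k))
    have hη : ket 1 η = ∑ y, η y • ket 1 (basisKet y) := by
      conv_lhs => rw [← sum_smul_basisKet η]
      simp only [ket_sum, ket_smul]
    rw [v1, hv, hlin.map_smul, ket_sum, map_sum, LinearMap.sum_apply, hη]
    simp only [map_sum, ket_smul, map_smul, LinearMap.smul_apply]
    congr 1
    rw [← IsLinearMap.mk'_apply hlin, map_sum]
    refine Finset.sum_congr rfl fun y _ => ?_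
    rw [map_smul, IsLinearMap.mk'_apply, decode_vec hk (cliffordOp_hasTableau hT), hW]
  have e2 : s2.vec = c • tens (Finsupp.single W 1)
      (tens (ket (chan 0 0) (cliffordOp T *ᵥ basisKet (glue hk t u)))
        (tens (ket 10 ((cliffordOp T)ᴴ *ᵥ basisKet fun _ => false))
      (tens (ket 0 (cliffordOp T *ᵥ basisKet fun _ => false)) (ket 1 η)))) := by
    rw [v2, e1, (swapSeq_isLinear _ _ _ _ _).map_smul, (flipSeq_isLinear _ _ _).map_smul,
      encode_vec (cliffordOp_hasTableau hT) (by decide) (by decide) (by decide) hW5 hw]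
    exact tens_mem_Supp (ket_mem_Supp_compl (by decide) (by decide) (by decide) _)
      (ket_mem_Supp_compl (by decide) (by decide) (by decide) _)
  rw [v3, e2, (swapSeq_isLinear _ _ _ _ _).map_smul, (flipSeq_isLinear _ _ _).map_smul,
      encode_vec (cliffordOp_hasTableau hS) (by decide) (by decide) (by decide) hW5 hw, ← hW]
  · rw [tens_reorder]
  · exact tens_mem_Supp (ket_mem_Supp_compl (by decide) (by decide) (by decide) _) (tens_mem_Supp
      (ket_mem_Supp_compl (by decide) (by decide) (by decide) _) (tens_mem_Supp
      (ket_mem_Supp_compl (by decide) (by decide) (by decide) _)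
      (ket_mem_Supp_compl (by decide) (by decide) (by decide) _)))

/-! ## Corrections -/

/-- `X^a`, then `Z^b`. -/
def applyZX {k : ℕ} (a b : Bits k) (η : Ket k) : Ket k := fun y => zsign b y * η (bxor y a)

theorem applyZX_applyXZ {k : ℕ} (a b : Bits k) (ψ : Ket k) : applyZX a b (applyXZ a b ψ) = ψ := by
  funext y
  rw [applyZX, applyXZ, bxor_bxor_cancel, ← mul_assoc, zsign_mul_self, one_mul]

/-- The correction of one qubit. -/
def corrSite (a b : Bool) (c q : Qubit) (v : QMem) : QMem :=
  -- The answers are masked: for correct ones the bits at this qubit are those of `u ⊕ a` and `u ⊕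
  -- b`. The bit of `u` sits in the qubit `c`, so the controlled gates remove the mask.
  gateCZ c q ((if b then gateZ q else id) (gateCX c q ((if a then gateX q else id) v)))

/-- The corrections of the qubits `(1, 0), …, (1, m - 1)`. -/
def corrSeq (a b : ℕ → Bool) (r : ℕ) : ℕ → QMem → QMem
  | 0, v => v
  | m + 1, v => corrSite (a m) (b m) (5, r + m) (1, m) (corrSeq a b r m v)

/-- The program for `corrSite`. -/
def corrSiteProg : Program := block [.load 12 (chan 0 3) 28, .ite 12 (xProg 1 28) nop,
  .cx 5 26 1 28, .load 12 (chan 1 3) 28,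
  .ite 12 (block [.tgate 1 28, .tgate 1 28, .tgate 1 28, .tgate 1 28]) nop,
  .had 1 28, .cx 5 26 1 28, .had 1 28, .add 26 26 3, .add 28 28 3]

/-- The program for `corrSeq`. -/
def corrProg : Program := block [.const 28 0, .add 26 4 2, .loop 1 corrSiteProg]

theorem corrSiteProg_spec (s : Config) (h3 : s.var 3 = 1) :
    ∃ s', corrSiteProg.run O s = {s'} ∧ Frame workVars ∅ 24 s s' ∧
      s'.var 26 = s.var 26 + 1 ∧ s'.var 28 = s.var 28 + 1 ∧
      s'.vec = corrSite (decide (s.arr (chan 0 3) (s.var 28) ≠ 0))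
        (decide (s.arr (chan 1 3) (s.var 28) ≠ 0)) (5, s.var 26) (1, s.var 28) s.vec := by
  have hcz : ∀ v, gateH (1, s.var 28) (gateCX (5, s.var 26) (1, s.var 28)
      (gateH (1, s.var 28) v)) = gateCZ (5, s.var 26) (1, s.var 28) v := fun v =>
    gateH_gateCX_gateH (by simp) v
  by_cases hx : s.arr (chan 0 3) (s.var 28) = 0 <;>
  by_cases hz : s.arr (chan 1 3) (s.var 28) = 0 <;>
  · simp only [corrSiteProg, xProg, block, nop, Program.run, Config.tick, Config.setVar,
      Config.mapVec, Multiset.singleton_bind, Function.update_apply, hx, hz, h3, if_true,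
      if_false, Nat.reduceEqDiff, hcz, gateT_gateT, gateS_gateS, gateH_gateZ_gateH]
    refine ⟨_, rfl, ⟨fun x hx' => ?_, fun _ _ => rfl, by simp, rfl⟩, by simp, by simp, ?_⟩
    · have h : x ≠ 12 ∧ x ≠ 17 ∧ x ≠ 26 ∧ x ≠ 28 := by
        simp only [Set.mem_Icc] at hx'
        omega
      simp [h]
    · simp [corrSite, hx, hz]

theorem corrProg_spec {T : Tableau n} (s : Config) (hs : Ready k T s) :
    ∃ s', corrProg.run O s = {s'} ∧ Frame workVars ∅ (3 + 25 * k) s s' ∧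
      s'.vec = corrSeq (fun i => decide (s.arr (chan 0 3) i ≠ 0))
        (fun i => decide (s.arr (chan 1 3) i ≠ 0)) (n - k) k s.vec := by
  have h1 : s.var 1 = k := hs.var 1 (by simp) (by decide)
  have h2 : s.var 2 = 0 := hs.var 2 (by simp) (by decide)
  have h3 : s.var 3 = 1 := hs.var 3 (by simp) (by decide)
  have h4 : s.var 4 = n - k := hs.var 4 (by simp) (by decide)
  obtain ⟨s1, hs1⟩ : ∃ s1, s1 = (s.tick.setVar 28 0).tick.setVar 26 (n - k) := ⟨_, rfl⟩
  have r1 : ∀ P, (block [.const 28 0, .add 26 4 2, P]).run O s = P.run O s1 := by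
    intro P
    rw [block, run_seq rfl, block, run_seq (s' := s1)]
    · rfl
    · rw [hs1]
      simp [Program.run, Config.tick, Config.setVar, h4, h2]
  have h11 : s1.var 1 = k := by simp [hs1, Config.tick, Config.setVar, h1]
  obtain ⟨s2, r2, f2, -, -, v2⟩ := run_loop (O := O) (P := corrSiteProg) (x := 1) (s := s1)
    (fun i c => Frame workVars ∅ (3 + 25 * i) s c ∧ c.var 26 = n - k + i ∧ c.var 28 = i ∧
      c.vec = corrSeq (fun i => decide (s.arr (chan 0 3) i ≠ 0))
        (fun i => decide (s.arr (chan 1 3) i ≠ 0)) (n - k) i s.vec) (by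
      rw [hs1]
      refine ⟨⟨fun x hx => ?_, fun _ _ => rfl, le_rfl, rfl⟩, rfl, rfl, rfl⟩
      have h : x ≠ 26 ∧ x ≠ 28 := by
        simp only [Set.mem_Icc] at hx
        omega
      simp [Config.tick, Config.setVar, h]) (by
      rintro i - c ⟨hf, h26, h28, hv⟩
      obtain ⟨c', r, f, g26, g28, gv⟩ := corrSiteProg_spec (O := O) c.tick
        ((hf.var 3 (by simp)).trans h3)
      refine ⟨c', r, (hf.trans' (frame_tick f)).mono subset_rfl subset_rfl (by omega), ?_, ?_, ?_⟩
      · rw [g26]; simp [Config.tick, h26, add_assoc]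
      · rw [g28]; simp [Config.tick, h28]
      · rw [gv, corrSeq, ← hv]
        simp only [Config.tick, h26, h28, hf.arr _ (Set.notMem_empty _)])
  rw [h11] at f2 v2
  exact ⟨s2, by rw [corrProg, r1, r2], f2, v2⟩

theorem corrSite_isLinear (a b : Bool) (c q : Qubit) : IsLinearMap ℂ (corrSite a b c q) := by
  constructor
  · intro u v
    cases a <;> cases b <;>
      simp [corrSite, gateCZ, gateZ, gateCX, gateX, onBasis_add]
  · intro z v
    cases a <;> cases b <;>
      simp [corrSite, gateCZ, gateZ, gateCX, gateX, onBasis_smul]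

theorem corrSeq_isLinear (a b : ℕ → Bool) (r m : ℕ) : IsLinearMap ℂ (corrSeq a b r m) := by
  induction m with
  | zero => exact ⟨fun _ _ => rfl, fun _ _ => rfl⟩
  | succ m ih =>
    exact isLinearMap_comp (F := corrSite (a m) (b m) (5, r + m) (1, m)) (corrSite_isLinear _ _ _ _)
      ih

theorem corrSite_tens (a b : Bool) {c q : Qubit} (u : QMem) {v : QMem} (hv : v ∈ Supp {c, q}ᶜ) :
    corrSite a b c q (tens u v) = tens (corrSite a b c q u) v := by
  have hq : v ∈ Supp {q}ᶜ := Supp_mono (Set.compl_subset_compl.2 (by simp)) hv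
  cases a <;> cases b <;>
    simp [corrSite, gateX_tens _ hq, gateZ_tens _ hq, gateCX_tens _ hv, gateCZ_tens _ hv]

theorem corrSeq_tens (a b : ℕ → Bool) (r m : ℕ) (u : QMem) {v : QMem}
    (hv : v ∈ Supp (qarr 1 ∪ qarr 5)ᶜ) :
    corrSeq a b r m (tens u v) = tens (corrSeq a b r m u) v := by
  induction m with
  | zero => rfl
  | succ m ih =>
    rw [corrSeq, ih, corrSite_tens, corrSeq]
    exact Supp_mono (Set.compl_subset_compl.2 (by simp [Set.insert_subset_iff, qarr])) hv

theorem gateX_writeBits_union {m i : ℕ} {y : Bits m} {W : Finset Qubit} (hi : i < m)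
    (hW : (W : Set Qubit) ⊆ {q | q.1 = 1 ∧ q.2 < m}ᶜ) (z : ℂ) :
    gateX (1, i) (Finsupp.single (writeBits 1 m y ∪ W) z) =
      Finsupp.single (writeBits 1 m (Function.update y ⟨i, hi⟩ (!y ⟨i, hi⟩)) ∪ W) z := by
  rw [gateX, onBasis_single, symmDiff_writeBits_union ⟨i, hi⟩ hW, Finsupp.smul_single,
    smul_eq_mul, mul_one]

theorem corrSite_single {m i : ℕ} (a b : Bool) {c : Qubit} {y : Bits m} {W : Finset Qubit}
    (hi : i < m) (hW : (W : Set Qubit) ⊆ {q | q.1 = 1 ∧ q.2 < m}ᶜ) (hc : c.1 ≠ 1) (z : ℂ) :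
    corrSite a b c (1, i) (Finsupp.single (writeBits 1 m y ∪ W) z) =
      Finsupp.single (writeBits 1 m (Function.update y ⟨i, hi⟩
        (xor (y ⟨i, hi⟩) (xor a (decide (c ∈ W))))) ∪ W)
        ((if xor b (decide (c ∈ W)) && xor (y ⟨i, hi⟩) (xor a (decide (c ∈ W))) then -1 else 1) *
          z) := by
  have hmem : ∀ y : Bits m, c ∈ writeBits 1 m y ∪ W ↔ c ∈ W := fun y => by
    rw [Finset.mem_union, or_iff_right]
    exact fun h => hc (writeBits_subset 1 m y h).1
  have hne : c ≠ (1, i) := fun h => hc (by rw [h])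
  have hx : ∀ (a : Bool) (y : Bits m) (z : ℂ),
      (if a then gateX (1, i) else id) (Finsupp.single (writeBits 1 m y ∪ W) z) =
        Finsupp.single (writeBits 1 m (Function.update y ⟨i, hi⟩ (xor (y ⟨i, hi⟩) a)) ∪ W) z := by
    intro a y z
    cases a
    · simp
    · simpa using gateX_writeBits_union hi hW z
  have hcx : ∀ (y : Bits m) (z : ℂ), gateCX c (1, i) (Finsupp.single (writeBits 1 m y ∪ W) z) =
      (if decide (c ∈ W) then gateX (1, i) else id) (Finsupp.single (writeBits 1 m y ∪ W) z) := by
    intro y z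
    rw [gateCX_single]
    simp only [hmem, hne, ne_eq, not_false_iff, and_true, decide_eq_true_eq]
    split_ifs
    · rw [gateX, onBasis_single, Finsupp.smul_single, smul_eq_mul, mul_one]
    · rfl
  have hz : ∀ (y : Bits m) (z : ℂ),
      (if b then gateZ (1, i) else id) (Finsupp.single (writeBits 1 m y ∪ W) z) =
      Finsupp.single (writeBits 1 m y ∪ W) ((if b && y ⟨i, hi⟩ then -1 else 1) * z) := by
    intro y z
    cases b
    · simp
    · rw [if_pos rfl, gateZ, onBasis_single, Finsupp.smul_single, smul_eq_mul, mul_comm]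
      simp only [writeBits_union_subset (⟨i, hi⟩ : Fin m) hW, Bool.true_and]
  have hcz : ∀ (y : Bits m) (z : ℂ), gateCZ c (1, i) (Finsupp.single (writeBits 1 m y ∪ W) z) =
      Finsupp.single (writeBits 1 m y ∪ W)
        ((if decide (c ∈ W) && y ⟨i, hi⟩ then -1 else 1) * z) := by
    intro y z
    rw [gateCZ, onBasis_single, Finsupp.smul_single, smul_eq_mul, mul_comm]
    simp only [hmem, writeBits_union_subset (⟨i, hi⟩ : Fin m) hW, Bool.and_eq_true,
      decide_eq_true_eq]
  rw [corrSite, hx, hcx, hx, hz, hcz, ← mul_assoc]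
  simp only [Function.update_self, Function.update_idem, Bool.xor_assoc]
  congr 2
  cases b <;> cases decide (c ∈ W) <;> cases y ⟨i, hi⟩ <;> cases a <;> simp

theorem zsign_update {m : ℕ} (b y : Bits m) (i : Fin m) (t : Bool) (h : y i = false) :
    zsign b (Function.update y i t) = (if b i && t then -1 else 1) * zsign b y := by
  cases t
  · rw [← h, Function.update_eq_self]
    simp [h]
  · have := zsign_flip b y i
    rw [h] at this
    simpa using this

/-- The prefix of length `j` is already corrected. Its sign is the `zsign` of this prefix padded
with zeros, so each round contributes one factor. -/
theorem corrSeq_single {m r : ℕ} (a b : ℕ → Bool) {y : Bits m} {W : Finset Qubit}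
    (hW : (W : Set Qubit) ⊆ qarr 5) {j : ℕ} (hj : j ≤ m) {a' b' : Bits m}
    (ha : ∀ i : Fin m, xor (a i) (decide ((5, r + (i : ℕ)) ∈ W)) = a' i)
    (hb : ∀ i : Fin m, xor (b i) (decide ((5, r + (i : ℕ)) ∈ W)) = b' i) :
    corrSeq a b r j (Finsupp.single (writeBits 1 m y ∪ W) 1) =
      Finsupp.single (writeBits 1 m (fun i => if (i : ℕ) < j then bxor y a' i else y i) ∪ W)
        (zsign b' fun i => if (i : ℕ) < j then bxor y a' i else false) := by
  have hW' : (W : Set Qubit) ⊆ {q | q.1 = 1 ∧ q.2 < m}ᶜ := fun q hq hq' => by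
    have : q.1 = 5 := hW hq
    have := hq'.1
    omega
  induction j with
  | zero =>
    simp only [Nat.not_lt_zero, if_false, corrSeq]
    rw [zsign_zero]
  | succ j ih =>
    have key : ∀ (v w : Bits m) (x : Bool), bxor y a' ⟨j, hj⟩ = x →
        (fun i : Fin m => if (i : ℕ) < j + 1 then bxor y a' i else w i) =
        Function.update (fun i : Fin m => if (i : ℕ) < j then bxor y a' i else w i) ⟨j, hj⟩ x := by
      intro v w x hx
      funext i
      rw [Function.update_apply]
      by_cases hi : i = ⟨j, hj⟩
      · rw [if_pos hi, hi, if_pos (by simp), hx]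
      · have : (i : ℕ) ≠ j := fun h => hi (Fin.ext h)
        rw [if_neg hi]
        exact if_congr (by omega) rfl rfl
    have e1 : xor (y ⟨j, hj⟩) (xor (a j) (decide ((5, r + j) ∈ W))) = bxor y a' ⟨j, hj⟩ := by
      rw [ha ⟨j, hj⟩]; rfl
    have e2 : xor (b j) (decide ((5, r + j) ∈ W)) = b' ⟨j, hj⟩ := hb ⟨j, hj⟩
    rw [corrSeq, ih (by omega), corrSite_single _ _ hj hW' (by simp)]
    simp only [lt_irrefl, if_false, e1, e2]
    rw [key y y _ rfl, key y (fun _ => false) _ rfl, zsign_update _ _ _ _ (by simp)]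

theorem applyZX_eq (a b : Bits k) (η : Ket k) :
    applyZX a b η = ∑ y, (η y * zsign b (bxor y a)) • basisKet (bxor y a) := by
  rw [← sum_smul_basisKet (applyZX a b η), ← (bxorEquiv a).sum_comp]
  refine Finset.sum_congr rfl fun y _ => ?_
  change applyZX a b η (bxor y a) • basisKet (bxor y a) = _
  rw [applyZX, bxor_bxor_cancel, mul_comm]

theorem corrSeq_ket {r : ℕ} (a b : ℕ → Bool) {W : Finset Qubit} (hW : (W : Set Qubit) ⊆ qarr 5)
    {a' b' : Bits k} (ha : ∀ i : Fin k, xor (a i) (decide ((5, r + (i : ℕ)) ∈ W)) = a' i)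
    (hb : ∀ i : Fin k, xor (b i) (decide ((5, r + (i : ℕ)) ∈ W)) = b' i) (η : Ket k) :
    corrSeq a b r k (tens (Finsupp.single W 1) (ket 1 η)) =
      tens (Finsupp.single W 1) (ket 1 (applyZX a' b' η)) := by
  conv_lhs => rw [← sum_smul_basisKet η]
  rw [applyZX_eq, ket_sum, ket_sum, map_sum, map_sum,
    ← IsLinearMap.mk'_apply (corrSeq_isLinear a b r k), map_sum]
  refine Finset.sum_congr rfl fun y _ => ?_
  rw [ket_smul, map_smul, map_smul, IsLinearMap.mk'_apply, ket_basisKet, tens_single,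
    Finset.union_comm, one_mul, corrSeq_single a b hW le_rfl ha hb, ket_smul, map_smul,
    ket_basisKet, tens_single, Finset.union_comm, one_mul]
  simp only [Fin.is_lt, if_true, mul_smul]
  rw [Finsupp.smul_single, Finsupp.smul_single, Finsupp.smul_single]
  simp

end LSN

end

/-! ### Independence of the control flow from the amplitudes, and the fidelity of one branch. -/

noncomputable section

namespace LSN

variable {n k : ℕ} {O : Option (Oracle n k)}

/-! ## The classical part of a run -/

/-- Forget the quantum memory. -/
def Config.forget (s : Config) : Config := { s with vec := 0 }

theorem forget_mapVec {s : Config} {F : QMem → QMem} (h : F 0 = 0) :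
    (s.mapVec F).forget = s.forget.mapVec F := by
  simp only [Config.forget, Config.mapVec, h]

/-- Control flow never inspects amplitudes, and branches of amplitude zero are kept. Running times
and numbers of calls can thus be computed on any convenient input state. -/
theorem run_forget (P : Program) (s : Config) :
    P.run O s.forget = (P.run O s).map Config.forget := by
  induction P generalizing s with
  | const | add | sub | load | store => rfl
  | had a i =>
    rw [Program.run, Program.run, Multiset.map_singleton,
      forget_mapVec (F := gateH (a, s.var i)) (onBasis_zero _)]
    rfl
  | tgate a i =>
    rw [Program.run, Program.run, Multiset.map_singleton,
      forget_mapVec (F := gateT (a, s.var i)) (onBasis_zero _)]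
    rfl
  | cx a i b j =>
    rw [Program.run, Program.run, Multiset.map_singleton,
      forget_mapVec (F := gateCX (a, s.var i) (b, s.var j)) (onBasis_zero _)]
    rfl
  | meas x a i =>
    rw [Program.run, Program.run, Multiset.map_map]
    refine Multiset.map_congr rfl fun b _ => ?_
    rw [Function.comp_apply, forget_mapVec (F := projectQubit (a, s.var i) b) (onBasis_zero _)]
    rfl
  | query ax az asgn a out =>
    cases O with
    | none => rfl
    | some O =>
      simp only [Program.run]
      rw [Multiset.map_map]
      refine Multiset.map_congr rfl fun o _ => ?_
      have hc : ∀ w, contract a n w 0 = 0 := fun w => onBasis_zero _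
      simp only [Function.comp_apply, Config.forget, Config.mapVec, Config.tick, Config.setBits, hc]
  | seq P Q hP hQ =>
    simp only [Program.run, hP, Multiset.bind_map, Multiset.map_bind, hQ]
  | ite x P Q hP hQ =>
    rw [Program.run, Program.run]
    change (if s.var x = 0 then Q.run O s.tick.forget else P.run O s.tick.forget) = _
    rw [hP, hQ]
    split_ifs <;> rfl
  | loop x P hP =>
    rw [Program.run, Program.run]
    exact repeatRun_map (f := fun s => P.run O s.tick) (g := fun s => P.run O s.tick)
      (e := Config.forget) (fun c => hP c.tick) (s.var x) s.tick

theorem exists_mem_run {P : Program} {s s' c : Config} (hs : s.forget = s'.forget)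
    (hc : c ∈ P.run O s) : ∃ c' ∈ P.run O s', c'.forget = c.forget := by
  have := Multiset.mem_map_of_mem Config.forget hc
  rw [← run_forget, hs, run_forget, Multiset.mem_map] at this
  exact this

/-! ## The reduction with two queries -/

theorem mem_Supp_chan_compl {m a d : ℕ} (h : a ∉ Set.range (chan d)) (χ : Ket m) :
    ket a χ ∈ Supp (chanQubits d)ᶜ := by
  refine Supp_mono ?_ (ket_mem_qarr a χ)
  rintro q hq hA
  have : q.1 = a := hq
  exact h (this ▸ hA)

/-- The fidelity with `ψ` after the corrections `Z^b X^a` have been applied to `η`. -/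
def corrFidelity (a b : Bits k) (η ψ : Ket k) : ℝ := ‖∑ y, star (ψ y) * applyZX a b η y‖ ^ 2

theorem contract_smul (a m : ℕ) (w : Bits m → ℂ) (c : ℂ) (v : QMem) :
    contract a m w (c • v) = c • contract a m w v := onBasis_smul _ c v

/-- The memory is a product over disjoint arrays. Corrections involve the arrays `1` and `5`, the
overlap with `ψ` only the array `1`, and every other factor contributes its norm. -/
theorem qmemNormSq_corrected {r : ℕ} {a b : ℕ → Bool} {W : Finset Qubit} {a' b' : Bits k}
    {J M N : QMem} (hW : (W : Set Qubit) ⊆ qarr 5)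
    (ha : ∀ i : Fin k, xor (a i) (decide ((5, r + (i : ℕ)) ∈ W)) = a' i)
    (hb : ∀ i : Fin k, xor (b i) (decide ((5, r + (i : ℕ)) ∈ W)) = b' i)
    (hJ : J ∈ Supp {q | q.1 = 0 ∨ q.1 = 10 ∨ q.1 = 11}) (hJ1 : qmemNormSq J = 1)
    (hM : M ∈ Supp (chanQubits 0)) (hN : N ∈ Supp (chanQubits 1)) (c : ℂ) (η ψ : Ket k) :
    qmemNormSq (contract 1 k (fun y => star (ψ y)) (corrSeq a b r k
      (tens N (c • tens M (tens J (tens (Finsupp.single W 1) (ket 1 η))))))) =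
      ‖c‖ ^ 2 * corrFidelity a' b' η ψ * qmemNormSq M * qmemNormSq N := by
  have l1 : ∀ {x : ℕ} {d : ℕ}, x ∈ Set.range (chan d) → 100 ≤ x := by
    rintro _ d ⟨y, rfl⟩
    simp only [chan]
    omega
  have e : tens N (c • tens M (tens J (tens (Finsupp.single W 1) (ket 1 η)))) =
      c • tens (tens (Finsupp.single W 1) (ket 1 η)) (tens N (tens M J)) := by
    rw [map_smul, tens_comm _ (tens N (tens M J)), tens_assoc, tens_assoc]
  have hR : tens N (tens M J) ∈ Supp (qarr 1 ∪ qarr 5)ᶜ := by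
    refine tens_mem_Supp (Supp_mono ?_ hN) (tens_mem_Supp (Supp_mono ?_ hM) (Supp_mono ?_ hJ))
    · rintro q hq (h | h) <;>
      · have := l1 hq
        have : q.1 = _ := h
        omega
    · rintro q hq (h | h) <;>
      · have := l1 hq
        have : q.1 = _ := h
        omega
    · rintro q hq (h | h) <;>
      · have : q.1 = _ := h
        simp only [Set.mem_ofPred_eq] at hq
        omega
  have hWR : tens (Finsupp.single W 1) (tens N (tens M J)) ∈ Supp (qarr 1)ᶜ := by
    refine tens_mem_Supp (single_mem_Supp fun q hq h => ?_)
      (Supp_mono (Set.compl_subset_compl.2 Set.subset_union_left) hR)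
    have h1 : q.1 = 5 := hW hq
    have h2 : q.1 = 1 := h
    omega
  rw [e, (corrSeq_isLinear a b r k).map_smul, corrSeq_tens _ _ _ _ _ hR,
    corrSeq_ket a b hW ha hb, tens_comm (Finsupp.single W 1), tens_assoc, contract_smul,
    contract_tens, contract_ket, map_smul, LinearMap.smul_apply, vac_tens,
    qmemNormSq_smul, qmemNormSq_smul, qmemNormSq_tens (A := qarr 5) (B := (qarr 5)ᶜ)
    disjoint_compl_right (single_mem_Supp hW)
    (Supp_mono (Set.compl_subset_compl.2 Set.subset_union_right) hR), qmemNormSq_single,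
    qmemNormSq_tens (A := chanQubits 1) (B := (chanQubits 1)ᶜ) disjoint_compl_right hN
    (tens_mem_Supp (Supp_mono ?_ hM) (Supp_mono ?_ hJ)),
    qmemNormSq_tens (A := chanQubits 0) (B := (chanQubits 0)ᶜ) disjoint_compl_right hM
    (Supp_mono ?_ hJ), hJ1, corrFidelity]
  · simp only [norm_one, one_pow, one_mul, mul_one]
    ring
  · rintro q hq hq'
    have := l1 hq'
    simp only [Set.mem_ofPred_eq] at hq
    omega
  · rintro q ⟨y, hy⟩ hq'
    have hq2 : q.1 ∈ Set.range (chan 1) := hq'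
    rw [← hy] at hq2
    exact chan_zero_notMem y hq2
  · rintro q hq hq'
    have := l1 hq'
    simp only [Set.mem_ofPred_eq] at hq
    omega
  · exact Supp_mono (Set.compl_subset_compl.2 fun q hq => hq.1) hWR

end LSN

end

/-! ### Two calls, the corrections, and the complete reduction. -/

noncomputable section

namespace LSN

variable {n k : ℕ} {O : Option (Oracle n k)}

/-- The first answers are in the private parts of the memory, the state `ket 1 η` waits for the
corrections. -/
theorem second_query_spec {P : Program} {f : Tableau n → Ket n → Bits k → ℝ} {τ κ : ℕ}
    (hP : Answers O P f τ κ) {T S : Tableau n} (hS : S ∈ cliffords n) {s : Config}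
    (hs : Ready k T s) (h1 : Loaded k 1 S s) {φ : Ket n} {W : Finset Qubit} {J M : QMem}
    {u : Bits k} (hW : (W : Set Qubit) ⊆ qarr 5)
    (hu : ∀ i : Fin k, decide ((5, n - k + (i : ℕ)) ∈ W) = u i)
    (hJ : J ∈ Supp {q | q.1 = 0 ∨ q.1 = 10 ∨ q.1 = 11}) (hJ1 : qmemNormSq J = 1)
    (hM : M ∈ Supp (chanQubits 0)) {c : ℂ} {η : Ket k}
    (hv : s.vec = tens (ket (chan 1 0) φ)
      (c • tens M (tens J (tens (Finsupp.single W 1) (ket 1 η))))) (ψ : Ket k) :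
    (∀ s' ∈ (Program.seq (P.rename (chan 1)) corrProg).run O s,
      s'.time ≤ s.time + τ + (3 + 25 * k) ∧ s'.calls = s.calls + κ) ∧
    (((Program.seq (P.rename (chan 1)) corrProg).run O s).map fun s' =>
      qmemNormSq (contract 1 k (fun y => star (ψ y)) s'.vec)).sum =
      ‖c‖ ^ 2 * (∑ x, corrFidelity (bxor (s.getBits (chan 0 3) k) u) (bxor x u) η ψ * f S φ x) *
        qmemNormSq M := by
  have hrest : c • tens M (tens J (tens (Finsupp.single W 1) (ket 1 η))) ∈
      Supp (chanQubits 1)ᶜ := by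
    refine Submodule.smul_mem _ _ (tens_mem_Supp (Supp_mono ?_ hM) (tens_mem_Supp
      (Supp_mono ?_ hJ) (tens_mem_Supp (single_mem_Supp ?_)
      (mem_Supp_chan_compl (notMem_range_chan (by decide)) _))))
    · rintro q ⟨y, hy⟩ hq'
      have hq2 : q.1 ∈ Set.range (chan 1) := hq'
      rw [← hy] at hq2
      exact chan_zero_notMem y hq2
    · intro q hq
      simp only [Set.mem_ofPred_eq] at hq
      exact notMem_range_chan (by omega)
    · intro q hq
      have : q.1 = 5 := hW hq
      exact notMem_range_chan (by omega)
  obtain ⟨N, rN, hN, sN⟩ := hP 1 S hS φ s _ hrest (h1.var φ) (h1.arr φ) hv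
  have hrun : ∀ m ∈ N, ∃ s', corrProg.run O m.1 = {s'} ∧
      s'.time ≤ s.time + τ + (3 + 25 * k) ∧ s'.calls = s.calls + κ ∧
      qmemNormSq (contract 1 k (fun y => star (ψ y)) s'.vec) =
        ‖c‖ ^ 2 * corrFidelity (bxor (s.getBits (chan 0 3) k) u)
          (bxor (m.1.getBits (chan 1 3) k) u) η ψ * qmemNormSq M * qmemNormSq m.2 := by
    intro m hm
    obtain ⟨hvec, hsup, hvar, harr, ht, hc⟩ := hN m hm
    have hr : Ready k T m.1 := by
      refine ⟨fun x hx hx' => by rw [hvar x (notMem_range_chan hx'), hs.var x hx hx'], ?_⟩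
      rw [← hs.tab]
      funext g
      simp only [Config.getTableau, harr 0 (notMem_range_chan (by decide)),
        harr 1 (notMem_range_chan (by decide)), harr 2 (notMem_range_chan (by decide))]
    obtain ⟨s', r', f', v'⟩ := corrProg_spec (O := O) m.1 hr
    refine ⟨s', r', ?_, by rw [f'.calls, hc], ?_⟩
    · have := f'.time
      omega
    · rw [v', hvec]
      refine qmemNormSq_corrected hW (fun i => ?_) (fun i => ?_) hJ hJ1 hM hsup c η ψ
      · rw [hu, harr _ (chan_zero_notMem 3)]
        rfl
      · rw [hu]
        rfl
  rw [Program.run, rN, Multiset.bind_map]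
  constructor
  · intro s' hs'
    obtain ⟨m, hm, hs'⟩ := Multiset.mem_bind.1 hs'
    obtain ⟨s'', r, ht, hc, -⟩ := hrun m hm
    rw [r, Multiset.mem_singleton] at hs'
    rw [hs']
    exact ⟨ht, hc⟩
  · rw [Multiset.map_bind, Multiset.sum_bind]
    have : N.map (fun m => ((corrProg.run O m.1).map fun s' =>
        qmemNormSq (contract 1 k (fun y => star (ψ y)) s'.vec)).sum) =
        N.map fun m => ‖c‖ ^ 2 * qmemNormSq M * (corrFidelity (bxor (s.getBits (chan 0 3) k) u)
          (bxor (m.1.getBits (chan 1 3) k) u) η ψ * qmemNormSq m.2) := by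
      refine Multiset.map_congr rfl fun m hm => ?_
      obtain ⟨s', r, -, -, h⟩ := hrun m hm
      rw [r, Multiset.map_singleton, Multiset.sum_singleton, h]
      ring
    rw [this, Multiset.sum_map_mul_left, Answers.sum_eq (g := fun m => m.1.getBits (chan 1 3) k) sN
      (fun x => corrFidelity (bxor (s.getBits (chan 0 3) k) u) (bxor x u) η ψ)]
    ring

/-- Ask both queries, and apply the corrections. -/
def queryProg (P : Program) : Program :=
  .seq (P.rename (chan 0)) (.seq (P.rename (chan 1)) corrProg)

/-- During the first call the input of the second is part of `rest`, and conversely the residue of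
the first is part of `rest` during the second. So for fixed inputs the probabilities of the two
answers multiply. -/
theorem queryProg_spec {P : Program} {f : Tableau n → Ket n → Bits k → ℝ} {τ κ : ℕ}
    (hP : Answers O P f τ κ) {T S : Tableau n} (hT : T ∈ cliffords n) (hS : S ∈ cliffords n)
    {s : Config} (hs : Ready k T s) (h0 : Loaded k 0 T s) (h1 : Loaded k 1 S s) {φ φ' : Ket n}
    {W : Finset Qubit} {J : QMem} {u : Bits k} (hW : (W : Set Qubit) ⊆ qarr 5)
    (hu : ∀ i : Fin k, decide ((5, n - k + (i : ℕ)) ∈ W) = u i)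
    (hJ : J ∈ Supp {q | q.1 = 0 ∨ q.1 = 10 ∨ q.1 = 11}) (hJ1 : qmemNormSq J = 1)
    {c : ℂ} {η : Ket k}
    (hv : s.vec = c • tens (ket (chan 0 0) φ) (tens (ket (chan 1 0) φ')
      (tens J (tens (Finsupp.single W 1) (ket 1 η))))) (ψ : Ket k) :
    (∀ s' ∈ (queryProg P).run O s,
      s'.time ≤ s.time + 2 * τ + (3 + 25 * k) ∧ s'.calls = s.calls + 2 * κ) ∧
    (((queryProg P).run O s).map fun s' =>
      qmemNormSq (contract 1 k (fun y => star (ψ y)) s'.vec)).sum =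
      ‖c‖ ^ 2 * ∑ x, (∑ x', corrFidelity (bxor x u) (bxor x' u) η ψ * f S φ' x') * f T φ x := by
  have hrest : c • tens (ket (chan 1 0) φ') (tens J (tens (Finsupp.single W 1) (ket 1 η))) ∈
      Supp (chanQubits 0)ᶜ := by
    refine Submodule.smul_mem _ _ (tens_mem_Supp (mem_Supp_chan_compl (chan_one_notMem 0) _)
      (tens_mem_Supp (Supp_mono ?_ hJ) (tens_mem_Supp (single_mem_Supp ?_)
      (mem_Supp_chan_compl (notMem_range_chan (by decide)) _))))
    · intro q hq
      simp only [Set.mem_ofPred_eq] at hq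
      exact notMem_range_chan (by omega)
    · intro q hq
      have : q.1 = 5 := hW hq
      exact notMem_range_chan (by omega)
  obtain ⟨M, rM, hM, sM⟩ := hP 0 T hT φ s _ hrest (h0.var φ) (h0.arr φ)
    (by rw [hv, map_smul])
  have hrun : ∀ m ∈ M,
      (∀ s' ∈ (Program.seq (P.rename (chan 1)) corrProg).run O m.1,
        s'.time ≤ m.1.time + τ + (3 + 25 * k) ∧ s'.calls = m.1.calls + κ) ∧
      (((Program.seq (P.rename (chan 1)) corrProg).run O m.1).map fun s' =>
        qmemNormSq (contract 1 k (fun y => star (ψ y)) s'.vec)).sum =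
        ‖c‖ ^ 2 * (∑ x, corrFidelity (bxor (m.1.getBits (chan 0 3) k) u) (bxor x u) η ψ *
          f S φ' x) * qmemNormSq m.2 := by
    intro m hm
    obtain ⟨hvec, hsup, hvar, harr, -, -⟩ := hM m hm
    refine second_query_spec hP hS (T := T) ?_ ?_ hW hu hJ hJ1 hsup (φ := φ') ?_ ψ
    · refine ⟨fun x hx hx' => by rw [hvar x (notMem_range_chan hx'), hs.var x hx hx'], ?_⟩
      rw [← hs.tab]
      funext g
      simp only [Config.getTableau, harr 0 (notMem_range_chan (by decide)),
        harr 1 (notMem_range_chan (by decide)), harr 2 (notMem_range_chan (by decide))]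
    · exact ⟨fun φ x => by rw [hvar _ (chan_one_notMem x), h1.var φ],
        fun φ x => by rw [harr _ (chan_one_notMem x), h1.arr φ]⟩
    · rw [hvec, map_smul, map_smul, tens_left_comm]
  rw [queryProg, Program.run, rM, Multiset.bind_map]
  constructor
  · intro s' hs'
    obtain ⟨m, hm, hs'⟩ := Multiset.mem_bind.1 hs'
    obtain ⟨-, -, -, -, ht, hc⟩ := hM m hm
    obtain ⟨ht', hc'⟩ := (hrun m hm).1 s' hs'
    omega
  · rw [Multiset.map_bind, Multiset.sum_bind, Multiset.map_congr rfl fun m hm => (hrun m hm).2]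
    rw [← Answers.sum_eq (g := fun m => m.1.getBits (chan 0 3) k) sM
      (fun x => ∑ x', corrFidelity (bxor x u) (bxor x' u) η ψ * f S φ' x'),
      ← Multiset.sum_map_mul_left]
    simp only [mul_assoc]

/-- The reduction from Search sLSN to Search LSN, with two runs of the solver `P`. -/
def reduction (P : Program) : Program :=
  .seq setupProg (.seq randProg (.seq prepareProg (queryProg P)))

/-- The time of the reduction without its queries. -/
def reductionTime (n : ℕ) : ℕ := 80 + 95 * n + 60 * n * n + 6 * (n * (60 * (n + 1) + 21))

/-- The factor `2^{-k}` is the probability of a coin string `u`. No normalization of `η` is assumed: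
the case `η = 0` later provides the time bound. -/
theorem reduction_spec (hk : k ≤ n) {P : Program} {f : Tableau n → Ket n → Bits k → ℝ} {τ κ : ℕ}
    (hP : Answers O P f τ κ) {T : Tableau n} (hT : T ∈ cliffords n) (t : Bits (n - k)) (η : Ket k)
    (ψ : Ket k) {φ : Ket n}
    (hφ : φ = ∑ y, η y • (cliffordOp T *ᵥ basisKet (glue hk t y))) :
    (∀ s' ∈ (reduction P).run O (Config.start k T φ),
      s'.time ≤ reductionTime n + 2 * τ ∧ s'.calls = 2 * κ) ∧
    (reduction P).outputFidelity O T φ ψ = (2 ^ k : ℝ)⁻¹ * ∑ u, ∑ x, (∑ x',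
      corrFidelity (bxor x u) (bxor x' u) η ψ * f (twist k T)
        (cliffordOp (twist k T) *ᵥ basisKet (glue hk t u)) x') *
        f T (cliffordOp T *ᵥ basisKet (glue hk t u)) x := by
  obtain ⟨s1, r1, t1, c1, v1, hs1, h01, h11⟩ := setupProg_spec (O := O) hk T φ
  obtain ⟨g, r2, hg⟩ := randProg_spec (O := O) s1 hs1 (by
    rw [v1]
    refine Supp_mono ?_ (ket_mem_qarr 0 φ)
    intro q hq hq'
    have h1 : q.1 = 0 := hq
    have h2 : q.1 = 5 := hq'
    omega)
  have hS := twist_mem_cliffords k hT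
  have hrun : ∀ u, (∀ s' ∈ (Program.seq prepareProg (queryProg P)).run O (g u),
      s'.time ≤ reductionTime n + 2 * τ ∧ s'.calls = 2 * κ) ∧
      (((Program.seq prepareProg (queryProg P)).run O (g u)).map fun s' =>
        qmemNormSq (contract 1 k (fun y => star (ψ y)) s'.vec)).sum =
      (2 ^ k : ℝ)⁻¹ * ∑ x, (∑ x', corrFidelity (bxor x u) (bxor x' u) η ψ * f (twist k T)
        (cliffordOp (twist k T) *ᵥ basisKet (glue hk t u)) x') *
        f T (cliffordOp T *ᵥ basisKet (glue hk t u)) x := by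
    intro u
    obtain ⟨f2, v2⟩ := hg u
    obtain ⟨s3, r3, f3, v3⟩ := prepareProg_spec (O := O) hk hT hS (g u) (hs1.frame f2)
      (h01.frame f2) (h11.frame f2) u t η _ (by rw [v2, v1, hφ])
    have f13 := f2.trans' f3
    have hu1 : ∀ V : Op n, V ∈ Matrix.unitaryGroup (Bits n) ℂ → ∀ a,
        qmemNormSq (ket a (V *ᵥ basisKet fun _ => false)) = 1 := fun V hV a => by
      rw [qmemNormSq_ket, ketNormSq_unitary hV, ketNormSq_basisKet]
    have hstar : ∀ V : Op n, V ∈ Matrix.unitaryGroup (Bits n) ℂ →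
        Vᴴ ∈ Matrix.unitaryGroup (Bits n) ℂ := fun V hV => Unitary.star_mem hV
    have hTu := (cliffordOp_hasTableau hT).1.1
    have hSu := (cliffordOp_hasTableau hS).1.1
    have := queryProg_spec (O := O) hP hT hS (hs1.frame f13) (h01.frame f13) (h11.frame f13)
      (u := u) ?_ ?_ ?_ ?_ v3 ψ
    · rw [run_seq r3]
      refine ⟨fun s' hs' => ?_, ?_⟩
      · obtain ⟨h1, h2⟩ := this.1 s' hs'
        have ht := f13.time
        have hc := f13.calls
        rw [reductionTime]
        constructor <;> omega
      · rw [this.2, norm_pow, norm_inv, Complex.norm_real, Real.norm_of_nonneg (Real.sqrt_nonneg _),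
          ← pow_mul, mul_comm k 2, pow_mul, inv_pow, Real.sq_sqrt (by norm_num), inv_pow]
    · intro q hq
      rcases Finset.mem_union.1 (Finset.mem_coe.1 hq) with h | h
      · obtain ⟨j, -, rfl⟩ := mem_shiftBits.1 h
        rfl
      · exact (writeBits_subset 5 _ t h).1
    · intro i
      rw [Bool.eq_iff_iff, decide_eq_true_eq, Finset.mem_union, mem_shiftBits, mem_writeBits_iff]
      constructor
      · rintro (⟨j, hj, h⟩ | ⟨-, h, -⟩)
        · simp only [Prod.mk.injEq, true_and, Nat.add_left_cancel_iff] at h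
          rwa [Fin.ext h] at hj
        · omega
      · exact fun h => Or.inl ⟨i, h, rfl⟩
    · refine tens_mem_Supp (Supp_mono ?_ (ket_mem_qarr 0 _)) (tens_mem_Supp
        (Supp_mono ?_ (ket_mem_qarr 10 _)) (Supp_mono ?_ (ket_mem_qarr 11 _)))
      · exact fun q hq => Or.inl hq
      · exact fun q hq => Or.inr (Or.inl hq)
      · exact fun q hq => Or.inr (Or.inr hq)
    · rw [qmemNormSq_tens (A := qarr 0) (B := (qarr 0)ᶜ) disjoint_compl_right (ket_mem_qarr 0 _)
        (tens_mem_Supp (Supp_mono ?_ (ket_mem_qarr 10 _)) (Supp_mono ?_ (ket_mem_qarr 11 _))),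
        qmemNormSq_tens (A := qarr 10) (B := (qarr 10)ᶜ) disjoint_compl_right (ket_mem_qarr 10 _)
        (Supp_mono ?_ (ket_mem_qarr 11 _)), hu1 _ hTu, hu1 _ (hstar _ hTu),
        hu1 _ (hstar _ hSu)]
      · norm_num
      all_goals
        intro q hq hq'
        have h1 : q.1 = _ := hq
        have h2 : q.1 = _ := hq'
        omega
  rw [reduction, run_seq r1, Program.run, r2, Multiset.bind_map]
  constructor
  · intro s' hs'
    obtain ⟨u, -, hs'⟩ := Multiset.mem_bind.1 hs'
    exact (hrun u).1 s' hs'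
  · rw [Program.outputFidelity, run_seq r1, Program.run, r2, Multiset.bind_map, Multiset.map_bind,
      Multiset.sum_bind, Finset.mul_sum]
    exact Finset.sum_congr rfl fun u _ => (hrun u).2

end LSN

end

noncomputable section

namespace LSN

variable {n k : ℕ} {O : Option (Oracle n k)}

/-! ## Analysis of the reduction -/

/-- The answers of a measurement of an unnormalized state. -/
structure IsMeasurement (f : Tableau n → Ket n → Bits k → ℝ) : Prop where
  nonneg : ∀ T φ x, 0 ≤ f T φ x
  sum_eq : ∀ T φ, ∑ x, f T φ x = ketNormSq φ
  smul : ∀ T φ x (c : ℂ), f T (c • φ) x = ‖c‖ ^ 2 * f T φ x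

theorem Oracle.isMeasurement_prob (O : Oracle n k) : IsMeasurement O.prob :=
  ⟨fun _ _ _ => ketNormSq_nonneg _, O.sum_prob, O.prob_smul⟩

theorem Program.isMeasurement_outputProb (A : Program) :
    IsMeasurement (A.outputProb (none : Option (Oracle n k))) :=
  ⟨outputProb_nonneg none A, sum_outputProb A, outputProb_smul A⟩

theorem IsMeasurement.le_one {f : Tableau n → Ket n → Bits k → ℝ} (hf : IsMeasurement f)
    {T : Tableau n} {φ : Ket n} (hφ : ketNormSq φ = 1) (x : Bits k) : f T φ x ≤ 1 := by
  rw [← hφ, ← hf.sum_eq T φ]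
  exact Finset.single_le_sum (fun y _ => hf.nonneg T φ y) (Finset.mem_univ x)

theorem corrFidelity_nonneg (a b : Bits k) (η ψ : Ket k) : 0 ≤ corrFidelity a b η ψ := sq_nonneg _

theorem corrFidelity_applyXZ (a b : Bits k) {μ : ℂ} (hμ : ‖μ‖ = 1) {ψ : Ket k}
    (hψ : ketNormSq ψ = 1) : corrFidelity a b (μ • applyXZ a b ψ) ψ = 1 := by
  have h1 : applyZX a b (μ • applyXZ a b ψ) = μ • ψ := by
    conv_rhs => rw [← applyZX_applyXZ a b ψ]
    funext y
    simp only [applyZX, Pi.smul_apply, smul_eq_mul]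
    ring
  have h2 : ∑ y, star (ψ y) * (μ • ψ) y = μ := by
    have := ketNormSq_eq ψ
    rw [hψ, dotProduct] at this
    simp only [Pi.star_apply] at this
    calc ∑ y, star (ψ y) * (μ • ψ) y = μ * ∑ y, star (ψ y) * ψ y := by
          rw [Finset.mul_sum]
          refine Finset.sum_congr rfl fun y _ => ?_
          rw [Pi.smul_apply, smul_eq_mul]
          ring
      _ = μ := by rw [← this]; simp
  rw [corrFidelity, h1, h2, hμ, one_pow]

theorem continuous_corrFidelity (a b a' b' : Bits k) (μ : ℂ) :
    Continuous fun ψ : Ket k => corrFidelity a b (μ • applyXZ a' b' ψ) ψ := by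
  simp only [corrFidelity, applyZX, applyXZ, Pi.smul_apply, smul_eq_mul]
  fun_prop

/-- Only the branches with both answers correct, `u ⊕ a` and `u ⊕ b`, are kept. In these the
correction restores `ψ` up to a phase, and their weight is the product of two probabilities, bounded
below by their sum minus `1`. The bound does not depend on `ψ`. -/
theorem reduction_integral_ge (hk : k ≤ n) {P : Program} {f : Tableau n → Ket n → Bits k → ℝ}
    {τ κ : ℕ} (hP : Answers O P f τ κ) (hf : IsMeasurement f) {T : Tableau n}
    (hT : T ∈ cliffords n) (E : PauliString n) :
    (∑ u : Bits k, (f T (cliffordOp T *ᵥ basisKet (glue hk (slice 0 (n - k) (zsyn T E)) u))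
        (bxor u (slice (n - k) k (zsyn T E))) +
      f (twist k T) (cliffordOp (twist k T) *ᵥ
        basisKet (glue hk (slice 0 (n - k) (zsyn T E)) u))
        (bxor u (slice (n - k) k (xsyn T E))) - 1)) / 2 ^ k ≤
    ∫ ψ, (reduction P).outputFidelity O T (noisyCodeword hk T E ψ) ψ ∂haarState k := by
  obtain ⟨μ, hμ, hcode, -⟩ := noisyCodeword_eq hk hT E
  obtain ⟨t, ht⟩ : ∃ t, t = slice 0 (n - k) (zsyn T E) := ⟨_, rfl⟩
  obtain ⟨a, ha⟩ : ∃ a, a = slice (n - k) k (zsyn T E) := ⟨_, rfl⟩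
  obtain ⟨b, hb⟩ : ∃ b, b = slice (n - k) k (xsyn T E) := ⟨_, rfl⟩
  rw [← ht, ← ha, ← hb] at hcode
  rw [← ht, ← ha, ← hb]
  have hS := twist_mem_cliffords k hT
  have h1 : ∀ S ∈ cliffords n, ∀ u, ketNormSq (cliffordOp S *ᵥ basisKet (glue hk t u)) = 1 :=
    fun S hS u => by rw [ketNormSq_unitary (cliffordOp_hasTableau hS).1.1, ketNormSq_basisKet]
  have hfid := fun ψ => (reduction_spec hk hP hT t (μ • applyXZ a b ψ) ψ
    (φ := noisyCodeword hk T E ψ) (by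
      rw [hcode ψ, Finset.smul_sum]
      refine Finset.sum_congr rfl fun y _ => ?_
      rw [Pi.smul_apply, smul_smul, smul_eq_mul])).2
  simp only [hfid]
  have hint : ∀ r : ℝ, ∫ _ : Ket k, r ∂haarState k = r := fun r => by simp
  rw [← hint ((∑ u : Bits k, _) / _)]
  refine integral_haarState_mono continuous_const ?_ fun ψ hψ => ?_
  · refine continuous_const.mul (continuous_finsetSum _ fun u _ => continuous_finsetSum _
      fun x _ => Continuous.mul (continuous_finsetSum _ fun x' _ => ?_) continuous_const)
    exact (continuous_corrFidelity _ _ _ _ _).mul continuous_const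
  · rw [div_eq_inv_mul]
    refine mul_le_mul_of_nonneg_left (Finset.sum_le_sum fun u _ => ?_) (by positivity)
    have e : ∀ c : Bits k, bxor (bxor u c) u = c := fun c => by
      rw [bxor_comm u c, bxor_bxor_cancel]
    have n1 := hf.nonneg T (cliffordOp T *ᵥ basisKet (glue hk t u))
    have n2 := hf.nonneg (twist k T) (cliffordOp (twist k T) *ᵥ basisKet (glue hk t u))
    have l1 := hf.le_one (T := T) (h1 T hT u) (bxor u a)
    have l2 := hf.le_one (T := twist k T) (h1 _ hS u) (bxor u b)
    have hin : ∀ x x', 0 ≤ corrFidelity (bxor x u) (bxor x' u) (μ • applyXZ a b ψ) ψ *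
        f (twist k T) (cliffordOp (twist k T) *ᵥ basisKet (glue hk t u)) x' := fun x x' =>
      mul_nonneg (corrFidelity_nonneg _ _ _ _) (n2 x')
    refine le_trans ?_ (Finset.single_le_sum (fun x _ => mul_nonneg
      (Finset.sum_nonneg fun x' _ => hin x x') (n1 x)) (Finset.mem_univ (bxor u a)))
    refine le_trans ?_ (mul_le_mul_of_nonneg_right (Finset.single_le_sum
      (fun x' _ => hin (bxor u a) x') (Finset.mem_univ (bxor u b))) (n1 _))
    rw [e, e, corrFidelity_applyXZ a b hμ hψ]
    -- With both probabilities at most `1`, this is `(1 - P)(1 - Q) ≥ 0`.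
    nlinarith

/-- The lower bound of `reduction_integral_ge` is linear in the two success probabilities, so they
can be averaged separately. Each average is the success probability of the solver, by
`lsnAverage_eq` and `lsnAverage_eq_twist`; no relation between the two queries matters. -/
theorem reduction_slsnFidelity_ge (hk : k ≤ n) {p : ℝ} (hp0 : 0 < p) (hp1 : p < 1) {P : Program}
    {f : Tableau n → Ket n → Bits k → ℝ} {τ κ : ℕ} (hP : Answers O P f τ κ)
    (hf : IsMeasurement f) :
    2 * lsnAverage hk p f - 1 ≤ (reduction P).slsnFidelity hk p O := by
  have hphase : ∀ T φ x (c : ℂ), ‖c‖ = 1 → f T (c • φ) x = f T φ x := fun T φ x c hc => by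
    rw [hf.smul, hc, one_pow, one_mul]
  have hc : (0 : ℝ) < (cliffords n).card := by exact_mod_cast card_cliffords_pos n
  have hd : (0 : ℝ) < 2 ^ k := by positivity
  have key : 2 * lsnAverage hk p f - 1 = (∑ T ∈ cliffords n, ∑ E : PauliString n,
      depolarizing p E * ((∑ u : Bits k,
        (f T (cliffordOp T *ᵥ basisKet (glue hk (slice 0 (n - k) (zsyn T E)) u))
        (bxor u (slice (n - k) k (zsyn T E))) +
      f (twist k T) (cliffordOp (twist k T) *ᵥ
        basisKet (glue hk (slice 0 (n - k) (zsyn T E)) u))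
        (bxor u (slice (n - k) k (xsyn T E))) - 1)) / 2 ^ k)) / (cliffords n).card := by
    rw [two_mul]
    conv_lhs =>
      congr
      · congr
        · rw [lsnAverage_eq hk p hphase]
        · rw [lsnAverage_eq_twist hk p hphase]
    simp only [Finset.sum_sub_distrib, Finset.sum_add_distrib, Finset.sum_const, Finset.card_univ,
      card_bits, sub_div, add_div, mul_sub, mul_add, nsmul_eq_mul, mul_one]
    have e1 : ∑ E : PauliString n, depolarizing p E * (((2 ^ k : ℕ) : ℝ) / 2 ^ k) = 1 := by
      push_cast
      simp only [div_self hd.ne', mul_one, sum_depolarizing]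
    rw [e1, mul_one, div_self hc.ne']
    simp only [← Finset.mul_sum, mul_div_assoc', ← Finset.sum_div, div_div,
      mul_comm ((2 : ℝ) ^ k)]
  rw [key, Program.slsnFidelity, slsnAverage]
  refine div_le_div_of_nonneg_right (Finset.sum_le_sum fun T hT => Finset.sum_le_sum fun E _ =>
    mul_le_mul_of_nonneg_left (reduction_integral_ge hk hP hf hT E)
      (depolarizing_nonneg hp0 hp1 E)) hc.le

/-- `reduction_spec` speaks only of states with a definite syndrome. Since time and calls do not
depend on the input state (`run_forget`), the zero vector, which has the required form with `η = 0`,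
covers all states. -/
theorem reduction_time_calls (hk : k ≤ n) {P : Program} {f : Tableau n → Ket n → Bits k → ℝ}
    {τ κ : ℕ} (hP : Answers O P f τ κ) :
    (reduction P).TimeAtMost O (reductionTime n + 2 * τ) ∧
      (reduction P).CallsExactly O (2 * κ) := by
  have h : ∀ T ∈ cliffords n, ∀ φ : Ket n, ∀ s ∈ (reduction P).run O (Config.start k T φ),
      s.time ≤ reductionTime n + 2 * τ ∧ s.calls = 2 * κ := by
    intro T hT φ s hs
    obtain ⟨c, hc, e⟩ := exists_mem_run (s' := Config.start k T (0 : Ket n))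
      (show (Config.start k T φ).forget = (Config.start k T (0 : Ket n)).forget from rfl) hs
    have ht : c.forget.time = s.forget.time := congrArg Config.time e
    have hcalls : c.forget.calls = s.forget.calls := congrArg Config.calls e
    rw [show s.time = c.time from ht.symm, show s.calls = c.calls from hcalls.symm]
    exact (reduction_spec hk hP hT (fun _ => false) 0 0 (by simp)).1 c hc
  exact ⟨fun T hT φ s hs => (h T hT φ s hs).1, fun T hT φ s hs => (h T hT φ s hs).2⟩

theorem exists_polynomial_reductionTime : ∃ q : Polynomial ℕ, ∀ n, q.eval n = reductionTime n := by
  open Polynomial in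
  refine ⟨C 80 + C 95 * X + C 60 * X * X + C 6 * (X * (C 60 * (X + 1) + C 21)), fun n => ?_⟩
  simp [reductionTime]

/-- Twice the assumed lower bound on `f`, minus `1`, is the target exactly, so the exponent `d` does
not change. -/
theorem exceeds_of_half {k : ℕ → ℕ} {f g : ℕ → ℝ}
    (h : ∃ d : ℕ, ∀ᶠ n : ℕ in atTop, 1 / 2 * (1 + 1 / 2 ^ k n + 1 / (n : ℝ) ^ d) ≤ f n)
    (hfg : ∀ n, 2 * f n - 1 ≤ g n) : ExceedsByInvPoly g fun n => 1 / 2 ^ k n := by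
  obtain ⟨d, hd⟩ := h
  refine ⟨d, ?_⟩
  filter_upwards [hd] with n hn
  linarith [hfg n]

theorem guessProg_time_calls (hk : k ≤ n) (O : Oracle n k) :
    guessProg.TimeAtMost (some O) (11 + 20 * n) ∧ guessProg.CallsExactly (some O) 1 := by
  constructor
  all_goals
    intro T _ φ s hs
    obtain ⟨g, hg, h⟩ := guessProg_run O T φ
    rw [hg, Multiset.mem_map] at hs
    obtain ⟨o, -, rfl⟩ := hs
    obtain ⟨h1, h2, -⟩ := h o
    omega

end LSN

end

theorem mainTheorem12 :
    -- few logical qubits: an oracle for Search LSN with any non-negligible advantage, one call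
    (∃ B : LSN.Program,
      (∃ t : Polynomial ℕ, ∀ (n k : ℕ), k ≤ n → ∀ O : LSN.Oracle n k,
        B.TimeAtMost (some O) (t.eval n) ∧ B.CallsExactly (some O) 1) ∧
      ∀ (k : ℕ → ℕ) (hk : ∀ n, k n ≤ n) (p : ℕ → ℝ), (∀ n, 0 < p n ∧ p n < 1) →
        Asymptotics.IsBigO Filter.atTop (fun n => (k n : ℝ)) (fun n => Real.log n) →
        ∀ O : (n : ℕ) → LSN.Oracle n (k n),
          LSN.ExceedsByInvPoly (fun n => (O n).lsnSuccess (hk n) (p n))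
            (fun n => 1 / 2 ^ k n) →
          LSN.ExceedsByInvPoly (fun n => B.slsnFidelity (hk n) (p n) (some (O n)))
            (fun n => 1 / 2 ^ k n)) ∧
    -- arbitrary `k`: an oracle for Search LSN with high success probability, two calls
    (∃ B : LSN.Program,
      (∃ t : Polynomial ℕ, ∀ (n k : ℕ), k ≤ n → ∀ O : LSN.Oracle n k,
        B.TimeAtMost (some O) (t.eval n) ∧ B.CallsExactly (some O) 2) ∧
      ∀ (k : ℕ → ℕ) (hk : ∀ n, k n ≤ n) (p : ℕ → ℝ), (∀ n, 0 < p n ∧ p n < 1) →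
        ∀ O : (n : ℕ) → LSN.Oracle n (k n),
          (∃ d : ℕ, ∀ᶠ n : ℕ in Filter.atTop,
            1 / 2 * (1 + 1 / 2 ^ k n + 1 / (n : ℝ) ^ d) ≤ (O n).lsnSuccess (hk n) (p n)) →
          LSN.ExceedsByInvPoly (fun n => B.slsnFidelity (hk n) (p n) (some (O n)))
            (fun n => 1 / 2 ^ k n)) ∧
    -- arbitrary `k`: an efficient algorithm in place of the oracle
    (∀ (k : ℕ → ℕ) (hk : ∀ n, k n ≤ n) (p : ℕ → ℝ), (∀ n, 0 < p n ∧ p n < 1) →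
      ∀ A : LSN.Program,
        (∃ t : Polynomial ℕ, ∀ n, A.TimeAtMost (n := n) (k := k n) none (t.eval n)) →
        (∃ d : ℕ, ∀ᶠ n : ℕ in Filter.atTop,
          1 / 2 * (1 + 1 / 2 ^ k n + 1 / (n : ℝ) ^ d) ≤ A.lsnSuccess (hk n) (p n) none) →
        ∃ B : LSN.Program,
          (∃ t : Polynomial ℕ, ∀ n, B.TimeAtMost (n := n) (k := k n) none (t.eval n)) ∧
          LSN.ExceedsByInvPoly (fun n => B.slsnFidelity (hk n) (p n) none)
            (fun n => 1 / 2 ^ k n)) := by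
  refine ⟨⟨LSN.guessProg, ⟨Polynomial.C 11 + Polynomial.C 20 * Polynomial.X,
    fun n k hk O => ?_⟩, fun k hk p _ hlog O h => LSN.guessProg_exceeds hk hlog O h⟩,
    ⟨LSN.reduction (.query 0 1 2 0 3), ?_, fun k hk p hp O h => ?_⟩, ?_⟩
  · simpa using LSN.guessProg_time_calls hk O
  · obtain ⟨q, hq⟩ := LSN.exists_polynomial_reductionTime
    -- A call of the oracle takes one step, and there are two calls.
    refine ⟨q + 2, fun n k hk O => ?_⟩
    have := LSN.reduction_time_calls hk (LSN.answers_of_oracle O)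
    simpa [hq] using this
  · exact LSN.exceeds_of_half h fun n => LSN.reduction_slsnFidelity_ge (hk n) (hp n).1 (hp n).2
      (LSN.answers_of_oracle (O n)) (O n).isMeasurement_prob
  · rintro k hk p hp A ⟨t, ht⟩ h
    obtain ⟨q, hq⟩ := LSN.exists_polynomial_reductionTime
    -- The algorithm runs twice, hence `2 * t`.
    refine ⟨LSN.reduction A, ⟨q + 2 * t, fun n => ?_⟩, LSN.exceeds_of_half h fun n =>
      LSN.reduction_slsnFidelity_ge (hk n) (hp n).1 (hp n).2 (LSN.answers_of_program (ht n))
        A.isMeasurement_outputProb⟩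
    have := (LSN.reduction_time_calls (hk n) (LSN.answers_of_program (ht n))).1
    simpa [hq] using this
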